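/- Let $\mathfrak g$ be a finite-dimensional complex semisimple Lie algebra, $\mathfrak h\subset\mathfrak g$ a Cartan subalgebra, $\{\alpha_i\}_{i\in I}$ a choice of simple roots and $D$ a subset of the simple roots (a subdiagram of the Dynkin diagram). Let $\mathfrak g_D\subseteq\mathfrak g$ be the subalgebra generated by the root spaces $\mathfrak g_{\pm\alpha}$, $\alpha\in D$, let $R_D$ be its root system, let $\mathfrak l_D=\mathfrak g_D+\mathfrak h$ be the corresponding Levi subalgebra and $\mathfrak c_D$ the centre of $\mathfrak l_D$. Let $(\cdot,\cdot)$ be a non-degenerate, ad-invariant, symmetric bilinear form on $\mathfrak g$. For every positive root $\alpha$ let $e_\alpha\in\mathfrak g_\alpha$, $f_\alpha\in\mathfrak g_{-\alpha}$ be root vectors such that $[e_\alpha,f_\alpha]=h_\alpha$ is the coroot of $\alpha$, and set $$r_{\mathfrak g}=\sum_{\alpha\succ0}\frac{(\alpha,\alpha)}2\,e_\alpha\wedge f_\alpha\in\bigwedge\nolimits^2\mathfrak g,\qquad r_D=\sum_{\alpha\succ0,\ \alpha\in R_D}\frac{(\alpha,\alpha)}2\,e_\alpha\wedge f_\alpha\in\bigwedge\nolimits^2\mathfrak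 g_D,$$ where $(\alpha,\alpha)$ is computed with the form induced on $\mathfrak h^*$. Let $[\![\cdot,\cdot]\!]$ be the Schouten bracket on $\bigwedge\mathfrak g$, $$[\![X_1\wedge\cdots\wedge X_k,\,Y_1\wedge\cdots\wedge Y_l]\!]=\sum_{i,j}(-1)^{i+j}[X_i,Y_j]\wedge X_1\wedge\cdots\widehat{X_i}\cdots\wedge X_k\wedge Y_1\wedge\cdots\widehat{Y_j}\cdots\wedge Y_l .$$ Then $d=[\![r_{\mathfrak g}-r_D,\cdot]\!]$ maps $(\bigwedge^k\mathfrak g)^{\mathfrak g_D}$ to $(\bigwedge^{k+1}\mathfrak g)^{\mathfrak g_D}$ for all $k\ge0$ and satisfies $d^2=0$ there, and the cohomology of the complex $\big((\bigwedge\mathfrak g)^{\mathfrak g_D},d\big)$ in low degrees is $$H^1\cong\mathfrak c_D,\qquad H^2\cong\bigwedge\nolimits^2\mathfrak c_D,\qquad H^3\cong\bigwedge\nolimits^3\mathfrak c_D\oplus\big(\bigwedge\nolimits^3\mathfrak g_D\big)^{\mathfrak g_D},$$ where each isomorphism sends an element of the right-hand side, regarded as an element of $\bigwedge\mathfrak g$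 through the inclusions $\mathfrak c_D,\mathfrak g_D\subseteq\mathfrak g$, to its cohomology class. -/

import Mathlib

open scoped ExteriorAlgebra

noncomputable section

namespace RelTwist

/-! ### Derivations of the exterior algebra and the Schouten bracket -/

section Exterior

variable {R L : Type*} [CommRing R]

section Module

variable [AddCommGroup L] [Module R L]

/-- The linear map `X ↦ ((a, u) ↦ (X ∧ a, T X ∧ a + X ∧ u))` from which the derivation
extending `T` is built. -/
def derStep (T : Module.End R L) :
    L →ₗ[R] (ExteriorAlgebra R L × ExteriorAlgebra R L) →ₗ[R]
      (ExteriorAlgebra R L × ExteriorAlgebra R L) :=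
  LinearMap.mk₂ R
    (fun X p => (ExteriorAlgebra.ι R X * p.1,
      ExteriorAlgebra.ι R (T X) * p.1 + ExteriorAlgebra.ι R X * p.2))
    (by intro X Y p; ext <;> simp [add_mul]; abel)
    (by intro c X p; ext <;> simp)
    (by intro X p q; ext <;> simp [mul_add]; abel)
    (by intro c X p; ext <;> simp)

theorem derStep_apply (T : Module.End R L) (X : L)
    (p : ExteriorAlgebra R L × ExteriorAlgebra R L) :
    derStep T X p = (ExteriorAlgebra.ι R X * p.1,
      ExteriorAlgebra.ι R (T X) * p.1 + ExteriorAlgebra.ι R X * p.2) := rfl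

theorem left_induction {P : ExteriorAlgebra R L → Prop}
    (one : ∀ r : R, P (r • 1)) (add : ∀ a b, P a → P b → P (a + b))
    (ι_mul : ∀ (a : ExteriorAlgebra R L) (X : L), P a → P (ExteriorAlgebra.ι R X * a))
    (a : ExteriorAlgebra R L) : P a := by
  refine CliffordAlgebra.left_induction (Q := (0 : QuadraticForm R L)) ?_ add
    (fun a X h => ι_mul a X h) a
  intro r
  rw [Algebra.algebraMap_eq_smul_one]
  exact one r

theorem foldr_ι_mul {N : Type*} [AddCommGroup N] [Module R N] (f : L →ₗ[R] N →ₗ[R] N)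
    (hf : ∀ m x, f m (f m x) = (0 : QuadraticForm R L) m • x) (n : N) (X : L)
    (a : ExteriorAlgebra R L) :
    CliffordAlgebra.foldr (0 : QuadraticForm R L) f hf n (ExteriorAlgebra.ι R X * a)
      = f X (CliffordAlgebra.foldr (0 : QuadraticForm R L) f hf n a) := by
  rw [CliffordAlgebra.foldr_mul]
  exact CliffordAlgebra.foldr_ι _ _ _ _ _

theorem derStep_sq (T : Module.End R L) (X : L) (p : ExteriorAlgebra R L × ExteriorAlgebra R L) :
    derStep T X (derStep T X p) = (0 : QuadraticForm R L) X • p := by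
  have h1 : ExteriorAlgebra.ι R X * ExteriorAlgebra.ι R X = 0 := ExteriorAlgebra.ι_sq_zero X
  have h2 := ExteriorAlgebra.ι_add_mul_swap (R := R) (T X) X
  ext
  · simp [derStep, ← mul_assoc, h1]
  · simp [derStep, ← mul_assoc, h1, mul_add, ← add_mul, h2]

/-- The derivation `T^∧` of the exterior algebra which extends the endomorphism `T`:
`T^∧ (X₁ ∧ ⋯ ∧ Xₖ) = ∑ᵢ X₁ ∧ ⋯ ∧ T Xᵢ ∧ ⋯ ∧ Xₖ`. -/
def extDer (T : Module.End R L) : Module.End R (ExteriorAlgebra R L) :=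
  LinearMap.snd R _ _ ∘ₗ
    CliffordAlgebra.foldr (0 : QuadraticForm R L) (derStep T) (derStep_sq T) (1, 0)

theorem foldr_derStep_fst (T : Module.End R L) (a : ExteriorAlgebra R L) :
    (CliffordAlgebra.foldr (0 : QuadraticForm R L) (derStep T) (derStep_sq T) (1, 0) a).1 = a := by
  induction a using left_induction with
  | one r => simp
  | add a b ha hb => simp [ha, hb]
  | ι_mul a X ha =>
    rw [foldr_ι_mul, derStep_apply, ha]

@[simp] theorem extDer_one (T : Module.End R L) : extDer T 1 = 0 := by
  simp [extDer]

theorem extDer_ι_mul (T : Module.End R L) (X : L) (a : ExteriorAlgebra R L) :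
    extDer T (ExteriorAlgebra.ι R X * a)
      = ExteriorAlgebra.ι R (T X) * a + ExteriorAlgebra.ι R X * extDer T a := by
  simp only [extDer, LinearMap.comp_apply, foldr_ι_mul, derStep_apply, LinearMap.snd_apply]
  rw [foldr_derStep_fst]

@[simp] theorem extDer_ι (T : Module.End R L) (X : L) :
    extDer T (ExteriorAlgebra.ι R X) = ExteriorAlgebra.ι R (T X) := by
  simpa using extDer_ι_mul T X 1

theorem extDer_mul (T : Module.End R L) (a b : ExteriorAlgebra R L) :
    extDer T (a * b) = extDer T a * b + a * extDer T b := by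
  induction a using left_induction with
  | one r => simp
  | add a a' ha ha' => simp only [add_mul, map_add, ha, ha']; abel
  | ι_mul a X ha =>
    rw [mul_assoc, extDer_ι_mul, extDer_ι_mul, ha]
    simp only [add_mul, mul_add, mul_assoc, add_assoc]

theorem ext_of_ι_mul {M : Type*} [AddCommGroup M] [Module R M]
    {f g : ExteriorAlgebra R L →ₗ[R] M} (h1 : f 1 = g 1)
    (h2 : ∀ (X : L) (a : ExteriorAlgebra R L), f a = g a →
      f (ExteriorAlgebra.ι R X * a) = g (ExteriorAlgebra.ι R X * a)) : f = g := by
  refine LinearMap.ext fun a => ?_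
  induction a using left_induction with
  | one r => simp [h1]
  | add a a' ha ha' => simp [ha, ha']
  | ι_mul a X ha => exact h2 X a ha

theorem extDer_add (S T : Module.End R L) : extDer (S + T) = extDer S + extDer T := by
  refine ext_of_ι_mul (by simp) fun X a h => ?_
  simp only [LinearMap.add_apply] at h
  simp only [extDer_ι_mul, LinearMap.add_apply, h, map_add, add_mul, mul_add]
  abel

theorem extDer_smul (c : R) (T : Module.End R L) : extDer (c • T) = c • extDer T := by
  refine ext_of_ι_mul (by simp) fun X a h => ?_
  simp only [LinearMap.smul_apply] at h
  simp only [extDer_ι_mul, LinearMap.smul_apply, h, map_smul, smul_mul_assoc, mul_smul_comm,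
    smul_add]

end Module

variable [LieRing L] [LieAlgebra R L]

/-- The adjoint action of the Lie algebra `L` on its exterior algebra. -/
def adExt : L →ₗ[R] Module.End R (ExteriorAlgebra R L) where
  toFun X := extDer (LieAlgebra.ad R L X)
  map_add' X Y := by rw [map_add, extDer_add]
  map_smul' c X := by rw [map_smul, extDer_smul]; rfl

/-- The linear map `X ↦ ((a, u) ↦ (X ∧ a, X ∧ u(·) + (-1)^{deg a} a ∧ ad(X)(·)))` from which
the Schouten bracket is built. -/
def schoutenStep :
    L →ₗ[R] (ExteriorAlgebra R L × Module.End R (ExteriorAlgebra R L)) →ₗ[R]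
      (ExteriorAlgebra R L × Module.End R (ExteriorAlgebra R L)) :=
  LinearMap.mk₂ R
    (fun X p => (ExteriorAlgebra.ι R X * p.1,
      LinearMap.mulLeft R (ExteriorAlgebra.ι R X) ∘ₗ p.2
        + LinearMap.mulLeft R (CliffordAlgebra.involute p.1) ∘ₗ adExt X))
    (by intro X Y p
        refine Prod.ext (by simp [add_mul]) (LinearMap.ext fun y => ?_)
        simp [add_mul, mul_add]; abel)
    (by intro c X p
        refine Prod.ext (by simp) (LinearMap.ext fun y => ?_)
        simp)
    (by intro X p q
        refine Prod.ext (by simp [mul_add]) (LinearMap.ext fun y => ?_)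
        simp [add_mul, mul_add]; abel)
    (by intro c X p
        refine Prod.ext (by simp) (LinearMap.ext fun y => ?_)
        simp)

theorem schoutenStep_apply (X : L)
    (p : ExteriorAlgebra R L × Module.End R (ExteriorAlgebra R L)) :
    schoutenStep X p = (ExteriorAlgebra.ι R X * p.1,
      LinearMap.mulLeft R (ExteriorAlgebra.ι R X) ∘ₗ p.2
        + LinearMap.mulLeft R (CliffordAlgebra.involute p.1) ∘ₗ adExt X) := rfl

theorem schoutenStep_sq (X : L)
    (p : ExteriorAlgebra R L × Module.End R (ExteriorAlgebra R L)) :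
    schoutenStep X (schoutenStep X p) = (0 : QuadraticForm R L) X • p := by
  have h1 : ExteriorAlgebra.ι R X * ExteriorAlgebra.ι R X = 0 := ExteriorAlgebra.ι_sq_zero X
  refine Prod.ext ?_ (LinearMap.ext fun y => ?_)
  · simp [schoutenStep, ← mul_assoc, h1]
  · have h3 : (CliffordAlgebra.involute (ExteriorAlgebra.ι R X) : ExteriorAlgebra R L)
        = - ExteriorAlgebra.ι R X := CliffordAlgebra.involute_ι X
    simp [schoutenStep, ← mul_assoc, h1, mul_add, h3]

/-- The Schouten bracket `⟦·,·⟧` on the exterior algebra of a Lie algebra. It is determined by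
`⟦1, Y⟧ = 0` and `⟦X ∧ a, Y⟧ = X ∧ ⟦a, Y⟧ + (-1)^{deg a} a ∧ ad(X) Y`; the usual formula on
products of elements of `L` is `schouten_ιMulti`. -/
def schouten : ExteriorAlgebra R L →ₗ[R] ExteriorAlgebra R L →ₗ[R] ExteriorAlgebra R L :=
  LinearMap.snd R _ _ ∘ₗ
    CliffordAlgebra.foldr (0 : QuadraticForm R L) schoutenStep schoutenStep_sq (1, 0)

theorem foldr_schoutenStep_fst (a : ExteriorAlgebra R L) :
    (CliffordAlgebra.foldr (0 : QuadraticForm R L) schoutenStep schoutenStep_sq (1, 0) a).1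
      = a := by
  induction a using left_induction with
  | one r => simp
  | add a b ha hb => simp [ha, hb]
  | ι_mul a X ha =>
    rw [foldr_ι_mul, schoutenStep_apply, ha]

@[simp] theorem schouten_one (y : ExteriorAlgebra R L) : schouten (R := R) 1 y = 0 := by
  simp [schouten]

theorem schouten_ι_mul (X : L) (a y : ExteriorAlgebra R L) :
    schouten (ExteriorAlgebra.ι R X * a) y
      = ExteriorAlgebra.ι R X * schouten a y + CliffordAlgebra.involute a * adExt X y := by
  simp only [schouten, LinearMap.comp_apply, foldr_ι_mul, schoutenStep_apply, LinearMap.snd_apply]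
  rw [foldr_schoutenStep_fst]
  simp

theorem adExt_ιMulti (X : L) (l : ℕ) (Y : Fin (l + 1) → L) :
    adExt X (ExteriorAlgebra.ιMulti R (l + 1) Y)
      = ∑ j : Fin (l + 1), (-1 : R) ^ (j : ℕ) •
          (ExteriorAlgebra.ι R ⁅X, Y j⁆ * ExteriorAlgebra.ιMulti R l (j.removeNth Y)) := by
  induction l with
  | zero =>
    simp [adExt, ExteriorAlgebra.ιMulti_succ_apply]
  | succ l ih =>
    rw [ExteriorAlgebra.ιMulti_succ_apply]
    have h : adExt X (ExteriorAlgebra.ι R (Y 0) * ExteriorAlgebra.ιMulti R (l + 1) (Matrix.vecTail Y))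
        = ExteriorAlgebra.ι R ⁅X, Y 0⁆ * ExteriorAlgebra.ιMulti R (l + 1) (Matrix.vecTail Y)
          + ExteriorAlgebra.ι R (Y 0) *
            adExt X (ExteriorAlgebra.ιMulti R (l + 1) (Matrix.vecTail Y)) :=
      extDer_ι_mul _ _ _
    rw [h, ih, Finset.mul_sum]
    conv_rhs => rw [Fin.sum_univ_succ]
    congr 1
    · simp [Fin.tail, Matrix.vecTail, Function.comp_def]
    · refine Finset.sum_congr rfl fun j _ => ?_
      rw [ExteriorAlgebra.ιMulti_succ_apply (v := j.succ.removeNth Y)]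
      have e1 : j.succ.removeNth Y 0 = Y 0 := by simp [Fin.removeNth]
      have e2 : Matrix.vecTail (j.succ.removeNth Y) = j.removeNth (Matrix.vecTail Y) := by
        funext i; simp [Matrix.vecTail, Fin.removeNth, Fin.succ_succAbove_succ]
      have e3 := eq_neg_of_add_eq_zero_left
        (ExteriorAlgebra.ι_add_mul_swap (R := R) (Y 0) ⁅X, Matrix.vecTail Y j⁆)
      rw [e1, e2, mul_smul_comm, ← mul_assoc, e3, ← mul_assoc]
      simp [pow_succ, Matrix.vecTail]

theorem ιMulti_mul_ι (k : ℕ) (X : Fin k → L) (Z : L) :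
    ExteriorAlgebra.ιMulti R k X * ExteriorAlgebra.ι R Z
      = (-1 : R) ^ k • (ExteriorAlgebra.ι R Z * ExteriorAlgebra.ιMulti R k X) := by
  induction k with
  | zero => simp
  | succ k ih =>
    have e3 := eq_neg_of_add_eq_zero_left (ExteriorAlgebra.ι_add_mul_swap (R := R) (X 0) Z)
    rw [ExteriorAlgebra.ιMulti_succ_apply, mul_assoc, ih, mul_smul_comm, ← mul_assoc, e3,
      ← mul_assoc]
    simp [pow_succ]

theorem involute_ιMulti (k : ℕ) (X : Fin k → L) :
    CliffordAlgebra.involute (ExteriorAlgebra.ιMulti R k X)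
      = (-1 : R) ^ k • ExteriorAlgebra.ιMulti R k X := by
  induction k with
  | zero => simp
  | succ k ih =>
    have h3 : (CliffordAlgebra.involute (ExteriorAlgebra.ι R (X 0)) : ExteriorAlgebra R L)
        = - ExteriorAlgebra.ι R (X 0) := CliffordAlgebra.involute_ι (X 0)
    rw [ExteriorAlgebra.ιMulti_succ_apply, map_mul, ih, h3]
    simp [pow_succ]

theorem schouten_ιMulti_left (k : ℕ) (X : Fin (k + 1) → L) (y : ExteriorAlgebra R L) :
    schouten (ExteriorAlgebra.ιMulti R (k + 1) X) y
      = ∑ i : Fin (k + 1), (-1 : R) ^ (k + (i : ℕ)) •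
          (ExteriorAlgebra.ιMulti R k (i.removeNth X) * adExt (X i) y) := by
  induction k with
  | zero =>
    rw [ExteriorAlgebra.ιMulti_succ_apply, schouten_ι_mul]
    simp
  | succ k ih =>
    rw [ExteriorAlgebra.ιMulti_succ_apply, schouten_ι_mul, ih, Finset.mul_sum,
      add_comm, involute_ιMulti]
    conv_rhs => rw [Fin.sum_univ_succ]
    congr 1
    · simp [Fin.tail, Matrix.vecTail, Function.comp_def]
    · refine Finset.sum_congr rfl fun j _ => ?_
      rw [ExteriorAlgebra.ιMulti_succ_apply (v := j.succ.removeNth X)]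
      have e1 : j.succ.removeNth X 0 = X 0 := by simp [Fin.removeNth]
      have e2 : Matrix.vecTail (j.succ.removeNth X) = j.removeNth (Matrix.vecTail X) := by
        funext i; simp [Matrix.vecTail, Fin.removeNth, Fin.succ_succAbove_succ]
      rw [e1, e2, mul_smul_comm, mul_assoc]
      congr 1
      simp only [Fin.val_succ, pow_add, pow_one]
      ring

/-- The explicit formula for the Schouten bracket: with indices counted from `0`,
`⟦X₀ ∧ ⋯ ∧ Xₖ, Y₀ ∧ ⋯ ∧ Yₗ⟧ = ∑ (-1)^{i+j} [Xᵢ, Yⱼ] ∧ X₀ ∧ ⋯ X̂ᵢ ⋯ ∧ Xₖ ∧ Y₀ ∧ ⋯ Ŷⱼ ⋯ ∧ Yₗ`. -/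
theorem schouten_ιMulti (k l : ℕ) (X : Fin (k + 1) → L) (Y : Fin (l + 1) → L) :
    schouten (ExteriorAlgebra.ιMulti R (k + 1) X) (ExteriorAlgebra.ιMulti R (l + 1) Y)
      = ∑ i : Fin (k + 1), ∑ j : Fin (l + 1), (-1 : R) ^ ((i : ℕ) + (j : ℕ)) •
          (ExteriorAlgebra.ι R ⁅X i, Y j⁆ * ExteriorAlgebra.ιMulti R k (i.removeNth X)
            * ExteriorAlgebra.ιMulti R l (j.removeNth Y)) := by
  rw [schouten_ιMulti_left]
  refine Finset.sum_congr rfl fun i _ => ?_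
  rw [adExt_ιMulti, Finset.mul_sum, Finset.smul_sum]
  refine Finset.sum_congr rfl fun j _ => ?_
  rw [mul_smul_comm, ← mul_assoc, ιMulti_mul_ι, smul_mul_assoc, smul_smul, smul_smul]
  congr 1
  have : ((-1 : R) ^ k) * (-1) ^ k = 1 := by rw [← mul_pow]; simp
  rw [pow_add, pow_add]
  linear_combination ((-1 : R) ^ (i : ℕ) * (-1) ^ (j : ℕ)) * this

/-! ### Invariants and cohomology -/

/-- The space `(⋀ᵏ L)^K` of elements of degree `k` of the exterior algebra of `L` which are
invariant under the adjoint action of the subalgebra `K`. -/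
def invariants (K : LieSubalgebra R L) (k : ℕ) : Submodule R (ExteriorAlgebra R L) :=
  (⋀[R]^k L) ⊓ ⨅ X : K, LinearMap.ker (adExt (R := R) (X : L))

/-- The elements of `(⋀ᵏ L)^K` annihilated by `⟦ρ, ·⟧`. -/
def cocycles (ρ : ExteriorAlgebra R L) (K : LieSubalgebra R L) (k : ℕ) :
    Submodule R (ExteriorAlgebra R L) :=
  invariants K k ⊓ LinearMap.ker (schouten ρ)

/-- The image of `(⋀ᵏ⁻¹ L)^K` under `⟦ρ, ·⟧`, and `0` when `k = 0`. -/
def coboundaries (ρ : ExteriorAlgebra R L) (K : LieSubalgebra R L) :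
    ℕ → Submodule R (ExteriorAlgebra R L)
  | 0 => ⊥
  | k + 1 => (invariants K k).map (schouten ρ)

/-- The `k`-th cohomology of `((⋀ L)^K, ⟦ρ, ·⟧)`. -/
abbrev Cohomology (ρ : ExteriorAlgebra R L) (K : LieSubalgebra R L) (k : ℕ) : Type _ :=
  cocycles ρ K k ⧸ (coboundaries ρ K k).submoduleOf (cocycles ρ K k)

/-- The cohomology class of a cocycle. -/
def cohomologyClass (ρ : ExteriorAlgebra R L) (K : LieSubalgebra R L) (k : ℕ) :
    cocycles ρ K k →ₗ[R] Cohomology ρ K k :=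
  ((coboundaries ρ K k).submoduleOf (cocycles ρ K k)).mkQ

end Exterior

/-! ### Diagrammatic subalgebras and standard solutions of the classical Yang-Baxter equation -/

section Semisimple

open LieAlgebra LieAlgebra.IsKilling

variable {g : Type*} [LieRing g] [LieAlgebra ℂ g] [FiniteDimensional ℂ g] [IsSemisimple ℂ g]
  {H : LieSubalgebra ℂ g} [H.IsCartanSubalgebra]

/-- The diagrammatic subalgebra `g_D`, generated by the root spaces of `α` and `-α` for the
roots `α` in `D` (a set of simple roots in the application). -/
def diagSubalgebra (D : Finset H.root) : LieSubalgebra ℂ g :=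
  LieSubalgebra.lieSpan ℂ g
    {x | ∃ α ∈ D, x ∈ rootSpace H α.1 ∨ x ∈ rootSpace H (-(α.1 : H → ℂ))}

/-- The Levi subalgebra `l_D` generated by `g_D` and the Cartan subalgebra. -/
def leviSubalgebra (D : Finset H.root) : LieSubalgebra ℂ g :=
  diagSubalgebra D ⊔ H

/-- The centre `c_D` of the Levi subalgebra, as a subspace of `g`. -/
def leviCenter (D : Finset H.root) : Submodule ℂ g :=
  (LieAlgebra.center ℂ (leviSubalgebra D)).toSubmodule.map
    (leviSubalgebra D).toSubmodule.subtype

/-- The root system `R_D` of `g_D`: the roots of `g` whose root space lies in `g_D`. -/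
def diagRoots (D : Finset H.root) : Set H.root :=
  {α | ∀ x ∈ rootSpace H α.1, x ∈ diagSubalgebra D}

open Classical in
/-- The bilinear form induced on the dual of `V` by a nondegenerate bilinear form on `V`. -/
def dualForm {V : Type*} [AddCommGroup V] [Module ℂ V] [FiniteDimensional ℂ V]
    (B : LinearMap.BilinForm ℂ V) (φ ψ : Module.Dual ℂ V) : ℂ :=
  if h : B.Nondegenerate then φ ((LinearMap.BilinForm.toDual B h).symm ψ) else 0

/-- The number `(α, α)`, for the form on the dual of the Cartan subalgebra induced by the
restriction of `B`. -/
def rootNormSq (B : LinearMap.BilinForm ℂ g) (α : H.root) : ℂ :=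
  dualForm (B.restrict H.toSubmodule) ((rootSystem H).root α) ((rootSystem H).root α)

/-- `e α` and `f α` are root vectors for `α` and `-α` with `[e α, f α]` the coroot of `α`, for
every positive root `α`. -/
def IsRootVectorFamily (b : (rootSystem H).Base) (e f : H.root → g) : Prop :=
  ∀ α : H.root, b.IsPos α →
    e α ∈ rootSpace H α.1 ∧ f α ∈ rootSpace H (-(α.1 : H → ℂ)) ∧
      ⁅e α, f α⁆ = (((rootSystem H).coroot α : H) : g)

open Classical in
/-- The bivector `∑ (α, α)/2 • e α ∧ f α`, summed over the positive roots `α` in `S`. It is the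
standard solution `r_g` of the modified classical Yang-Baxter equation for `g` when `S` is the
set of all roots. When `S` is the root system of `g_D`, it is the standard solution `r_D` for
`g_D` and the restricted form: `(α, α)` is the same for the form and for its restriction, since
`2 α / (α, α)` corresponds to the coroot of `α`, which lies in `g_D`. -/
def standardSolution (B : LinearMap.BilinForm ℂ g) (b : (rootSystem H).Base)
    (e f : H.root → g) (S : Set H.root) : ExteriorAlgebra ℂ g :=
  ∑ α : H.root with b.IsPos α ∧ α ∈ S,
    (rootNormSq B α / 2) • (ExteriorAlgebra.ι ℂ (e α) * ExteriorAlgebra.ι ℂ (f α))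

end Semisimple

end RelTwist

end

noncomputable section

namespace RelTwist

/-! ### Derivations, contractions and degrees on the exterior algebra -/

section Exterior

variable {R L : Type*} [CommRing R] [AddCommGroup L] [Module R L]

/-! Let ϖ in the Cartan subalgebra take the value 0 on the simple roots in D and 1 on the others.
The eigenvalues of ad ϖ grade g by integers, and the degree-zero part, the centraliser of ϖ, is the
Levi subalgebra l = l_D. Through the form B, the bivector ρ = r_g - r_D becomes the skew
endomorphism S equal to -sign(n) in degree n: the coefficient (α,α)/2 is exactly 1/B(e_α,f_α)
(`rootNormSq_mul`, `IsGradingElement.isSignOperator`). For B-dual families e, e', the bracket with ρ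
is d = ∑ eₖ ∧ ad(S e'ₖ) (`twistOp`).

The operator d preserves the invariants because S commutes with ad l. On homogeneous elements S
satisfies the modified Yang-Baxter equation, except in degrees (0,0), where the defect lies in [l,l]
⊆ g_D and so annihilates invariants; the remaining term ∑ eₖ ∧ eₗ ∧ ad[e'ₖ,e'ₗ] vanishes by the
Jacobi identity. Hence d² = 0 (`IsDualPair.twistOp_twistOp`).

Contraction with B(ϖ,·) is a homotopy. By a Cartan formula (`IsDualPair.contract_twistOp`), its
anticommutator T with d is the derivation extending -S ∘ ad ϖ, which acts on g by |n| in degree n.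
As these eigenvalues are natural numbers, T is diagonalisable and its kernel is exactly ⋀ l, where d
vanishes. Consequently the cohomology is (⋀ l)^{g_D} in every positive degree
(`IsSignBivector.exists_cohomology_equiv`).

Finally l is the orthogonal sum of its centre c_D and the perfect algebra g_D
(`IsGradingElement.exists_isLeviDecomposition`). A perfect algebra with an invariant nondegenerate
form has no invariants in ⋀¹ and ⋀², so up to degree 3 only ⋀ c_D and (⋀³ g_D)^{g_D} remain
(`contract_eq_zero_of_one`, `contract_eq_zero_of_two`, `map_p_add_map_q`). -/

theorem exteriorPower_succ_induction {k : ℕ} {P : ExteriorAlgebra R L → Prop}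
    (add : ∀ a b, P a → P b → P (a + b))
    (ι_mul : ∀ (X : L), ∀ a ∈ ⋀[R]^k L, P (ExteriorAlgebra.ι R X * a))
    {w : ExteriorAlgebra R L} (hw : w ∈ ⋀[R]^(k + 1) L) : P w := by
  change w ∈ LinearMap.range (ExteriorAlgebra.ι R (M := L)) ^ (k + 1) at hw
  rw [pow_succ'] at hw
  refine Submodule.mul_induction_on hw ?_ add
  rintro _ ⟨X, rfl⟩ a ha
  exact ι_mul X a ha

theorem ι_mul_mem {k : ℕ} (X : L) {a : ExteriorAlgebra R L} (ha : a ∈ ⋀[R]^k L) :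
    ExteriorAlgebra.ι R X * a ∈ ⋀[R]^(k + 1) L := by
  change _ ∈ LinearMap.range (ExteriorAlgebra.ι R (M := L)) ^ (k + 1)
  rw [pow_succ']
  exact Submodule.mul_mem_mul ⟨X, rfl⟩ ha

theorem mem_exteriorPower_zero {a : ExteriorAlgebra R L} :
    a ∈ ⋀[R]^0 L ↔ ∃ r : R, r • 1 = a := by
  change a ∈ LinearMap.range (ExteriorAlgebra.ι R (M := L)) ^ 0 ↔ _
  rw [pow_zero, Submodule.mem_one]
  simp [Algebra.algebraMap_eq_smul_one]

theorem ι_mem_exteriorPower_one (X : L) : ExteriorAlgebra.ι R X ∈ ⋀[R]^1 L := by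
  simp

theorem mem_exteriorPower_one {a : ExteriorAlgebra R L} :
    a ∈ ⋀[R]^1 L ↔ ∃ X : L, ExteriorAlgebra.ι R X = a := by
  change a ∈ LinearMap.range (ExteriorAlgebra.ι R (M := L)) ^ 1 ↔ _
  rw [pow_one, LinearMap.mem_range]

theorem extDer_mem {k : ℕ} (T : Module.End R L) {a : ExteriorAlgebra R L} (ha : a ∈ ⋀[R]^k L) :
    extDer T a ∈ ⋀[R]^k L := by
  induction k generalizing a with
  | zero =>
    obtain ⟨r, rfl⟩ := mem_exteriorPower_zero.1 ha
    simp
  | succ k ih =>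
    refine exteriorPower_succ_induction (P := fun a => extDer T a ∈ ⋀[R]^(k + 1) L) ?_ ?_ ha
    · intro a b ha hb
      rw [map_add]
      exact add_mem ha hb
    · intro X a ha
      rw [extDer_ι_mul]
      exact add_mem (ι_mul_mem _ ha) (ι_mul_mem _ (ih ha))

@[simp] theorem extDer_zero : extDer (0 : Module.End R L) = 0 := by
  have := extDer_smul (0 : R) (0 : Module.End R L)
  simpa using this

theorem extDer_neg (T : Module.End R L) : extDer (-T) = -extDer T := by
  refine eq_neg_of_add_eq_zero_left ?_
  rw [← extDer_add, neg_add_cancel, extDer_zero]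

theorem extDer_sum {κ : Type*} (s : Finset κ) (T : κ → Module.End R L) :
    extDer (∑ k ∈ s, T k) = ∑ k ∈ s, extDer (T k) := by
  classical
  induction s using Finset.induction_on with
  | empty => simp
  | insert a s ha ih => rw [Finset.sum_insert ha, Finset.sum_insert ha, extDer_add, ih]

theorem extDer_comp_sub (S T : Module.End R L) (w : ExteriorAlgebra R L) :
    extDer S (extDer T w) - extDer T (extDer S w) = extDer (S * T - T * S) w := by
  induction w using left_induction with
  | one r => simp
  | add a b ha hb => simp only [map_add, ← ha, ← hb]; abel
  | ι_mul a X ha =>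
    simp only [extDer_ι_mul, map_add, ← ha, LinearMap.sub_apply, map_sub, Module.End.mul_apply,
      sub_mul, mul_sub]
    abel

theorem extDer_id_of_mem {k : ℕ} {w : ExteriorAlgebra R L} (hw : w ∈ ⋀[R]^k L) :
    extDer LinearMap.id w = (k : R) • w := by
  induction k generalizing w with
  | zero =>
    obtain ⟨r, rfl⟩ := mem_exteriorPower_zero.1 hw
    simp
  | succ k ih =>
    refine exteriorPower_succ_induction
      (P := fun w => extDer LinearMap.id w = ((k + 1 : ℕ) : R) • w) ?_ ?_ hw
    · intro a b ha hb
      rw [map_add, ha, hb, smul_add]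
    · intro X a ha
      rw [extDer_ι_mul, ih ha, mul_smul_comm, LinearMap.id_apply, Nat.cast_succ, add_smul, one_smul,
        add_comm]

/-- Contraction of the exterior algebra with a linear form. -/
def contract (φ : Module.Dual R L) : Module.End R (ExteriorAlgebra R L) :=
  CliffordAlgebra.contractLeft (Q := (0 : QuadraticForm R L)) φ

theorem contract_ι_mul (φ : Module.Dual R L) (X : L) (a : ExteriorAlgebra R L) :
    contract φ (ExteriorAlgebra.ι R X * a) = φ X • a - ExteriorAlgebra.ι R X * contract φ a :=
  CliffordAlgebra.contractLeft_ι_mul _ _ _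

@[simp] theorem contract_one (φ : Module.Dual R L) : contract φ (1 : ExteriorAlgebra R L) = 0 :=
  CliffordAlgebra.contractLeft_one (Q := (0 : QuadraticForm R L)) φ

theorem contract_comm (φ ψ : Module.Dual R L) (w : ExteriorAlgebra R L) :
    contract φ (contract ψ w) = -contract ψ (contract φ w) :=
  CliffordAlgebra.contractLeft_comm _ _ _

theorem contract_add (φ ψ : Module.Dual R L) : contract (φ + ψ) = contract φ + contract ψ :=
  map_add _ _ _

theorem contract_neg (φ : Module.Dual R L) : contract (-φ) = -contract φ :=
  map_neg _ _

theorem contract_smul (c : R) (φ : Module.Dual R L) : contract (c • φ) = c • contract φ :=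
  map_smul _ _ _

@[simp] theorem contract_zero : contract (0 : Module.Dual R L) = 0 :=
  map_zero _

theorem contract_mem {k : ℕ} (φ : Module.Dual R L) {a : ExteriorAlgebra R L}
    (ha : a ∈ ⋀[R]^(k + 1) L) : contract φ a ∈ ⋀[R]^k L := by
  induction k generalizing a with
  | zero =>
    refine exteriorPower_succ_induction (P := fun a => contract φ a ∈ ⋀[R]^0 L) ?_ ?_ ha
    · intro a b ha hb
      rw [map_add]
      exact add_mem ha hb
    · intro X a ha
      obtain ⟨r, rfl⟩ := mem_exteriorPower_zero.1 ha
      rw [contract_ι_mul]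
      simpa only [map_smul, contract_one, smul_zero, mul_zero, sub_zero]
        using Submodule.smul_mem _ _ ha
  | succ k ih =>
    refine exteriorPower_succ_induction (P := fun a => contract φ a ∈ ⋀[R]^(k + 1) L) ?_ ?_ ha
    · intro a b ha hb
      rw [map_add]
      exact add_mem ha hb
    · intro X a ha
      rw [contract_ι_mul]
      exact sub_mem (Submodule.smul_mem _ _ ha) (ι_mul_mem _ (ih ha))

theorem contract_of_mem_zero (φ : Module.Dual R L) {a : ExteriorAlgebra R L}
    (ha : a ∈ ⋀[R]^0 L) : contract φ a = 0 := by
  obtain ⟨r, rfl⟩ := mem_exteriorPower_zero.1 ha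
  simp

theorem contract_extDer (φ : Module.Dual R L) (T : Module.End R L) (w : ExteriorAlgebra R L) :
    contract φ (extDer T w) = extDer T (contract φ w) + contract (φ ∘ₗ T) w := by
  induction w using left_induction with
  | one r => simp
  | add a b ha hb => simp only [map_add, ha, hb]; abel
  | ι_mul a X ha =>
    simp only [extDer_ι_mul, map_add, contract_ι_mul, ha, map_sub, map_smul, mul_add,
      LinearMap.comp_apply]
    abel

/-- Both sides are derivations that agree on L. Sums of wedge-and-contract terms thereby become the
derivation of a sum of rank-one endomorphisms. -/
theorem ι_mul_contract (φ : Module.Dual R L) (X : L) (w : ExteriorAlgebra R L) :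
    ExteriorAlgebra.ι R X * contract φ w = extDer (φ.smulRight X) w := by
  induction w using left_induction with
  | one r => simp
  | add a b ha hb => simp only [map_add, mul_add, ha, hb]
  | ι_mul a Y ha =>
    have h := eq_neg_of_add_eq_zero_left (ExteriorAlgebra.ι_add_mul_swap (R := R) X Y)
    rw [extDer_ι_mul, ← ha, contract_ι_mul, mul_sub, ← mul_assoc, h, LinearMap.smulRight_apply,
      map_smul, mul_smul_comm, smul_mul_assoc, ← mul_assoc]
    simp

variable {N : Type*} [AddCommGroup N] [Module R N]

theorem map_ι_mul (f : L →ₗ[R] N) (X : L) (a : ExteriorAlgebra R L) :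
    ExteriorAlgebra.map f (ExteriorAlgebra.ι R X * a)
      = ExteriorAlgebra.ι R (f X) * ExteriorAlgebra.map f a := by
  rw [map_mul, ExteriorAlgebra.map_apply_ι]

theorem map_mem {k : ℕ} (f : L →ₗ[R] N) {a : ExteriorAlgebra R L} (ha : a ∈ ⋀[R]^k L) :
    ExteriorAlgebra.map f a ∈ ⋀[R]^k N := by
  induction k generalizing a with
  | zero =>
    obtain ⟨r, rfl⟩ := mem_exteriorPower_zero.1 ha
    exact mem_exteriorPower_zero.2 ⟨r, by simp⟩
  | succ k ih =>
    refine exteriorPower_succ_induction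
      (P := fun a => ExteriorAlgebra.map f a ∈ ⋀[R]^(k + 1) N) ?_ ?_ ha
    · intro a b ha hb
      rw [map_add]
      exact add_mem ha hb
    · intro X a ha
      rw [map_ι_mul]
      exact ι_mul_mem _ (ih ha)

theorem map_extDer {f : L →ₗ[R] N} {S : Module.End R L} {T : Module.End R N}
    (h : ∀ X, f (S X) = T (f X)) (w : ExteriorAlgebra R L) :
    ExteriorAlgebra.map f (extDer S w) = extDer T (ExteriorAlgebra.map f w) := by
  induction w using left_induction with
  | one r => simp
  | add a b ha hb => simp only [map_add, ha, hb]
  | ι_mul a X ha => simp only [extDer_ι_mul, map_add, map_ι_mul, h, ha]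

theorem contract_map (φ : Module.Dual R N) (f : L →ₗ[R] N) (w : ExteriorAlgebra R L) :
    contract φ (ExteriorAlgebra.map f w) = ExteriorAlgebra.map f (contract (φ ∘ₗ f) w) := by
  induction w using left_induction with
  | one r => simp
  | add a b ha hb => simp only [map_add, ha, hb]
  | ι_mul a X ha =>
    simp only [map_ι_mul, contract_ι_mul, ha, map_sub, map_smul, LinearMap.comp_apply]

theorem map_map_apply {P : Type*} [AddCommGroup P] [Module R P] (f : L →ₗ[R] N) (h : N →ₗ[R] P)
    (w : ExteriorAlgebra R L) :
    ExteriorAlgebra.map h (ExteriorAlgebra.map f w) = ExteriorAlgebra.map (h ∘ₗ f) w := by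
  rw [← ExteriorAlgebra.map_comp_map, AlgHom.comp_apply]

theorem map_eq_self_of_mem_zero (f : Module.End R L) {a : ExteriorAlgebra R L}
    (ha : a ∈ ⋀[R]^0 L) : ExteriorAlgebra.map f a = a := by
  obtain ⟨r, rfl⟩ := mem_exteriorPower_zero.1 ha
  simp

theorem map_zero_of_mem_succ {k : ℕ} {a : ExteriorAlgebra R L} (ha : a ∈ ⋀[R]^(k + 1) L) :
    ExteriorAlgebra.map (0 : L →ₗ[R] N) a = 0 := by
  refine exteriorPower_succ_induction
    (P := fun a => ExteriorAlgebra.map (0 : L →ₗ[R] N) a = 0) ?_ ?_ ha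
  · intro a b ha hb
    rw [map_add, ha, hb, add_zero]
  · intro X a _
    simp [map_ι_mul]

end Exterior

/-! ### Dual pairs of families for a bilinear form -/

section DualPair

variable {R L : Type*} [CommRing R] [AddCommGroup L] [Module R L]

/-- The families `e` and `e'` are dual to each other for the bilinear form `B`. -/
structure IsDualPair {κ : Type*} [Fintype κ] (B : LinearMap.BilinForm R L) (e e' : κ → L) :
    Prop where
  sum_left : ∀ x, ∑ k, B x (e' k) • e k = x
  sum_right : ∀ x, ∑ k, B x (e k) • e' k = x

variable {κ : Type*} [Fintype κ] {B : LinearMap.BilinForm R L} {e e' : κ → L}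

/-- The canonical tensor ∑ eₖ ⊗ e'ₖ represents the form, so an operator acting on one leg may be
replaced by its adjoint acting on the other. An arbitrary bilinear map F stands in for the tensor
product. -/
theorem IsDualPair.sum_adjoint {M : Type*} [AddCommGroup M] [Module R M]
    (h : IsDualPair B e e') (hB : ∀ x y, B x y = B y x) {S T : Module.End R L}
    (hST : ∀ x y, B (S x) y = B x (T y)) (F : L →ₗ[R] L →ₗ[R] M) :
    ∑ k, F (e k) (S (e' k)) = ∑ k, F (T (e k)) (e' k) := by
  calc ∑ k, F (e k) (S (e' k)) = ∑ k, ∑ l, B (S (e' k)) (e l) • F (e k) (e' l) := by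
        refine Finset.sum_congr rfl fun k _ => ?_
        conv_lhs => rw [← h.sum_right (S (e' k))]
        simp only [map_sum, map_smul]
    _ = ∑ l, ∑ k, B (T (e l)) (e' k) • F (e k) (e' l) := by
        rw [Finset.sum_comm]
        refine Finset.sum_congr rfl fun l _ => Finset.sum_congr rfl fun k _ => ?_
        rw [hST, hB]
    _ = ∑ k, F (T (e k)) (e' k) := by
        refine Finset.sum_congr rfl fun k _ => ?_
        conv_rhs => rw [← h.sum_left (T (e k))]
        simp only [map_sum, map_smul, LinearMap.sum_apply, LinearMap.smul_apply]

theorem IsDualPair.sum_swap {M : Type*} [AddCommGroup M] [Module R M]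
    (h : IsDualPair B e e') (hB : ∀ x y, B x y = B y x) (F : L →ₗ[R] L →ₗ[R] M) :
    ∑ k, F (e k) (e' k) = ∑ k, F (e' k) (e k) := by
  calc ∑ k, F (e k) (e' k) = ∑ k, ∑ l, B (e k) (e l) • F (e' l) (e' k) := by
        refine Finset.sum_congr rfl fun k _ => ?_
        conv_lhs => rw [← h.sum_right (e k)]
        simp only [map_sum, map_smul, LinearMap.sum_apply, LinearMap.smul_apply]
    _ = ∑ l, ∑ k, B (e l) (e k) • F (e' l) (e' k) := by
        rw [Finset.sum_comm]
        refine Finset.sum_congr rfl fun l _ => Finset.sum_congr rfl fun k _ => ?_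
        rw [hB]
    _ = ∑ k, F (e' k) (e k) := by
        refine Finset.sum_congr rfl fun k _ => ?_
        conv_rhs => rw [← h.sum_right (e k)]
        simp only [map_sum, map_smul]

/-- An element of positive degree of the exterior algebra all of whose contractions vanish is
zero. -/
theorem IsDualPair.eq_zero_of_contract [Module.IsTorsionFree R (ExteriorAlgebra R L)]
    [IsDomain R] [CharZero R]
    (h : IsDualPair B e e') (hB : ∀ x y, B x y = B y x) {k : ℕ} {w : ExteriorAlgebra R L}
    (hw : w ∈ ⋀[R]^(k + 1) L) (hc : ∀ x, contract (B x) w = 0) : w = 0 := by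
  -- The derivation extending the identity is multiplication by the degree k + 1, which is nonzero.
  -- Writing the identity as a sum of rank-one maps turns it into ∑ eₖ ∧ (contraction), which
  -- vanishes by assumption.
  have hid : (LinearMap.id : Module.End R L) = ∑ k, (B (e' k)).smulRight (e k) := by
    ext x
    simp only [LinearMap.sum_apply, LinearMap.smulRight_apply, LinearMap.id_apply]
    conv_lhs => rw [← h.sum_left x]
    simp only [hB]
  have h1 := extDer_id_of_mem hw
  rw [hid, extDer_sum, LinearMap.sum_apply] at h1
  simp only [← ι_mul_contract, hc, mul_zero, Finset.sum_const_zero] at h1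
  exact (smul_eq_zero.1 h1.symm).resolve_left (by exact_mod_cast k.succ_ne_zero)

end DualPair

/-! ### The operator `∑ eₖ ∧ ad (S e'ₖ)` -/

section AdExt

variable {R L : Type*} [CommRing R] [LieRing L] [LieAlgebra R L]

theorem adExt_ι_mul (x X : L) (a : ExteriorAlgebra R L) :
    adExt x (ExteriorAlgebra.ι R X * a)
      = ExteriorAlgebra.ι R ⁅x, X⁆ * a + ExteriorAlgebra.ι R X * adExt x a :=
  extDer_ι_mul _ _ _

@[simp] theorem adExt_one (x : L) : adExt x (1 : ExteriorAlgebra R L) = 0 :=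
  extDer_one _

theorem adExt_mem {k : ℕ} (x : L) {a : ExteriorAlgebra R L} (ha : a ∈ ⋀[R]^k L) :
    adExt x a ∈ ⋀[R]^k L :=
  extDer_mem _ ha

theorem adExt_lie (x y : L) (w : ExteriorAlgebra R L) :
    adExt ⁅x, y⁆ w = adExt x (adExt y w) - adExt y (adExt x w) := by
  have h : LieAlgebra.ad R L ⁅x, y⁆ = LieAlgebra.ad R L x * LieAlgebra.ad R L y
      - LieAlgebra.ad R L y * LieAlgebra.ad R L x := by
    ext z
    simp only [LinearMap.sub_apply, Module.End.mul_apply, LieAlgebra.ad_apply, lie_lie]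
  change extDer (LieAlgebra.ad R L ⁅x, y⁆) w = _
  rw [h, ← extDer_comp_sub]
  rfl

theorem mem_invariants {K : LieSubalgebra R L} {k : ℕ} {w : ExteriorAlgebra R L} :
    w ∈ invariants K k ↔ w ∈ ⋀[R]^k L ∧ ∀ x ∈ K, adExt x w = 0 := by
  simp [invariants, Submodule.mem_inf, Submodule.mem_iInf]

theorem contract_adExt (φ : Module.Dual R L) (x : L) (w : ExteriorAlgebra R L) :
    contract φ (adExt x w)
      = adExt x (contract φ w) + contract (φ ∘ₗ LieAlgebra.ad R L x) w :=
  contract_extDer _ _ _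

/-- The operator `w ↦ ∑ eₖ ∧ ad (S e'ₖ) w` on the exterior algebra. -/
def twistOp {κ : Type*} [Fintype κ] (e e' : κ → L) (S : Module.End R L) :
    Module.End R (ExteriorAlgebra R L) :=
  ∑ k, LinearMap.mulLeft R (ExteriorAlgebra.ι R (e k)) ∘ₗ adExt (S (e' k))

variable {κ : Type*} [Fintype κ] {e e' : κ → L} {S : Module.End R L}

theorem twistOp_apply (w : ExteriorAlgebra R L) :
    twistOp e e' S w = ∑ k, ExteriorAlgebra.ι R (e k) * adExt (S (e' k)) w := by
  simp [twistOp]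

theorem twistOp_mem {k : ℕ} {w : ExteriorAlgebra R L} (hw : w ∈ ⋀[R]^k L) :
    twistOp e e' S w ∈ ⋀[R]^(k + 1) L := by
  rw [twistOp_apply]
  exact sum_mem fun i _ => ι_mul_mem _ (adExt_mem _ hw)

@[simp] theorem twistOp_one : twistOp e e' S (1 : ExteriorAlgebra R L) = 0 := by
  simp [twistOp_apply]

/-- Each ad(S e'ₖ) is a derivation, and moving eₖ past X costs a sign. The operator is thus an
antiderivation, and it vanishes on a subalgebra as soon as it kills generators of degree one. -/
theorem twistOp_ι_mul (X : L) (a : ExteriorAlgebra R L) :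
    twistOp e e' S (ExteriorAlgebra.ι R X * a)
      = twistOp e e' S (ExteriorAlgebra.ι R X) * a
        - ExteriorAlgebra.ι R X * twistOp e e' S a := by
  have h : ∀ y : L, adExt y (ExteriorAlgebra.ι R X) = ExteriorAlgebra.ι R ⁅y, X⁆ := fun y =>
    extDer_ι _ _
  simp only [twistOp_apply, adExt_ι_mul, mul_add, Finset.sum_add_distrib, h, Finset.sum_mul,
    Finset.mul_sum, ← mul_assoc, sub_eq_add_neg, ← Finset.sum_neg_distrib, ← neg_mul]
  congr 1
  refine Finset.sum_congr rfl fun k _ => ?_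
  rw [eq_neg_of_add_eq_zero_left (ExteriorAlgebra.ι_add_mul_swap (R := R) (e k) X), neg_mul,
    neg_mul, neg_mul]

/-- The bilinear map `(a, b) ↦ a ∧ ad (S b) w`. -/
def wedgeAd (S : Module.End R L) (w : ExteriorAlgebra R L) :
    L →ₗ[R] L →ₗ[R] ExteriorAlgebra R L :=
  (LinearMap.mul R (ExteriorAlgebra R L)).compl₁₂ (ExteriorAlgebra.ι R) (adExt.flip w ∘ₗ S)

theorem wedgeAd_apply (S : Module.End R L) (w : ExteriorAlgebra R L) (a b : L) :
    wedgeAd S w a b = ExteriorAlgebra.ι R a * adExt (S b) w := rfl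

variable {B : LinearMap.BilinForm R L}

/-- This is the ad-invariance of the canonical tensor: ad y is skew for an invariant form. -/
theorem IsDualPair.sum_lie {M : Type*} [AddCommGroup M] [Module R M]
    (h : IsDualPair B e e') (hB : ∀ x y, B x y = B y x) (hinv : B.lieInvariant L) (y : L)
    (F : L →ₗ[R] L →ₗ[R] M) :
    ∑ k, F ⁅y, e k⁆ (e' k) = -∑ k, F (e k) ⁅y, e' k⁆ := by
  have h1 := h.sum_adjoint hB (S := LieAlgebra.ad R L y) (T := -LieAlgebra.ad R L y)
    (fun a b => by
      rw [LinearMap.neg_apply, LieAlgebra.ad_apply, LieAlgebra.ad_apply, hinv, map_neg]) F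
  simp only [LieAlgebra.ad_apply, LinearMap.neg_apply, map_neg, Finset.sum_neg_distrib] at h1
  rw [h1, neg_neg]

/-- If `S` commutes with `ad x`, then so does the operator `∑ eₖ ∧ ad (S e'ₖ)`. -/
theorem IsDualPair.adExt_twistOp (h : IsDualPair B e e') (hB : ∀ x y, B x y = B y x)
    (hinv : B.lieInvariant L) {x : L} (hx : ∀ y, S ⁅x, y⁆ = ⁅x, S y⁆)
    (w : ExteriorAlgebra R L) :
    adExt x (twistOp e e' S w) = twistOp e e' S (adExt x w) := by
  have h1 := h.sum_lie hB hinv x (wedgeAd S w)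
  have h2 : ∀ k, adExt x (adExt (S (e' k)) w)
      = adExt (S (e' k)) (adExt x w) + adExt (S ⁅x, e' k⁆) w := by
    intro k
    rw [hx, adExt_lie]
    abel
  simp only [wedgeAd_apply] at h1
  simp only [twistOp_apply, map_sum, adExt_ι_mul, h2, mul_add, Finset.sum_add_distrib, h1]
  abel

/-- If `S` is skew for `B` and commutes with `ad X`, then `∑ eₖ ∧ [S e'ₖ, X] = 0`. -/
theorem IsDualPair.twistOp_ι_eq_zero [CharZero R] [IsDomain R]
    [Module.IsTorsionFree R (ExteriorAlgebra R L)] (h : IsDualPair B e e')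
    (hB : ∀ x y, B x y = B y x) (hinv : B.lieInvariant L)
    (hS : ∀ x y, B (S x) y = -B x (S y)) {X : L} (hX : ∀ y, S ⁅X, y⁆ = ⁅X, S y⁆) :
    twistOp e e' S (ExteriorAlgebra.ι R X) = 0 := by
  let F : L →ₗ[R] L →ₗ[R] ExteriorAlgebra R L :=
    (LinearMap.mul R (ExteriorAlgebra R L)).compl₁₂ (ExteriorAlgebra.ι R) (ExteriorAlgebra.ι R)
  have hF : ∀ a b, F a b = ExteriorAlgebra.ι R a * ExteriorAlgebra.ι R b := fun _ _ => rfl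
  have hsw : ∀ a b, F a b = -F b a := fun a b =>
    eq_neg_of_add_eq_zero_left (ExteriorAlgebra.ι_add_mul_swap (R := R) a b)
  have h0 : twistOp e e' S (ExteriorAlgebra.ι R X) = -∑ k, F (e k) (S ⁅X, e' k⁆) := by
    rw [twistOp_apply, ← Finset.sum_neg_distrib]
    refine Finset.sum_congr rfl fun k _ => ?_
    have : adExt (S (e' k)) (ExteriorAlgebra.ι R X) = ExteriorAlgebra.ι R ⁅S (e' k), X⁆ :=
      extDer_ι _ _
    rw [this, hX, hF, ← lie_skew, map_neg, mul_neg]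
  -- S and ad X are skew and commute, so S ∘ ad X is self-adjoint. The tensor ∑ eₖ ⊗ S[X, e'ₖ] is
  -- then symmetric, and its image in ⋀² equals its own negative.
  have h1 : ∑ k, F (e k) (S ⁅X, e' k⁆) = -∑ k, F (e k) (S ⁅X, e' k⁆) := by
    calc ∑ k, F (e k) (S ⁅X, e' k⁆)
        = ∑ k, F ⁅X, S (e k)⁆ (e' k) := by
          refine h.sum_adjoint hB (S := S ∘ₗ LieAlgebra.ad R L X)
            (T := LieAlgebra.ad R L X ∘ₗ S) (fun a b => ?_) F
          simp only [LinearMap.comp_apply, LieAlgebra.ad_apply]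
          rw [hS, hinv, neg_neg]
      _ = -∑ k, F (e' k) (S ⁅X, e k⁆) := by
          rw [← Finset.sum_neg_distrib]
          refine Finset.sum_congr rfl fun k _ => ?_
          rw [hX, hsw]
      _ = -∑ k, F (e k) (S ⁅X, e' k⁆) := by
          have := h.sum_swap hB (F.compl₂ (S ∘ₗ LieAlgebra.ad R L X))
          simp only [LinearMap.compl₂_apply, LinearMap.comp_apply, LieAlgebra.ad_apply] at this
          rw [this]
  have h2 : (2 : R) • ∑ k, F (e k) (S ⁅X, e' k⁆) = 0 := by
    rw [two_smul]
    exact eq_neg_iff_add_eq_zero.1 h1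
  rw [h0, (smul_eq_zero.1 h2).resolve_left two_ne_zero, neg_zero]

/-- Cartan's formula for the contraction with `B x` when `S x = 0`. -/
theorem IsDualPair.contract_twistOp (h : IsDualPair B e e') (hB : ∀ x y, B x y = B y x)
    (hinv : B.lieInvariant L) (hS : ∀ x y, B (S x) y = -B x (S y)) {x : L} (hx : S x = 0)
    (w : ExteriorAlgebra R L) :
    contract (B x) (twistOp e e' S w) + twistOp e e' S (contract (B x) w)
      = -extDer (S ∘ₗ LieAlgebra.ad R L x) w := by
  have h1 : ∀ k, contract (B x) (adExt (S (e' k)) w)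
      = adExt (S (e' k)) (contract (B x) w) + contract (B ⁅x, S (e' k)⁆) w := by
    intro k
    have h0 : B x ∘ₗ LieAlgebra.ad R L (S (e' k)) = B ⁅x, S (e' k)⁆ := by
      ext y
      rw [LinearMap.comp_apply, LieAlgebra.ad_apply, ← lie_skew x, map_neg, LinearMap.neg_apply,
        hinv, neg_neg]
    rw [contract_adExt, h0]
  -- The terms in which the contraction hits the leading factor add up to ad(S x) w.
  have h2 : ∑ k, B x (e k) • adExt (S (e' k)) w = 0 := by
    have : ∑ k, B x (e k) • adExt (S (e' k)) w
        = adExt (S (∑ k, B x (e k) • e' k)) w := by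
      rw [map_sum, map_sum, LinearMap.sum_apply]
      simp only [map_smul, LinearMap.smul_apply]
    rw [this, h.sum_right, hx, map_zero, LinearMap.zero_apply]
  -- The terms eₖ ∧ (contraction with [x, S e'ₖ]) come from this sum of rank-one maps. It is
  -- evaluated by moving ad x and then S to the other argument of B; the two signs cancel.
  have h3 : ∑ k, (B ⁅x, S (e' k)⁆).smulRight (e k) = S ∘ₗ LieAlgebra.ad R L x := by
    ext y
    simp only [LinearMap.sum_apply, LinearMap.smulRight_apply, LinearMap.comp_apply,
      LieAlgebra.ad_apply]
    conv_rhs => rw [← h.sum_left (S ⁅x, y⁆)]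
    refine Finset.sum_congr rfl fun k _ => ?_
    rw [hinv, hS (e' k), neg_neg, hB]
  simp only [twistOp_apply, map_sum, contract_ι_mul, h1, Finset.sum_sub_distrib, h2, mul_add,
    Finset.sum_add_distrib, ι_mul_contract]
  rw [← h3, extDer_sum, LinearMap.sum_apply]
  abel

/-- `∑ eₖ ∧ eₗ ∧ [[e'ₖ, e'ₗ], Y] = 0`. -/
theorem IsDualPair.sum_lie_lie [CharZero R] [IsDomain R]
    [Module.IsTorsionFree R (ExteriorAlgebra R L)] (h : IsDualPair B e e')
    (hB : ∀ x y, B x y = B y x) (hinv : B.lieInvariant L) (Y : L) :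
    ∑ k, ∑ l, ExteriorAlgebra.ι R (e k) * ExteriorAlgebra.ι R (e l)
      * ExteriorAlgebra.ι R ⁅⁅e' k, e' l⁆, Y⁆ = 0 := by
  let ι := ExteriorAlgebra.ι R (M := L)
  have hsw : ∀ a b, ι a * ι b = -(ι b * ι a) := fun a b =>
    eq_neg_of_add_eq_zero_left (ExteriorAlgebra.ι_add_mul_swap (R := R) a b)
  let G : L → L →ₗ[R] L →ₗ[R] ExteriorAlgebra R L := fun c =>
    (LinearMap.mul R (ExteriorAlgebra R L)).compl₁₂ (LinearMap.mulLeft R (ι c) ∘ₗ ι) ι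
  have hG : ∀ c a b, G c a b = ι c * ι a * ι b := fun _ _ _ => rfl
  set A := ∑ k, ∑ l, ι (e k) * ι (e l) * ι ⁅⁅e' k, e' l⁆, Y⁆ with hA
  change A = 0
  set C := ∑ k, ∑ l, ι (e k) * ι (e l) * ι ⁅e' k, ⁅e' l, Y⁆⁆ with hC
  -- Jacobi identity, together with the antisymmetry of eₖ ∧ eₗ in k and l.
  have h1 : A = C + C := by
    have : ∑ k, ∑ l, ι (e k) * ι (e l) * ι ⁅e' l, ⁅e' k, Y⁆⁆ = -C := by
      rw [hC, Finset.sum_comm, ← Finset.sum_neg_distrib]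
      refine Finset.sum_congr rfl fun k _ => ?_
      rw [← Finset.sum_neg_distrib]
      refine Finset.sum_congr rfl fun l _ => ?_
      rw [hsw (e l), neg_mul]
    rw [hA, ← sub_neg_eq_add C, ← this, hC, ← Finset.sum_sub_distrib]
    refine Finset.sum_congr rfl fun k _ => ?_
    rw [← Finset.sum_sub_distrib]
    refine Finset.sum_congr rfl fun l _ => ?_
    rw [← mul_sub, ← map_sub, lie_lie]
  -- Invariance of the canonical tensor is used twice, for ad Y and for ad e'ₖ, until the inner
  -- bracket is again [e'ₖ, e'ₗ] bracketed with Y. Together with A = 2C this gives 3A = 0.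
  have h2 : C = -A := by
    calc C = ∑ k, ∑ l, ι (e k) * ι ⁅Y, e l⁆ * ι ⁅e' k, e' l⁆ := by
          refine Finset.sum_congr rfl fun k _ => ?_
          have := h.sum_lie hB hinv Y ((G (e k)).compl₂ (LieAlgebra.ad R L (e' k)))
          simp only [LinearMap.compl₂_apply, hG, LieAlgebra.ad_apply] at this
          rw [this, ← Finset.sum_neg_distrib]
          refine Finset.sum_congr rfl fun l _ => ?_
          rw [← lie_skew (e' l) Y, lie_neg, map_neg, mul_neg]
      _ = -∑ k, ∑ l, ι (e k) * ι ⁅Y, ⁅e' k, e l⁆⁆ * ι (e' l) := by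
          rw [← Finset.sum_neg_distrib]
          refine Finset.sum_congr rfl fun k _ => ?_
          have := h.sum_lie hB hinv (e' k) (G (e k) ∘ₗ LieAlgebra.ad R L Y)
          simp only [LinearMap.comp_apply, hG, LieAlgebra.ad_apply] at this
          rw [this, neg_neg]
      _ = ∑ k, ∑ l, ι (e k) * ι (e' l) * ι ⁅Y, ⁅e' k, e l⁆⁆ := by
          rw [← Finset.sum_neg_distrib]
          refine Finset.sum_congr rfl fun k _ => ?_
          rw [← Finset.sum_neg_distrib]
          refine Finset.sum_congr rfl fun l _ => ?_
          rw [mul_assoc, hsw ⁅Y, _⁆, mul_neg, neg_neg, mul_assoc]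
      _ = ∑ k, ∑ l, ι (e k) * ι (e l) * ι ⁅Y, ⁅e' k, e' l⁆⁆ := by
          refine Finset.sum_congr rfl fun k _ => ?_
          have := h.sum_swap hB
            ((G (e k)).compl₂ (LieAlgebra.ad R L Y ∘ₗ LieAlgebra.ad R L (e' k)))
          simp only [LinearMap.compl₂_apply, LinearMap.comp_apply, hG, LieAlgebra.ad_apply] at this
          exact this.symm
      _ = -A := by
          rw [hA, ← Finset.sum_neg_distrib]
          refine Finset.sum_congr rfl fun k _ => ?_
          rw [← Finset.sum_neg_distrib]
          refine Finset.sum_congr rfl fun l _ => ?_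
          rw [← lie_skew ⁅e' k, e' l⁆ Y, map_neg, mul_neg, neg_neg]
  have h3 : (3 : R) • A = 0 := by
    have : (3 : R) • A = A - (-A + -A) := by
      rw [show (3 : R) = 1 + 1 + 1 by norm_num, add_smul, add_smul, one_smul]
      abel
    rw [this, ← h2, ← h1, sub_self]
  exact (smul_eq_zero.1 h3).resolve_left (by norm_num)

/-- `∑ eₖ ∧ eₗ ∧ ad [e'ₖ, e'ₗ]` vanishes on the exterior algebra. -/
theorem IsDualPair.sum_adExt_lie [CharZero R] [IsDomain R]
    [Module.IsTorsionFree R (ExteriorAlgebra R L)] (h : IsDualPair B e e')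
    (hB : ∀ x y, B x y = B y x) (hinv : B.lieInvariant L) (w : ExteriorAlgebra R L) :
    ∑ k, ∑ l, ExteriorAlgebra.ι R (e k) * ExteriorAlgebra.ι R (e l) * adExt ⁅e' k, e' l⁆ w
      = 0 := by
  induction w using left_induction with
  | one r => simp
  | add a b ha hb =>
    simp only [map_add, mul_add, Finset.sum_add_distrib, ha, hb, add_zero]
  | ι_mul a X ha =>
    -- A product of two elements of L has even degree and commutes with X.
    have h1 : ∀ c d b : L, ExteriorAlgebra.ι R c * ExteriorAlgebra.ι R d
        * (ExteriorAlgebra.ι R X * adExt b a)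
        = ExteriorAlgebra.ι R X
          * (ExteriorAlgebra.ι R c * ExteriorAlgebra.ι R d * adExt b a) := by
      intro c d b
      have hsw : ∀ a b : L, ExteriorAlgebra.ι R a * ExteriorAlgebra.ι R b
          = -(ExteriorAlgebra.ι R b * ExteriorAlgebra.ι R a) := fun a b =>
        eq_neg_of_add_eq_zero_left (ExteriorAlgebra.ι_add_mul_swap (R := R) a b)
      rw [← mul_assoc, mul_assoc _ _ (ExteriorAlgebra.ι R X), hsw d X, mul_neg, ← mul_assoc,
        hsw c X]
      simp only [neg_mul, neg_neg, mul_assoc]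
    simp only [adExt_ι_mul, mul_add, Finset.sum_add_distrib, h1, ← Finset.mul_sum, ha, mul_zero,
      add_zero]
    simp only [← mul_assoc, ← Finset.sum_mul]
    rw [h.sum_lie_lie hB hinv, zero_mul]

/-- If the modified Yang-Baxter equation for `S` holds up to elements annihilating `w`, then
`∑ eₖ ∧ ad (S e'ₖ)` squares to zero on `w`. -/
theorem IsDualPair.twistOp_twistOp [CharZero R] [IsDomain R]
    [Module.IsTorsionFree R (ExteriorAlgebra R L)] (h : IsDualPair B e e')
    (hB : ∀ x y, B x y = B y x) (hinv : B.lieInvariant L) {w : ExteriorAlgebra R L}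
    (hw : ∀ x y, adExt (⁅S x, S y⁆ - S (⁅S x, y⁆ + ⁅x, S y⁆) + ⁅x, y⁆) w = 0) :
    twistOp e e' S (twistOp e e' S w) = 0 := by
  let ι := ExteriorAlgebra.ι R (M := L)
  have hsw : ∀ a b, ι a * ι b = -(ι b * ι a) := fun a b =>
    eq_neg_of_add_eq_zero_left (ExteriorAlgebra.ι_add_mul_swap (R := R) a b)
  let N : κ → κ → ExteriorAlgebra R L := fun k l =>
    adExt (S (e' k)) (adExt (S (e' l)) w) - adExt (S ⁅S (e' k), e' l⁆) w
  -- Invariance of the inner canonical tensor under ad(S e'ₖ) turns the terms in which the outer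
  -- derivation hits eₗ into the second summand of `N`.
  have h1 : twistOp e e' S (twistOp e e' S w) = ∑ k, ∑ l, ι (e k) * ι (e l) * N k l := by
    rw [twistOp_apply]
    refine Finset.sum_congr rfl fun k _ => ?_
    have h2 := h.sum_lie hB hinv (S (e' k)) (wedgeAd S w)
    simp only [wedgeAd_apply] at h2
    simp only [twistOp_apply, map_sum, adExt_ι_mul, Finset.sum_add_distrib, h2, N, mul_sub,
      Finset.sum_sub_distrib, mul_add, Finset.mul_sum, mul_assoc, mul_neg]
    rw [neg_add_eq_sub]
  have h2 : ∑ k, ∑ l, ι (e k) * ι (e l) * N k l = -∑ k, ∑ l, ι (e k) * ι (e l) * N l k := by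
    rw [Finset.sum_comm, ← Finset.sum_neg_distrib]
    refine Finset.sum_congr rfl fun k _ => ?_
    rw [← Finset.sum_neg_distrib]
    refine Finset.sum_congr rfl fun l _ => ?_
    rw [hsw, neg_mul]
  -- Only the part of `N` antisymmetric in k and l contributes. The Yang-Baxter hypothesis reduces
  -- it to -ad[e'ₖ, e'ₗ], whose sum vanishes by `sum_adExt_lie`.
  have h3 : ∀ k l, N k l - N l k = -adExt ⁅e' k, e' l⁆ w := by
    intro k l
    have h4 := hw (e' k) (e' l)
    have h5 : ⁅e' k, S (e' l)⁆ = -⁅S (e' l), e' k⁆ := (lie_skew _ _).symm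
    rw [h5] at h4
    simp only [map_add, map_sub, map_neg, LinearMap.add_apply, LinearMap.sub_apply,
      LinearMap.neg_apply, adExt_lie (S (e' k)) (S (e' l))] at h4
    rw [eq_neg_iff_add_eq_zero, ← h4]
    simp only [N]
    abel
  have h6 : (2 : R) • ∑ k, ∑ l, ι (e k) * ι (e l) * N k l = 0 := by
    rw [two_smul]
    nth_rewrite 2 [h2]
    rw [← sub_eq_add_neg, ← Finset.sum_sub_distrib]
    simp only [← Finset.sum_sub_distrib, ← mul_sub, h3, mul_neg, Finset.sum_neg_distrib]
    rw [h.sum_adExt_lie hB hinv, neg_zero]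
  rw [h1]
  exact (smul_eq_zero.1 h6).resolve_left two_ne_zero

end AdExt

/-! ### Derivations with natural eigenvalues -/

section Spectral

variable {𝕜 L : Type*} [Field 𝕜] [CharZero 𝕜] [AddCommGroup L] [Module 𝕜 L]

theorem disjoint_eigenspace_zero {V : Type*} [AddCommGroup V] [Module 𝕜 V] (f : Module.End 𝕜 V) :
    Disjoint (LinearMap.ker f) (⨆ n : ℕ, f.eigenspace ((n + 1 : ℕ) : 𝕜)) := by
  have h := f.eigenspaces_iSupIndep (0 : 𝕜)
  rw [Module.End.eigenspace_zero] at h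
  refine h.mono_right (iSup_le fun n => ?_)
  exact le_iSup₂_of_le ((n + 1 : ℕ) : 𝕜) (by exact_mod_cast n.succ_ne_zero) le_rfl

variable {A : Module.End 𝕜 L} (hA : ⨆ n : ℕ, A.eigenspace (n : 𝕜) = ⊤)
include hA

/-- Eigenvalues add under the wedge product. Since those of A are natural numbers, no cancellation
occurs, and a product of eigenvectors has eigenvalue 0 only when every factor lies in the kernel of
A. -/
theorem mem_range_map_sup_eigenspace (w : ExteriorAlgebra 𝕜 L) :
    w ∈ LinearMap.range (ExteriorAlgebra.map (LinearMap.ker A).subtype).toLinearMap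
      ⊔ ⨆ n : ℕ, (extDer A).eigenspace ((n + 1 : ℕ) : 𝕜) := by
  set U := LinearMap.range (ExteriorAlgebra.map (LinearMap.ker A).subtype).toLinearMap
    ⊔ ⨆ n : ℕ, (extDer A).eigenspace ((n + 1 : ℕ) : 𝕜) with hU
  have hpos : ∀ (n : ℕ) (v : ExteriorAlgebra 𝕜 L), extDer A v = ((n + 1 : ℕ) : 𝕜) • v → v ∈ U :=
    fun n v hv => Submodule.mem_sup_right
      (Submodule.mem_iSup_of_mem n (Module.End.mem_eigenspace_iff.2 hv))
  have hmap : ∀ v : ExteriorAlgebra 𝕜 (LinearMap.ker A),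
      extDer A (ExteriorAlgebra.map (LinearMap.ker A).subtype v) = 0 := by
    intro v
    rw [← map_extDer (S := 0) (fun X => by simp), extDer_zero, LinearMap.zero_apply, map_zero]
  induction w using left_induction with
  | one r => exact Submodule.mem_sup_left ⟨r • 1, by simp⟩
  | add a b ha hb => exact add_mem ha hb
  | ι_mul a X ha =>
    have hX : X ∈ ⨆ n : ℕ, A.eigenspace (n : 𝕜) := hA ▸ Submodule.mem_top
    induction hX using Submodule.iSup_induction' with
    | zero => simp
    | add X Y _ _ hX hY => rw [map_add, add_mul]; exact add_mem hX hY
    | mem m X hX =>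
      rw [Module.End.mem_eigenspace_iff] at hX
      have key : ∀ (n : ℕ) (v : ExteriorAlgebra 𝕜 L), extDer A v = (n : 𝕜) • v →
          extDer A (ExteriorAlgebra.ι 𝕜 X * v)
            = ((m + n : ℕ) : 𝕜) • (ExteriorAlgebra.ι 𝕜 X * v) := by
        intro n v hv
        rw [extDer_ι_mul, hX, hv, map_smul, smul_mul_assoc, mul_smul_comm, ← add_smul,
          Nat.cast_add]
      obtain ⟨_, ⟨v, rfl⟩, u, hu, rfl⟩ := Submodule.mem_sup.1 ha
      rw [mul_add]
      refine add_mem ?_ ?_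
      · rcases m with _ | m
        · refine Submodule.mem_sup_left
            ⟨ExteriorAlgebra.ι 𝕜 ⟨X, by simpa using hX⟩ * v, ?_⟩
          change ExteriorAlgebra.map _ _ = _
          rw [map_ι_mul]
          rfl
        · refine hpos m _ ?_
          have := key 0 _ (by rw [Nat.cast_zero, zero_smul]; exact hmap v)
          exact this
      · clear ha
        induction hu using Submodule.iSup_induction' with
        | zero => simp
        | add u v _ _ hu hv => rw [mul_add]; exact add_mem hu hv
        | mem n u hu =>
          exact hpos (m + n) _ (key (n + 1) _ (Module.End.mem_eigenspace_iff.1 hu))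

theorem extDer_eq_zero_iff {w : ExteriorAlgebra 𝕜 L} :
    extDer A w = 0 ↔ ∃ v, ExteriorAlgebra.map (LinearMap.ker A).subtype v = w := by
  constructor
  · intro hw
    obtain ⟨_, ⟨v, rfl⟩, u, hu, rfl⟩ :=
      Submodule.mem_sup.1 (mem_range_map_sup_eigenspace hA w)
    refine ⟨v, ?_⟩
    have hv : extDer A (ExteriorAlgebra.map (LinearMap.ker A).subtype v) = 0 := by
      rw [← map_extDer (S := 0) (fun X => by simp), extDer_zero, LinearMap.zero_apply, map_zero]
    have hu' : extDer A u = 0 := by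
      rw [map_add] at hw
      rwa [AlgHom.toLinearMap_apply, hv, zero_add] at hw
    rw [Submodule.disjoint_def.1 (disjoint_eigenspace_zero (extDer A)) u hu' hu, add_zero]
    rfl
  · rintro ⟨v, rfl⟩
    rw [← map_extDer (S := 0) (fun X => by simp), extDer_zero, LinearMap.zero_apply, map_zero]

/-- The derivation kills the image of ⋀ ker A and preserves the sum of its positive eigenspaces,
which meets its kernel trivially. This is the semisimplicity at 0 required by the homotopy argument.
-/
theorem extDer_eq_zero_of_extDer_extDer {w : ExteriorAlgebra 𝕜 L}
    (hw : extDer A (extDer A w) = 0) : extDer A w = 0 := by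
  obtain ⟨_, ⟨v, rfl⟩, u, hu, rfl⟩ :=
    Submodule.mem_sup.1 (mem_range_map_sup_eigenspace hA w)
  have hv : extDer A (ExteriorAlgebra.map (LinearMap.ker A).subtype v) = 0 :=
    (extDer_eq_zero_iff hA).2 ⟨v, rfl⟩
  have hu' : extDer A u ∈ ⨆ n : ℕ, (extDer A).eigenspace ((n + 1 : ℕ) : 𝕜) := by
    clear hw
    induction hu using Submodule.iSup_induction' with
    | zero => simp
    | add u v _ _ hu hv => rw [map_add]; exact add_mem hu hv
    | mem n u hu =>
      rw [Module.End.mem_eigenspace_iff.1 hu]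
      exact Submodule.smul_mem _ _ (Submodule.mem_iSup_of_mem n hu)
  refine Submodule.disjoint_def.1 (disjoint_eigenspace_zero (extDer A)) _ hw ?_
  rw [map_add]
  rwa [AlgHom.toLinearMap_apply, hv, zero_add]

end Spectral

/-! ### Cohomology from a contracting homotopy -/

section Homotopy

variable {𝕜 L : Type*} [Field 𝕜] [LieRing L] [LieAlgebra 𝕜 L]

/-- On the finite-dimensional stable subspace W the kernel and the range of f are disjoint, hence
complementary by rank-nullity. Both components are thereby found inside W, that is, among the
invariants in the application. -/
theorem exists_eq_add_of_mapsTo {V : Type*} [AddCommGroup V] [Module 𝕜 V] {f : Module.End 𝕜 V}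
    (hf : ∀ v, f (f v) = 0 → f v = 0) {W : Submodule 𝕜 V} [FiniteDimensional 𝕜 W]
    (hW : ∀ v ∈ W, f v ∈ W) {v : V} (hv : v ∈ W) :
    ∃ v₀ ∈ W, ∃ v₁ ∈ W, f v₀ = 0 ∧ v = v₀ + f v₁ := by
  let f' : Module.End 𝕜 W := f.restrict hW
  have hd : Disjoint (LinearMap.ker f') (LinearMap.range f') := by
    rw [Submodule.disjoint_def]
    rintro _ hx ⟨y, rfl⟩
    have h1 : f (f y) = 0 := congrArg Subtype.val (LinearMap.mem_ker.1 hx)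
    exact Subtype.ext (hf _ h1)
  have ht : LinearMap.ker f' ⊔ LinearMap.range f' = ⊤ := by
    refine Submodule.eq_top_of_disjoint _ _ ?_ hd
    rw [add_comm]
    exact (LinearMap.finrank_range_add_finrank_ker f').ge
  obtain ⟨x, hx, _, ⟨y, rfl⟩, hxy⟩ := Submodule.mem_sup.1
    (ht ▸ Submodule.mem_top : (⟨v, hv⟩ : W) ∈ LinearMap.ker f' ⊔ LinearMap.range f')
  exact ⟨x, x.2, y, y.2, congrArg Subtype.val (LinearMap.mem_ker.1 hx),
    (congrArg Subtype.val hxy).symm⟩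

variable [FiniteDimensional 𝕜 L]

instance (K : LieSubalgebra 𝕜 L) (k : ℕ) : FiniteDimensional 𝕜 (invariants K k) :=
  Submodule.finiteDimensional_of_le (S₂ := ⋀[𝕜]^k L) inf_le_left

/-- If `⟦ρ, ·⟧` is a differential on the invariants of `K` with a homotopy `i` such that
`T = ⟦ρ, ·⟧ i + i ⟦ρ, ·⟧` is semisimple at `0` and `⟦ρ, ·⟧` vanishes on the kernel of `T`, then
the cohomology is the kernel of `T` on the invariants. -/
theorem exists_cohomology_equiv {ρ : ExteriorAlgebra 𝕜 L} {K : LieSubalgebra 𝕜 L} {k : ℕ}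
    {i T : Module.End 𝕜 (ExteriorAlgebra 𝕜 L)}
    (hd : ∀ (k : ℕ), ∀ a ∈ invariants K k,
      schouten ρ a ∈ invariants K (k + 1) ∧ schouten ρ (schouten ρ a) = 0)
    (hi : ∀ (k : ℕ), ∀ a ∈ invariants K (k + 1), i a ∈ invariants K k)
    (hi₀ : ∀ a ∈ invariants K 0, i a = 0)
    (hT : ∀ w, i (schouten ρ w) + schouten ρ (i w) = T w)
    (hTK : ∀ (k : ℕ), ∀ a ∈ invariants K k, T a ∈ invariants K k)
    (hdT : ∀ w, T w = 0 → schouten ρ w = 0)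
    (hTT : ∀ w, T (T w) = 0 → T w = 0)
    {M : Type*} [AddCommGroup M] [Module 𝕜 M] (J : M →ₗ[𝕜] ExteriorAlgebra 𝕜 L)
    (hJ : Function.Injective J) (hJK : ∀ m, J m ∈ invariants K (k + 1)) (hJT : ∀ m, T (J m) = 0)
    (hJs : ∀ w ∈ invariants K (k + 1), T w = 0 → ∃ m, J m = w) :
    ∃ φ : M ≃ₗ[𝕜] Cohomology ρ K (k + 1), ∀ m, ∃ z : cocycles ρ K (k + 1),
      (z : ExteriorAlgebra 𝕜 L) = J m ∧ φ m = cohomologyClass ρ K (k + 1) z := by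
  -- Both sides equal d i d a because d² = 0. As d² = 0 is known on invariants only, i a must be
  -- invariant; in degree 0 it is zero.
  have hcomm : ∀ (k : ℕ), ∀ a ∈ invariants K k, T (schouten ρ a) = schouten ρ (T a) := by
    intro k a ha
    have h1 : schouten ρ (schouten ρ (i a)) = 0 := by
      rcases k with _ | k
      · rw [hi₀ a ha, map_zero, map_zero]
      · exact (hd k _ (hi k a ha)).2
    rw [← hT, ← hT, map_add, h1, (hd k a ha).2, map_zero, zero_add, add_zero]
  have hJz : ∀ m, J m ∈ cocycles ρ K (k + 1) := fun m => ⟨hJK m, hdT _ (hJT m)⟩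
  let ψ : M →ₗ[𝕜] Cohomology ρ K (k + 1) :=
    cohomologyClass ρ K (k + 1) ∘ₗ J.codRestrict _ hJz
  have hψ : ∀ m, ψ m = cohomologyClass ρ K (k + 1) ⟨J m, hJz m⟩ := fun _ => rfl
  have hinj : Function.Injective ψ := by
    rw [← LinearMap.ker_eq_bot, LinearMap.ker_eq_bot']
    intro m hm
    rw [hψ, cohomologyClass, Submodule.mkQ_apply, Submodule.Quotient.mk_eq_zero] at hm
    obtain ⟨a, ha, hae⟩ := hm
    -- If J m = d a with a = a₀ + T a₁, then J m = T (d a₁) lies in both the range and the kernel of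
    -- T, hence is zero.
    obtain ⟨a₀, _, a₁, ha₁, h0, rfl⟩ := exists_eq_add_of_mapsTo hTT (hTK k) ha
    rw [map_add, hdT _ h0, zero_add, ← hcomm k a₁ ha₁] at hae
    have h2 := hJT m
    change _ = J m at hae
    rw [← hae] at h2
    refine hJ ?_
    rw [map_zero, ← hae, hTT _ h2]
  have hsurj : Function.Surjective ψ := by
    intro c
    obtain ⟨⟨z, hz⟩, rfl⟩ := Submodule.mkQ_surjective _ c
    obtain ⟨z₀, hz₀, z₁, hz₁, h0, h1⟩ := exists_eq_add_of_mapsTo hTT (hTK (k + 1)) hz.1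
    -- Decomposing a second time gives z = z₀ + T (T y₁). From d z = 0 it follows that T (T (d y₁))
    -- = 0, so d (T y₁) = T (d y₁) = 0, and the homotopy formula exhibits T (T y₁) as the coboundary
    -- d (i (T y₁)).
    obtain ⟨y₀, _, y₁, hy₁, h2, h3⟩ := exists_eq_add_of_mapsTo hTT (hTK (k + 1)) hz₁
    rw [h3, map_add, h2, zero_add] at h1
    obtain ⟨m, hm⟩ := hJs z₀ hz₀ h0
    have h4 : schouten ρ (T y₁) = 0 := by
      have h5 : schouten ρ z = 0 := hz.2
      have h6 := hTK (k + 1) y₁ hy₁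
      rw [h1, map_add, hdT _ h0, zero_add, ← hcomm _ _ h6, ← hcomm _ _ hy₁] at h5
      rw [← hcomm _ _ hy₁]
      exact hTT _ h5
    refine ⟨m, ?_⟩
    rw [hψ, cohomologyClass, Submodule.mkQ_apply, Submodule.mkQ_apply, Submodule.Quotient.eq]
    refine ⟨-i (T y₁), neg_mem (hi k _ (hTK _ _ hy₁)), ?_⟩
    have h7 := hT (T y₁)
    rw [h4, map_zero, zero_add] at h7
    rw [map_neg, h7]
    change -T (T y₁) = J m - z
    rw [hm, h1]
    abel
  exact ⟨LinearEquiv.ofBijective ψ ⟨hinj, hsurj⟩, fun m => ⟨⟨J m, hJz m⟩, rfl, rfl⟩⟩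

end Homotopy

/-! ### Invariants of low degree -/

section LowDegree

variable {𝕜 L : Type*} [Field 𝕜]

section Linear

variable [AddCommGroup L] [Module 𝕜 L] {B : LinearMap.BilinForm 𝕜 L}
  {κ : Type*} [Fintype κ] {e e' : κ → L}

theorem contract_eq_of_sub_eq_zero {x y : L} {w : ExteriorAlgebra 𝕜 L}
    (h : contract (B (x - y)) w = 0) : contract (B x) w = contract (B y) w := by
  rw [map_sub, sub_eq_add_neg, contract_add, contract_neg, LinearMap.add_apply,
    LinearMap.neg_apply, ← sub_eq_add_neg] at h
  exact sub_eq_zero.1 h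

/-- If the contractions of `w` with the kernel of a self-adjoint projection `p` vanish, then `p`
fixes `w`. -/
theorem IsDualPair.map_eq_self [CharZero 𝕜] (h : IsDualPair B e e') (hB : ∀ x y, B x y = B y x)
    {p : Module.End 𝕜 L} (hp : ∀ x y, B (p x) y = B x (p y)) (hpp : ∀ x, p (p x) = p x)
    {k : ℕ} {w : ExteriorAlgebra 𝕜 L} (hw : w ∈ ⋀[𝕜]^k L)
    (hc : ∀ x, p x = 0 → contract (B x) w = 0) : ExteriorAlgebra.map p w = w := by
  induction k generalizing w with
  | zero => exact map_eq_self_of_mem_zero p hw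
  | succ k ih =>
    rw [← sub_eq_zero]
    -- Contraction of w with B x depends only on p x, and on the image of w under p self-adjointness
    -- of p gives the same dependence. The two sides thus have equal contractions by the statement
    -- one degree lower.
    refine h.eq_zero_of_contract hB (sub_mem (map_mem p hw) hw) fun x => ?_
    have h1 : B x ∘ₗ p = B (p x) := by
      ext y
      exact (hp x y).symm
    have h2 : contract (B x) w = contract (B (p x)) w :=
      contract_eq_of_sub_eq_zero (hc _ (by rw [map_sub, hpp, sub_self]))
    rw [map_sub, contract_map, h1, h2, sub_eq_zero]
    refine ih (contract_mem _ hw) fun y hy => ?_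
    rw [contract_comm, hc y hy, map_zero, neg_zero]

end Linear

variable [LieRing L] [LieAlgebra 𝕜 L]

/-- The endomorphisms `p` and `q` are the orthogonal projections to `C` and to the perfect
subalgebra `K`, which centralises `C`, and `l` is contained in `C + K`. -/
structure IsLeviDecomposition (B : LinearMap.BilinForm 𝕜 L) (K : LieSubalgebra 𝕜 L)
    (C l : Submodule 𝕜 L) (p q : Module.End 𝕜 L) : Prop where
  p_mem : ∀ x, p x ∈ C
  p_of_mem : ∀ x ∈ C, p x = x
  p_adjoint : ∀ x y, B (p x) y = B x (p y)
  p_eq_zero : ∀ x ∈ K, p x = 0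
  q_mem : ∀ x, q x ∈ K
  q_of_mem : ∀ x ∈ K, q x = x
  q_adjoint : ∀ x y, B (q x) y = B x (q y)
  q_eq_zero : ∀ x ∈ C, q x = 0
  q_lie : ∀ x ∈ K, ∀ y, q ⁅x, y⁆ = ⁅x, q y⁆
  add_eq : ∀ x ∈ l, p x + q x = x
  lie_eq_zero : ∀ x ∈ K, ∀ c ∈ C, ⁅x, c⁆ = 0
  le_span : K.toSubmodule ≤ Submodule.span 𝕜 {z | ∃ x ∈ K, ∃ y ∈ K, ⁅x, y⁆ = z}

/-- As K centralises c, the linear form B c is K-invariant, and contraction with it commutes with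
the action of K. -/
theorem contract_mem_invariants {B : LinearMap.BilinForm 𝕜 L} (hinv : B.lieInvariant L)
    {K : LieSubalgebra 𝕜 L} {c : L} (hc : ∀ x ∈ K, ⁅x, c⁆ = 0) {k : ℕ} {w : ExteriorAlgebra 𝕜 L}
    (hw : w ∈ invariants K (k + 1)) : contract (B c) w ∈ invariants K k := by
  rw [mem_invariants] at hw ⊢
  refine ⟨contract_mem _ hw.1, fun x hx => ?_⟩
  have h := contract_adExt (B c) x w
  have h0 : B c ∘ₗ LieAlgebra.ad 𝕜 L x = 0 := by
    ext y
    rw [LinearMap.comp_apply, LieAlgebra.ad_apply, LinearMap.zero_apply, ← neg_eq_zero, ← hinv,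
      hc x hx, map_zero, LinearMap.zero_apply]
  rw [hw.2 x hx, map_zero, h0, contract_zero, LinearMap.zero_apply, add_zero] at h
  exact h.symm

namespace IsLeviDecomposition

variable {B : LinearMap.BilinForm 𝕜 L} {K : LieSubalgebra 𝕜 L}
  {C l : Submodule 𝕜 L} {p q : Module.End 𝕜 L} {κ : Type*} [Fintype κ] {e e' : κ → L}

/-- Since p and q are self-adjoint and p + q is the identity on l, the element x - (p x + q x) is
orthogonal to l. Contractions of elements of ⋀ l need only be tested against C and K. -/
theorem contract_eq_zero (hd : IsLeviDecomposition B K C l p q)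
    {w : ExteriorAlgebra 𝕜 L} (hw : ∃ v, ExteriorAlgebra.map l.subtype v = w) (x : L) :
    contract (B (x - (p x + q x))) w = 0 := by
  obtain ⟨v, rfl⟩ := hw
  have h : B (x - (p x + q x)) ∘ₗ l.subtype = 0 := by
    ext ⟨y, hy⟩
    simp only [LinearMap.comp_apply, Submodule.subtype_apply, map_sub, map_add,
      LinearMap.sub_apply, LinearMap.add_apply, hd.p_adjoint, hd.q_adjoint, LinearMap.zero_apply]
    rw [← map_add, hd.add_eq y hy, sub_self]
  rw [contract_map, h, contract_zero, LinearMap.zero_apply, map_zero]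

theorem contract_lie (hinv : B.lieInvariant L) {k : ℕ} {w : ExteriorAlgebra 𝕜 L}
    (hw : w ∈ invariants K k) {x : L} (hx : x ∈ K) (y : L) :
    contract (B ⁅x, y⁆) w = adExt x (contract (B y) w) := by
  have h := contract_adExt (B y) x w
  have h0 : B y ∘ₗ LieAlgebra.ad 𝕜 L x = -B ⁅x, y⁆ := by
    ext z
    rw [LinearMap.comp_apply, LieAlgebra.ad_apply, LinearMap.neg_apply, hinv, neg_neg]
  rw [(mem_invariants.1 hw).2 x hx, map_zero, h0, contract_neg, LinearMap.neg_apply,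
    ← sub_eq_add_neg] at h
  exact (sub_eq_zero.1 h.symm).symm

theorem contract_mem_map {w : ExteriorAlgebra 𝕜 L}
    (hw : ∃ v, ExteriorAlgebra.map l.subtype v = w) (φ : Module.Dual 𝕜 L) :
    ∃ v, ExteriorAlgebra.map l.subtype v = contract φ w := by
  obtain ⟨v, rfl⟩ := hw
  exact ⟨_, (contract_map _ _ _).symm⟩

theorem contract_eq_zero_of_lie (hd : IsLeviDecomposition B K C l p q)
    {w : ExteriorAlgebra 𝕜 L} (hw : ∀ x ∈ K, ∀ y ∈ K, contract (B ⁅x, y⁆) w = 0)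
    {z : L} (hz : z ∈ K) : contract (B z) w = 0 := by
  have hz' := hd.le_span hz
  clear hz
  induction hz' using Submodule.span_induction with
  | mem z h => obtain ⟨x, hx, y, hy, rfl⟩ := h; exact hw x hx y hy
  | zero => simp
  | add a b _ _ ha hb =>
    rw [map_add, contract_add, LinearMap.add_apply, ha, hb, add_zero]
  | smul c a _ ha => rw [map_smul, contract_smul, LinearMap.smul_apply, ha, smul_zero]

/-- Contraction with B [x, y] is ad x applied to a scalar, hence zero, and K is spanned by brackets.
-/
theorem contract_eq_zero_of_one (hd : IsLeviDecomposition B K C l p q)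
    (hinv : B.lieInvariant L) {w : ExteriorAlgebra 𝕜 L} (hw : w ∈ invariants K 1)
    {z : L} (hz : z ∈ K) : contract (B z) w = 0 := by
  refine hd.contract_eq_zero_of_lie (fun x hx y _ => ?_) hz
  rw [contract_lie hinv hw hx]
  obtain ⟨r, hr⟩ := mem_exteriorPower_zero.1 (contract_mem (B y) (mem_invariants.1 hw).1)
  rw [← hr, map_smul, adExt_one, smul_zero]

/-- Contracting w twice defines a K-invariant skew form b. It vanishes between C and K by the
degree-one case, and between K and K because an invariant skew form on a perfect Lie algebra is
zero. -/
theorem contract_eq_zero_of_two [CharZero 𝕜] (hd : IsLeviDecomposition B K C l p q)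
    (h : IsDualPair B e e') (hB : ∀ x y, B x y = B y x)
    (hinv : B.lieInvariant L) {w : ExteriorAlgebra 𝕜 L} (hw : w ∈ invariants K 2)
    (hwl : ∃ v, ExteriorAlgebra.map l.subtype v = w)
    {z : L} (hz : z ∈ K) : contract (B z) w = 0 := by
  have hw2 := (mem_invariants.1 hw).1
  let b : L → L → ExteriorAlgebra 𝕜 L := fun y z => contract (B y) (contract (B z) w)
  have hskew : ∀ y z, b y z = -b z y := fun y z => contract_comm _ _ _
  have hmove : ∀ x ∈ K, ∀ y z, b y ⁅x, z⁆ = -b ⁅x, y⁆ z := by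
    intro x hx y z
    have h0 : B y ∘ₗ LieAlgebra.ad 𝕜 L x = -B ⁅x, y⁆ := by
      ext z
      rw [LinearMap.comp_apply, LieAlgebra.ad_apply, LinearMap.neg_apply, hinv, neg_neg]
    obtain ⟨r, hr⟩ := mem_exteriorPower_zero.1 (contract_mem (B y) (contract_mem (B z) hw2))
    simp only [b]
    rw [contract_lie hinv hw hx, contract_adExt, ← hr, map_smul, adExt_one, smul_zero, zero_add,
      h0, contract_neg, LinearMap.neg_apply]
  have hsymm : ∀ x ∈ K, ∀ y z, b ⁅x, y⁆ z = b ⁅x, z⁆ y := by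
    intro x hx y z
    rw [hskew ⁅x, z⁆, hmove x hx, neg_neg]
  have hanti : ∀ x y z, b ⁅x, y⁆ z = -b ⁅y, x⁆ z := by
    intro x y z
    simp only [b]
    rw [← lie_skew, map_neg, contract_neg, LinearMap.neg_apply]
  -- The trilinear expression b([x, y], z) is antisymmetric in x, y and symmetric in y, z. The two
  -- symmetries generate all permutations, and they are compatible only if it vanishes.
  have hlie : ∀ x ∈ K, ∀ y ∈ K, ∀ z ∈ K, b ⁅x, y⁆ z = 0 := by
    intro x hx y hy z hz
    have h1 : b ⁅x, y⁆ z = -b ⁅x, y⁆ z := by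
      calc b ⁅x, y⁆ z = b ⁅x, z⁆ y := hsymm x hx y z
        _ = -b ⁅z, x⁆ y := hanti x z y
        _ = -b ⁅z, y⁆ x := by rw [hsymm z hz]
        _ = b ⁅y, z⁆ x := by rw [hanti z y, neg_neg]
        _ = b ⁅y, x⁆ z := hsymm y hy z x
        _ = -b ⁅x, y⁆ z := hanti y x z
    have h2 : (2 : 𝕜) • b ⁅x, y⁆ z = 0 := by
      rw [two_smul]
      exact eq_neg_iff_add_eq_zero.1 h1
    exact (smul_eq_zero.1 h2).resolve_left two_ne_zero
  refine h.eq_zero_of_contract hB (contract_mem (B z) hw2) fun x => ?_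
  have hx : contract (B x) (contract (B z) w) = contract (B (p x + q x)) (contract (B z) w) := by
    refine contract_eq_of_sub_eq_zero ?_
    rw [contract_comm, hd.contract_eq_zero hwl, map_zero, neg_zero]
  have hp : contract (B (p x)) (contract (B z) w) = 0 := by
    rw [contract_comm, hd.contract_eq_zero_of_one hinv (contract_mem_invariants hinv
      (fun y hy => hd.lie_eq_zero y hy _ (hd.p_mem x)) hw) hz, neg_zero]
  have hq : contract (B (q x)) (contract (B z) w) = 0 :=
    hd.contract_eq_zero_of_lie (fun x hx y hy => hlie x hx y hy z hz) (hd.q_mem x)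
  rw [hx, map_add, contract_add, LinearMap.add_apply, hp, hq, add_zero]

theorem map_p_eq_self [CharZero 𝕜] (hd : IsLeviDecomposition B K C l p q)
    (h : IsDualPair B e e') (hB : ∀ x y, B x y = B y x) {k : ℕ}
    {w : ExteriorAlgebra 𝕜 L} (hw : w ∈ ⋀[𝕜]^k L)
    (hwl : ∃ v, ExteriorAlgebra.map l.subtype v = w)
    (hc : ∀ x ∈ K, contract (B x) w = 0) : ExteriorAlgebra.map p w = w := by
  refine h.map_eq_self hB hd.p_adjoint (fun x => hd.p_of_mem _ (hd.p_mem x)) hw fun x hx => ?_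
  rw [contract_eq_of_sub_eq_zero (hd.contract_eq_zero hwl x), hx, zero_add]
  exact hc _ (hd.q_mem x)

theorem map_p_eq_self_of_one [CharZero 𝕜] (hd : IsLeviDecomposition B K C l p q)
    (h : IsDualPair B e e') (hB : ∀ x y, B x y = B y x)
    (hinv : B.lieInvariant L) {w : ExteriorAlgebra 𝕜 L} (hw : w ∈ invariants K 1)
    (hwl : ∃ v, ExteriorAlgebra.map l.subtype v = w) : ExteriorAlgebra.map p w = w :=
  hd.map_p_eq_self h hB (mem_invariants.1 hw).1 hwl
    fun _ hx => hd.contract_eq_zero_of_one hinv hw hx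

theorem map_p_eq_self_of_two [CharZero 𝕜] (hd : IsLeviDecomposition B K C l p q)
    (h : IsDualPair B e e') (hB : ∀ x y, B x y = B y x)
    (hinv : B.lieInvariant L) {w : ExteriorAlgebra 𝕜 L} (hw : w ∈ invariants K 2)
    (hwl : ∃ v, ExteriorAlgebra.map l.subtype v = w) : ExteriorAlgebra.map p w = w :=
  hd.map_p_eq_self h hB (mem_invariants.1 hw).1 hwl
    fun _ hx => hd.contract_eq_zero_of_two h hB hinv hw hwl hx

/-- Contracting w with an element of C gives an invariant of degree 2, which is fixed by p. Hence w
has no mixed components: after its ⋀³ C part is subtracted, all contractions with the kernel of q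
vanish and q fixes the remainder. -/
theorem map_p_add_map_q [CharZero 𝕜] (hd : IsLeviDecomposition B K C l p q)
    (h : IsDualPair B e e') (hB : ∀ x y, B x y = B y x)
    (hinv : B.lieInvariant L) {w : ExteriorAlgebra 𝕜 L} (hw : w ∈ invariants K 3)
    (hwl : ∃ v, ExteriorAlgebra.map l.subtype v = w) :
    ExteriorAlgebra.map p w + ExteriorAlgebra.map q w = w := by
  have hw3 := (mem_invariants.1 hw).1
  have hBp : ∀ x, B x ∘ₗ p = B (p x) := fun x => by
    ext y
    exact (hd.p_adjoint x y).symm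
  have h1 : ExteriorAlgebra.map q (w - ExteriorAlgebra.map p w) = w - ExteriorAlgebra.map p w := by
    refine h.map_eq_self hB hd.q_adjoint (fun x => hd.q_of_mem _ (hd.q_mem x))
      (sub_mem hw3 (map_mem p hw3)) fun x hx => ?_
    have h2 : contract (B x) w = contract (B (p x)) w := by
      rw [contract_eq_of_sub_eq_zero (hd.contract_eq_zero hwl x), hx, add_zero]
    rw [map_sub, contract_map, hBp, h2, hd.map_p_eq_self_of_two h hB hinv
      (contract_mem_invariants hinv (fun y hy => hd.lie_eq_zero y hy _ (hd.p_mem x)) hw)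
      (contract_mem_map hwl _), sub_self]
  have h3 : q ∘ₗ p = 0 := by
    ext x
    exact hd.q_eq_zero _ (hd.p_mem x)
  rw [map_sub, map_map_apply, h3, map_zero_of_mem_succ hw3, sub_zero] at h1
  rw [h1]
  abel

theorem map_subtype_center_mem (hd : IsLeviDecomposition B K C l p q) {k : ℕ}
    {v : ExteriorAlgebra 𝕜 C} (hv : v ∈ ⋀[𝕜]^k C) :
    ExteriorAlgebra.map C.subtype v ∈ invariants K k := by
  refine mem_invariants.2 ⟨map_mem _ hv, fun x hx => ?_⟩
  have := map_extDer (f := C.subtype) (S := 0) (T := LieAlgebra.ad 𝕜 L x)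
    (fun X => by simp [hd.lie_eq_zero x hx X X.2]) v
  rw [extDer_zero, LinearMap.zero_apply, map_zero] at this
  exact this.symm

theorem map_subtype_subalgebra_mem {k : ℕ} {v : ExteriorAlgebra 𝕜 K}
    (hv : v ∈ invariants (⊤ : LieSubalgebra 𝕜 K) k) :
    ExteriorAlgebra.map K.toSubmodule.subtype v ∈ invariants K k := by
  rw [mem_invariants] at hv
  refine mem_invariants.2 ⟨map_mem _ hv.1, fun x hx => ?_⟩
  have := map_extDer (f := K.toSubmodule.subtype) (S := LieAlgebra.ad 𝕜 K ⟨x, hx⟩)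
    (T := LieAlgebra.ad 𝕜 L x) (fun X => rfl) v
  rw [show extDer (LieAlgebra.ad 𝕜 K ⟨x, hx⟩) v = 0 from hv.2 ⟨x, hx⟩ trivial, map_zero] at this
  exact this.symm

/-- The projection `p` as a map to `C`. -/
def toCenter (hd : IsLeviDecomposition B K C l p q) : L →ₗ[𝕜] C :=
  p.codRestrict C hd.p_mem

/-- The projection `q` as a map to `K`. -/
def toSubalgebra (hd : IsLeviDecomposition B K C l p q) : L →ₗ[𝕜] K :=
  q.codRestrict K.toSubmodule hd.q_mem

theorem map_toCenter (hd : IsLeviDecomposition B K C l p q) (w : ExteriorAlgebra 𝕜 L) :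
    ExteriorAlgebra.map C.subtype (ExteriorAlgebra.map hd.toCenter w)
      = ExteriorAlgebra.map p w := by
  rw [map_map_apply]
  rfl

theorem map_toSubalgebra (hd : IsLeviDecomposition B K C l p q) (w : ExteriorAlgebra 𝕜 L) :
    ExteriorAlgebra.map K.toSubmodule.subtype (ExteriorAlgebra.map hd.toSubalgebra w)
      = ExteriorAlgebra.map q w := by
  rw [map_map_apply]
  rfl

theorem map_toSubalgebra_mem (hd : IsLeviDecomposition B K C l p q) {k : ℕ}
    {w : ExteriorAlgebra 𝕜 L} (hw : w ∈ invariants K k) :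
    ExteriorAlgebra.map hd.toSubalgebra w ∈ invariants (⊤ : LieSubalgebra 𝕜 K) k := by
  rw [mem_invariants] at hw
  refine mem_invariants.2 ⟨map_mem _ hw.1, fun x _ => ?_⟩
  have := map_extDer (f := hd.toSubalgebra) (S := LieAlgebra.ad 𝕜 L x)
    (T := LieAlgebra.ad 𝕜 K x) (fun X => Subtype.ext (hd.q_lie x x.2 X)) w
  rw [show extDer (LieAlgebra.ad 𝕜 L (x : L)) w = 0 from hw.2 x x.2, map_zero] at this
  exact this.symm

theorem map_toCenter_map_subtype (hd : IsLeviDecomposition B K C l p q)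
    (v : ExteriorAlgebra 𝕜 C) :
    ExteriorAlgebra.map hd.toCenter (ExteriorAlgebra.map C.subtype v) = v := by
  have h : hd.toCenter ∘ₗ C.subtype = LinearMap.id := by
    ext x
    exact hd.p_of_mem x x.2
  rw [map_map_apply, h, ExteriorAlgebra.map_id]
  rfl

theorem map_toSubalgebra_map_subtype (hd : IsLeviDecomposition B K C l p q)
    (v : ExteriorAlgebra 𝕜 K) :
    ExteriorAlgebra.map hd.toSubalgebra (ExteriorAlgebra.map K.toSubmodule.subtype v) = v := by
  have h : hd.toSubalgebra ∘ₗ K.toSubmodule.subtype = LinearMap.id := by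
    ext x
    exact hd.q_of_mem x x.2
  rw [map_map_apply, h, ExteriorAlgebra.map_id]
  rfl

theorem map_toCenter_map_subalgebra (hd : IsLeviDecomposition B K C l p q) {k : ℕ}
    {v : ExteriorAlgebra 𝕜 K} (hv : v ∈ ⋀[𝕜]^(k + 1) K) :
    ExteriorAlgebra.map hd.toCenter (ExteriorAlgebra.map K.toSubmodule.subtype v) = 0 := by
  have h : hd.toCenter ∘ₗ K.toSubmodule.subtype = 0 := by
    ext x
    exact hd.p_eq_zero x x.2
  rw [map_map_apply, h, map_zero_of_mem_succ hv]

end IsLeviDecomposition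

end LowDegree

open LieAlgebra LieAlgebra.IsKilling LieModule

/-! ### Root spaces -/

section RootSpaces

variable {K L : Type*} [Field K] [LieRing L] [LieAlgebra K L] [FiniteDimensional K L]
  {H : LieSubalgebra K L} [H.IsCartanSubalgebra]

theorem mem_rootSpace_zero_iff {x : L} : x ∈ rootSpace H (0 : H → K) ↔ x ∈ H := by
  rw [rootSpace_zero_eq K L H, LieSubalgebra.mem_toLieSubmodule]

theorem mem_of_forall_rootSpace [IsTriangularizable K H L] {S : Submodule K L}
    (h : ∀ χ : Weight K H L, ∀ x ∈ rootSpace H χ, x ∈ S) (x : L) : x ∈ S := by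
  have htop : (⨆ χ : Weight K H L, (rootSpace H χ).toSubmodule) = ⊤ := by
    have := iSup_genWeightSpace_eq_top' K H L
    rw [← LieSubmodule.toSubmodule_inj, LieSubmodule.iSup_toSubmodule] at this
    simpa using this
  have hle : (⨆ χ : Weight K H L, (rootSpace H χ).toSubmodule) ≤ S :=
    iSup_le fun χ x hx => h χ x hx
  exact hle (htop ▸ Submodule.mem_top)

variable [CharZero K] [IsKilling K L] [IsTriangularizable K H L]

/-- This is sl₂ theory on the α-string through β: raising is injective below the top of the string.
-/
theorem exists_lie_ne_zero {α β : Weight K H L} (hα : α.IsNonZero)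
    (hαβ : rootSpace H (α + β : H → K) ≠ ⊥) :
    ∃ x ∈ rootSpace H α, ∃ y ∈ rootSpace H β, ⁅x, y⁆ ≠ 0 := by
  have h1 : 1 ≤ chainTopCoeff α β := by
    have := (rootSpace_zsmul_add_ne_bot_iff α β hα 1).1 (by rwa [one_smul])
    exact_mod_cast this.1
  obtain ⟨m, hm⟩ := Nat.exists_eq_add_of_le' h1
  obtain ⟨v, hv, hv0⟩ := (chainTop α β).exists_ne_zero
  obtain ⟨h, e, f, isSl2, he, hf⟩ := exists_isSl2Triple_of_weight_isNonZero hα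
  obtain rfl := isSl2.h_eq_coroot hα he hf
  have prim : isSl2.HasPrimitiveVectorWith v (chainLength α β : K) :=
    have := lie_mem_genWeightSpace_of_mem_genWeightSpace he hv
    ⟨hv0, (chainLength_smul _ _ hv).symm, by rwa [genWeightSpace_add_chainTop _ _ hα] at this⟩
  have hle := chainTopCoeff_le_chainLength α β
  -- Here v spans the top β + (m + 1)α of the string, so lowering it m + 1 times lands in weight β.
  -- Raising once returns (m + 1)(`chainLength α β` - m) times a nonzero vector.
  refine ⟨e, he, (toEnd K L L f ^ (m + 1)) v, ?_, ?_⟩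
  · have := toEnd_pow_apply_mem hf hv (m + 1)
    rwa [coe_chainTop', hm, smul_neg, neg_add_cancel_left] at this
  · rw [prim.lie_e_pow_succ_toEnd_f]
    refine smul_ne_zero (mul_ne_zero (by exact_mod_cast m.succ_ne_zero) ?_)
      (prim.pow_toEnd_f_ne_zero_of_eq_nat rfl (by omega))
    rw [sub_ne_zero]
    exact_mod_cast (by omega : chainLength α β ≠ m)

theorem exists_smul_of_mem_rootSpace {α : Weight K H L} (hα : α.IsNonZero) {x y : L}
    (hx : x ∈ rootSpace H α) (hx0 : x ≠ 0) (hy : y ∈ rootSpace H α) : ∃ c : K, c • x = y := by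
  obtain ⟨c, hc⟩ := (finrank_eq_one_iff_of_nonzero' (⟨x, hx⟩ : rootSpace H α)
    (by simpa [Subtype.ext_iff] using hx0)).1 (finrank_rootSpace_eq_one α hα) ⟨y, hy⟩
  exact ⟨c, congrArg Subtype.val hc⟩

/-- The root space of γ is one-dimensional, so a single nonzero bracket spans it. -/
theorem rootSpace_add_le {α β γ : Weight K H L} (hα : α.IsNonZero) (hγ : γ.IsNonZero)
    (h : (γ : H → K) = α + β) {S : LieSubalgebra K L}
    (hαS : ∀ x ∈ rootSpace H α, x ∈ S) (hβS : ∀ x ∈ rootSpace H β, x ∈ S) :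
    ∀ x ∈ rootSpace H γ, x ∈ S := by
  obtain ⟨x, hx, y, hy, hxy⟩ := exists_lie_ne_zero (β := β) hα (h ▸ γ.genWeightSpace_ne_bot)
  intro z hz
  have h1 : ⁅x, y⁆ ∈ rootSpace H γ := by
    rw [h]
    exact lie_mem_genWeightSpace_of_mem_genWeightSpace hx hy
  obtain ⟨c, rfl⟩ := exists_smul_of_mem_rootSpace hγ h1 hxy hz
  exact S.smul_mem _ (S.lie_mem (hαS x hx) (hβS y hy))

theorem eq_zero_of_mem_rootSpace_of_add_ne_zero {B : LinearMap.BilinForm K L}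
    (hinv : B.lieInvariant L) {χ ψ : H → K} (hχψ : χ + ψ ≠ 0) {x y : L}
    (hx : x ∈ rootSpace H χ) (hy : y ∈ rootSpace H ψ) : B x y = 0 := by
  obtain ⟨h, hh⟩ := Function.ne_iff.1 hχψ
  have h1 := hinv (h : L) x y
  have h2 : ⁅(h : L), x⁆ = χ h • x := lie_eq_smul_of_mem_rootSpace hx h
  have h3 : ⁅(h : L), y⁆ = ψ h • y := lie_eq_smul_of_mem_rootSpace hy h
  rw [h2, h3, map_smul, map_smul, LinearMap.smul_apply, smul_eq_mul, smul_eq_mul,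
    eq_neg_iff_add_eq_zero, ← add_mul] at h1
  exact (mul_eq_zero.1 h1).resolve_left hh

/-- An element of a Cartan subalgebra on which all weights vanish is zero. -/
theorem eq_zero_of_forall_weight {x : H} (h : ∀ χ : Weight K H L, χ x = 0) : x = 0 := by
  have : x ∈ (⨅ α : Weight K H L, α.ker) := by
    rw [Submodule.mem_iInf]
    exact fun χ => h χ
  rw [iInf_ker_weight_eq_bot] at this
  exact this

end RootSpaces

/-! ### The grading element of a subset of the simple roots -/

section Grading

variable {g : Type*} [LieRing g] [LieAlgebra ℂ g] [FiniteDimensional ℂ g]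
  {H : LieSubalgebra ℂ g} [H.IsCartanSubalgebra]

theorem rootSpace_le_diagSubalgebra {D : Finset H.root} {α : H.root} (hα : α ∈ D) :
    (∀ x ∈ rootSpace H α.1, x ∈ diagSubalgebra D) ∧
      ∀ x ∈ rootSpace H (-(α.1 : H → ℂ)), x ∈ diagSubalgebra D :=
  ⟨fun _ hx => LieSubalgebra.subset_lieSpan ⟨α, hα, Or.inl hx⟩,
    fun _ hx => LieSubalgebra.subset_lieSpan ⟨α, hα, Or.inr hx⟩⟩

variable [IsSemisimple ℂ g]

/-- The simple roots form a basis of the dual of H, so their values at a point of H may be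
prescribed. -/
theorem exists_grading_element (b : (rootSystem H).Base) (D : Finset H.root) :
    ∃ ϖ : H, ∀ i ∈ b.support, (i ∈ D → i.1 ϖ = 0) ∧ (i ∉ D → i.1 ϖ = 1) := by
  classical
  let F : Module.Dual ℂ (Module.Dual ℂ H) :=
    b.toWeightBasis.constr ℂ fun i => if (i : H.root) ∈ D then 0 else 1
  refine ⟨(Module.evalEquiv ℂ H).symm F, fun i hi => ?_⟩
  have h1 : i.1 ((Module.evalEquiv ℂ H).symm F) = if i ∈ D then 0 else 1 := by
    have h2 : F ((rootSystem H).root i) = if i ∈ D then 0 else 1 := by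
      have := b.toWeightBasis.constr_basis ℂ
        (fun i => if (i : H.root) ∈ D then (0 : ℂ) else 1) ⟨i, hi⟩
      rwa [RootPairing.Base.toWeightBasis_apply] at this
    rw [← h2, ← Module.apply_evalEquiv_symm_apply ℂ H]
    rfl
  exact ⟨fun h => by rw [h1, if_pos h], fun h => by rw [h1, if_neg h]⟩

/-- The element `ϖ` of the Cartan subalgebra on which the simple roots in `D` take the value `0`
and the other simple roots take the value `1`. -/
def IsGradingElement (b : (rootSystem H).Base) (D : Finset H.root) (ϖ : H) : Prop :=
  ∀ i ∈ b.support, (i ∈ D → i.1 ϖ = 0) ∧ (i ∉ D → i.1 ϖ = 1)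

variable {b : (rootSystem H).Base} {D : Finset H.root} {ϖ : H}

/-- A positive root is built by adding simple roots one at a time through positive roots. Degrees
add, and total degree 0 forces every simple root used to lie in D; the root spaces then stay in g_D
at each stage. -/
theorem IsGradingElement.exists_nat (hϖ : IsGradingElement b D ϖ) {α : H.root}
    (hα : b.IsPos α) :
    ∃ n : ℕ, α.1 ϖ = n ∧ (n = 0 → (∀ x ∈ rootSpace H α.1, x ∈ diagSubalgebra D) ∧
      ∀ x ∈ rootSpace H (-(α.1 : H → ℂ)), x ∈ diagSubalgebra D) := by
  have simple : ∀ i ∈ b.support, ∃ n : ℕ, i.1 ϖ = n ∧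
      (n = 0 → (∀ x ∈ rootSpace H i.1, x ∈ diagSubalgebra D) ∧
      ∀ x ∈ rootSpace H (-(i.1 : H → ℂ)), x ∈ diagSubalgebra D) := by
    intro i hi
    by_cases hD : i ∈ D
    · exact ⟨0, by rw [(hϖ i hi).1 hD, Nat.cast_zero], fun _ => rootSpace_le_diagSubalgebra hD⟩
    · exact ⟨1, by rw [(hϖ i hi).2 hD, Nat.cast_one], fun h => absurd h one_ne_zero⟩
  refine hα.induction_on_add simple ?_
  rintro i j k hk ⟨n, hn, hn0⟩ hj
  obtain ⟨m, hm, hm0⟩ := simple j hj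
  have hk' : (k.1 : H → ℂ) = j.1 + i.1 := by
    ext x
    have := LinearMap.congr_fun hk x
    rw [add_comm]
    exact this
  refine ⟨n + m, ?_, fun h0 => ?_⟩
  · have := congrFun hk' ϖ
    rw [Pi.add_apply, hn, hm] at this
    rw [this, Nat.cast_add, add_comm]
  · obtain ⟨rfl, rfl⟩ : n = 0 ∧ m = 0 := by omega
    have nz : ∀ α : H.root, α.1.IsNonZero := fun α => H.isNonZero_coe_root α
    constructor
    · exact rootSpace_add_le (nz j) (nz k) hk' (hm0 rfl).1 (hn0 rfl).1
    · have := rootSpace_add_le (α := -j.1) (β := -i.1) (γ := -k.1) (S := diagSubalgebra D)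
        (nz j).neg (nz k).neg
        (by simp only [Weight.coe_neg, hk']; abel) (by simpa using (hm0 rfl).2)
        (by simpa using (hn0 rfl).2)
      simpa using this

theorem isPos_or_isPos_neg (α : H.root) (b : (rootSystem H).Base) :
    b.IsPos α ∨ ∃ β : H.root, b.IsPos β ∧ (α.1 : H → ℂ) = -(β.1 : H → ℂ) := by
  rcases RootPairing.Base.IsPos.or_neg b α with h | h
  · exact Or.inl h
  · refine Or.inr ⟨_, h, ?_⟩
    let := (rootSystem H).indexNeg
    have h1 := (rootSystem H).root_reflectionPerm α α
    rw [RootPairing.reflection_apply_self] at h1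
    ext x
    have := LinearMap.congr_fun h1 x
    change _ = -((-α : H.root).1 x)
    have h2 : ((-α : H.root).1 x) = -(α.1 x) := this
    rw [h2, neg_neg]

end Grading

/-! ### Orthogonal projections -/

section Orthogonal

variable {𝕜 V : Type*} [Field 𝕜] [AddCommGroup V] [Module 𝕜 V]

theorem restrict_nondegenerate_of_forall {B : LinearMap.BilinForm 𝕜 V}
    (hB : ∀ x y, B x y = B y x) {S : Submodule 𝕜 V}
    (hS : ∀ x ∈ S, (∀ y ∈ S, B x y = 0) → x = 0) : (B.restrict S).Nondegenerate :=
  ⟨fun x hx => Subtype.ext (hS x x.2 fun y hy => hx ⟨y, hy⟩),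
    fun x hx => Subtype.ext (hS x x.2 fun y hy => by rw [hB]; exact hx ⟨y, hy⟩)⟩

variable [FiniteDimensional 𝕜 V] in
/-- The orthogonal projection to a subspace on which a symmetric form is nondegenerate. -/
theorem exists_orthogonal_projection {B : LinearMap.BilinForm 𝕜 V}
    (hB : ∀ x y, B x y = B y x) {S : Submodule 𝕜 V}
    (hS : ∀ x ∈ S, (∀ y ∈ S, B x y = 0) → x = 0) :
    ∃ p : Module.End 𝕜 V, (∀ x, p x ∈ S) ∧ ∀ x, ∀ y ∈ S, B (p x) y = B x y := by
  have hnd := restrict_nondegenerate_of_forall hB hS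
  let p' : V →ₗ[𝕜] S :=
    ((B.restrict S).toDual hnd).symm.toLinearMap ∘ₗ (LinearMap.lcomp 𝕜 𝕜 S.subtype) ∘ₗ B
  refine ⟨S.subtype ∘ₗ p', fun x => (p' x).2, fun x y hy => ?_⟩
  exact LinearMap.BilinForm.apply_toDual_symm_apply (hB := hnd) (B x ∘ₗ S.subtype) ⟨y, hy⟩

end Orthogonal

/-! ### The Levi subalgebra -/

section Levi

variable {g : Type*} [LieRing g] [LieAlgebra ℂ g] [FiniteDimensional ℂ g]
  {H : LieSubalgebra ℂ g} [H.IsCartanSubalgebra] {D : Finset H.root}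

theorem mem_cartan_of_forall_lie {x : g} (hx : ∀ h ∈ H, ⁅h, x⁆ = 0) : x ∈ H := by
  refine mem_rootSpace_zero_iff.1 (weightSpace_le_genWeightSpace g (0 : H → ℂ) ?_)
  rw [mem_weightSpace]
  intro h
  rw [Pi.zero_apply, zero_smul]
  exact hx h h.2

theorem mem_leviCenter {x : g} :
    x ∈ leviCenter D ↔ x ∈ leviSubalgebra D ∧ ∀ y ∈ leviSubalgebra D, ⁅y, x⁆ = 0 := by
  constructor
  · rintro ⟨⟨x, hx⟩, hc, rfl⟩
    refine ⟨hx, fun y hy => ?_⟩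
    have := (LieModule.mem_maxTrivSubmodule (R := ℂ) (L := leviSubalgebra D)
      (M := leviSubalgebra D) ⟨x, hx⟩).1 hc ⟨y, hy⟩
    exact congrArg Subtype.val this
  · rintro ⟨hx, h⟩
    refine ⟨⟨x, hx⟩, ?_, rfl⟩
    exact (LieModule.mem_maxTrivSubmodule (R := ℂ) (L := leviSubalgebra D)
      (M := leviSubalgebra D) ⟨x, hx⟩).2 fun y => Subtype.ext (h y y.2)

variable [IsSemisimple ℂ g] {b : (rootSystem H).Base} {ϖ : H}

theorem lie_cartan_eq_zero {x y : g} (hx : x ∈ H) (hy : y ∈ H) : ⁅x, y⁆ = 0 := by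
  have := lie_eq_smul_of_mem_rootSpace (mem_rootSpace_zero_iff.2 hy) (⟨x, hx⟩ : H)
  rw [Pi.zero_apply, zero_smul] at this
  exact this

theorem weight_cases (b : (rootSystem H).Base) (χ : Weight ℂ H g) :
    (χ : H → ℂ) = 0 ∨ ∃ α : H.root, b.IsPos α ∧
      ((χ : H → ℂ) = α.1 ∨ (χ : H → ℂ) = -(α.1 : H → ℂ)) := by
  by_cases h : χ.IsZero
  · exact Or.inl h
  · refine Or.inr ?_
    obtain hα | ⟨β, hβ, he⟩ := isPos_or_isPos_neg (⟨χ, by simpa using h⟩ : H.root) b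
    · exact ⟨_, hα, Or.inl rfl⟩
    · exact ⟨β, hβ, Or.inr he⟩

theorem IsGradingElement.exists_int (hϖ : IsGradingElement b D ϖ) (χ : Weight ℂ H g) :
    ∃ n : ℤ, χ ϖ = n ∧ (n = 0 → ∀ x ∈ rootSpace H χ, x ∈ diagSubalgebra D ∨ x ∈ H) := by
  rcases weight_cases b χ with h | ⟨α, hα, h | h⟩
  · exact ⟨0, by rw [h]; simp, fun _ x hx => Or.inr (mem_rootSpace_zero_iff.1 (h ▸ hx))⟩
  · obtain ⟨n, hn, hn0⟩ := hϖ.exists_nat hα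
    refine ⟨n, by rw [h, hn]; simp, fun h0 x hx => Or.inl ?_⟩
    exact (hn0 (by exact_mod_cast h0)).1 x (h ▸ hx)
  · obtain ⟨n, hn, hn0⟩ := hϖ.exists_nat hα
    refine ⟨-n, by rw [h, Pi.neg_apply, hn]; simp, fun h0 x hx => Or.inl ?_⟩
    exact (hn0 (by exact_mod_cast neg_eq_zero.1 h0)).2 x (h ▸ hx)

theorem IsGradingElement.lie_diagSubalgebra (hϖ : IsGradingElement b D ϖ)
    (hD : D ⊆ b.support) {x : g} (hx : x ∈ diagSubalgebra D) : ⁅(ϖ : g), x⁆ = 0 := by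
  induction hx using LieSubalgebra.lieSpan_induction with
  | mem x h =>
    obtain ⟨α, hα, h | h⟩ := h
    · have := lie_eq_smul_of_mem_rootSpace h ϖ
      rw [(hϖ α (hD hα)).1 hα, zero_smul] at this
      exact this
    · have := lie_eq_smul_of_mem_rootSpace h ϖ
      rw [Pi.neg_apply, (hϖ α (hD hα)).1 hα, neg_zero, zero_smul] at this
      exact this
  | zero => exact lie_zero _
  | add x y _ _ hx hy => rw [lie_add, hx, hy, add_zero]
  | smul c x _ hx => rw [lie_smul, hx, smul_zero]
  | lie x y _ _ hx hy => rw [leibniz_lie, hx, hy, zero_lie, lie_zero, add_zero]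

theorem lie_cartan_diagSubalgebra {h x : g} (hh : h ∈ H)
    (hx : x ∈ diagSubalgebra D) : ⁅h, x⁆ ∈ diagSubalgebra D := by
  induction hx using LieSubalgebra.lieSpan_induction with
  | mem x hx =>
    obtain ⟨α, hα, hx | hx⟩ := hx
    · have := lie_eq_smul_of_mem_rootSpace hx ⟨h, hh⟩
      change ⁅h, x⁆ = _ at this
      rw [this]
      exact LieSubalgebra.smul_mem _ _ ((rootSpace_le_diagSubalgebra hα).1 x hx)
    · have := lie_eq_smul_of_mem_rootSpace hx ⟨h, hh⟩
      change ⁅h, x⁆ = _ at this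
      rw [this]
      exact LieSubalgebra.smul_mem _ _ ((rootSpace_le_diagSubalgebra hα).2 x hx)
  | zero => rw [lie_zero]; exact zero_mem _
  | add x y _ _ hx hy => rw [lie_add]; exact add_mem hx hy
  | smul c x _ hx => rw [lie_smul]; exact LieSubalgebra.smul_mem _ _ hx
  | lie x y hx' hy' hx hy =>
    rw [leibniz_lie]
    exact add_mem (LieSubalgebra.lie_mem _ hx hy') (LieSubalgebra.lie_mem _ hx' hy)

/-- Every root space of degree 0 lies in g_D or in H, and the others lie in nonzero eigenspaces of
ad ϖ. By independence of eigenspaces, a vector commuting with ϖ has no component of the second kind.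
-/
theorem IsGradingElement.mem_sup (hϖ : IsGradingElement b D ϖ) (hD : D ⊆ b.support) {x : g}
    (hx : ⁅(ϖ : g), x⁆ = 0) : x ∈ (diagSubalgebra D).toSubmodule ⊔ H.toSubmodule := by
  let f : Module.End ℂ g := LieAlgebra.ad ℂ g (ϖ : g)
  set S := (diagSubalgebra D).toSubmodule ⊔ H.toSubmodule with hS
  have hSker : S ≤ LinearMap.ker f := sup_le (fun y hy => hϖ.lie_diagSubalgebra hD hy)
    (fun y hy => lie_cartan_eq_zero ϖ.2 hy)
  have hmem : x ∈ S ⊔ ⨆ μ : ℂ, ⨆ _ : μ ≠ 0, f.eigenspace μ := by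
    refine mem_of_forall_rootSpace (H := H) (fun χ y hy => ?_) x
    obtain ⟨n, hn, hn0⟩ := hϖ.exists_int χ
    by_cases h0 : n = 0
    · rcases hn0 h0 y hy with h | h
      · exact Submodule.mem_sup_left (Submodule.mem_sup_left h)
      · exact Submodule.mem_sup_left (Submodule.mem_sup_right h)
    · refine Submodule.mem_sup_right (Submodule.mem_iSup_of_mem (n : ℂ)
        (Submodule.mem_iSup_of_mem (by exact_mod_cast h0) ?_))
      rw [Module.End.mem_eigenspace_iff, ← hn]
      exact lie_eq_smul_of_mem_rootSpace hy ϖ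
  obtain ⟨y, hy, z, hz, rfl⟩ := Submodule.mem_sup.1 hmem
  have hz0 : z = 0 := by
    have h := f.eigenspaces_iSupIndep (0 : ℂ)
    rw [Module.End.eigenspace_zero] at h
    refine Submodule.disjoint_def.1 h z ?_ hz
    have h1 : f y + f z = 0 := by rw [← map_add]; exact hx
    rwa [LinearMap.mem_ker.1 (hSker hy), zero_add] at h1
  rw [hz0, add_zero]
  exact hy

theorem IsGradingElement.mem_leviSubalgebra_iff (hϖ : IsGradingElement b D ϖ)
    (hD : D ⊆ b.support) {x : g} : x ∈ leviSubalgebra D ↔ ⁅(ϖ : g), x⁆ = 0 := by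
  constructor
  · intro hx
    let Z : LieSubalgebra ℂ g :=
      { LinearMap.ker (LieAlgebra.ad ℂ g (ϖ : g)) with
        lie_mem' := fun {x y} hx hy => by
          change ⁅(ϖ : g), ⁅x, y⁆⁆ = 0
          rw [leibniz_lie, show ⁅(ϖ : g), x⁆ = 0 from hx, show ⁅(ϖ : g), y⁆ = 0 from hy,
            zero_lie, lie_zero, add_zero] }
    have h : leviSubalgebra D ≤ Z := sup_le (fun y hy => hϖ.lie_diagSubalgebra hD hy)
      (fun y hy => lie_cartan_eq_zero ϖ.2 hy)
    exact h hx
  · intro hx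
    obtain ⟨y, hy, z, hz, rfl⟩ := Submodule.mem_sup.1 (hϖ.mem_sup hD hx)
    exact add_mem ((le_sup_left : diagSubalgebra D ≤ leviSubalgebra D) hy)
      ((le_sup_right : H ≤ leviSubalgebra D) hz)

/-- The centraliser of ϖ is g_D + H, where H is abelian and normalises g_D. -/
theorem IsGradingElement.lie_mem_diagSubalgebra (hϖ : IsGradingElement b D ϖ)
    (hD : D ⊆ b.support) {x y : g} (hx : ⁅(ϖ : g), x⁆ = 0) (hy : ⁅(ϖ : g), y⁆ = 0) :
    ⁅x, y⁆ ∈ diagSubalgebra D := by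
  obtain ⟨k, hk, h, hh, rfl⟩ := Submodule.mem_sup.1 (hϖ.mem_sup hD hx)
  obtain ⟨k', hk', h', hh', rfl⟩ := Submodule.mem_sup.1 (hϖ.mem_sup hD hy)
  rw [add_lie, lie_add, lie_add, lie_cartan_eq_zero hh hh', add_zero, ← lie_skew k h']
  exact add_mem (add_mem (LieSubalgebra.lie_mem _ hk hk')
    (neg_mem (lie_cartan_diagSubalgebra hh' hk))) (lie_cartan_diagSubalgebra hh hk')

/-- Perfectness of g_D: each generator is an eigenvector, with eigenvalue 2 or -2, of a coroot that
itself lies in g_D. -/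
theorem diagSubalgebra_le_span : (diagSubalgebra D).toSubmodule ≤
    Submodule.span ℂ {z | ∃ x ∈ diagSubalgebra D, ∃ y ∈ diagSubalgebra D, ⁅x, y⁆ = z} := by
  set S := Submodule.span ℂ {z | ∃ x ∈ diagSubalgebra D, ∃ y ∈ diagSubalgebra D, ⁅x, y⁆ = z}
    with hS
  have hle : S ≤ (diagSubalgebra D).toSubmodule := by
    rw [hS, Submodule.span_le]
    rintro _ ⟨x, hx, y, hy, rfl⟩
    exact LieSubalgebra.lie_mem _ hx hy
  let S' : LieSubalgebra ℂ g :=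
    { S with
      lie_mem' := fun {x y} hx hy =>
        Submodule.subset_span ⟨x, hle hx, y, hle hy, rfl⟩ }
  have h : diagSubalgebra D ≤ S' := by
    rw [diagSubalgebra, LieSubalgebra.lieSpan_le]
    rintro x ⟨α, hα, hx⟩
    have hnz : α.1.IsNonZero := H.isNonZero_coe_root α
    obtain ⟨h, e, f, ht, he, hf⟩ := exists_isSl2Triple_of_weight_isNonZero hnz
    have hh : h ∈ diagSubalgebra D := ht.lie_e_f ▸ LieSubalgebra.lie_mem _
      ((rootSpace_le_diagSubalgebra hα).1 e he) ((rootSpace_le_diagSubalgebra hα).2 f hf)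
    have hc : h = coroot α.1 := ht.h_eq_coroot hnz he hf
    rcases hx with hx | hx
    · refine Submodule.subset_span ⟨(2⁻¹ : ℂ) • h, LieSubalgebra.smul_mem _ _ hh, x,
        (rootSpace_le_diagSubalgebra hα).1 x hx, ?_⟩
      have h1 : ⁅h, x⁆ = (2 : ℂ) • x := by
        have := lie_eq_smul_of_mem_rootSpace hx (coroot α.1)
        rw [root_apply_coroot hnz] at this
        rw [hc]
        exact this
      rw [smul_lie, h1, smul_smul, inv_mul_cancel₀ two_ne_zero, one_smul]
    · refine Submodule.subset_span ⟨(-2⁻¹ : ℂ) • h, LieSubalgebra.smul_mem _ _ hh, x,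
        (rootSpace_le_diagSubalgebra hα).2 x hx, ?_⟩
      have h1 : ⁅h, x⁆ = (-2 : ℂ) • x := by
        have := lie_eq_smul_of_mem_rootSpace hx (coroot α.1)
        rw [Pi.neg_apply, root_apply_coroot hnz] at this
        rw [hc]
        exact this
      rw [smul_lie, h1, smul_smul, neg_mul_neg, inv_mul_cancel₀ two_ne_zero, one_smul]
  exact h

/-- The trace on an eigenspace of `ad x` of an element of the derived algebra of the centraliser
of `x` vanishes, so that such an element `x` of the Cartan subalgebra is zero. -/
theorem eq_zero_of_mem_span_lie {K : LieSubalgebra ℂ g} {x : g} (hxH : x ∈ H)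
    (hxK : ∀ y ∈ K, ⁅x, y⁆ = 0)
    (hx : x ∈ Submodule.span ℂ {z | ∃ y ∈ K, ∃ y' ∈ K, ⁅y, y'⁆ = z}) : x = 0 := by
  suffices h : (⟨x, hxH⟩ : H) = 0 from congrArg Subtype.val h
  refine eq_zero_of_forall_weight fun χ => ?_
  let E := (LieAlgebra.ad ℂ g x).eigenspace (χ ⟨x, hxH⟩)
  -- P is any projection to the eigenspace E, so that y ↦ P ∘ ad y is linear on all of g. For y in K
  -- it is the action on E, which K preserves because it commutes with x; hence commutators in K
  -- have trace 0, while x has trace χ(x) dim E.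
  obtain ⟨P, hP⟩ := LinearMap.exists_leftInverse_of_injective E.subtype (Submodule.ker_subtype E)
  have hPE : ∀ v (hv : v ∈ E), P v = ⟨v, hv⟩ := fun v hv => LinearMap.congr_fun hP ⟨v, hv⟩
  let T : g →ₗ[ℂ] Module.End ℂ E :=
    LinearMap.lcomp ℂ E E.subtype ∘ₗ LinearMap.llcomp ℂ g g E P ∘ₗ
      (LieAlgebra.ad ℂ g : g →ₗ[ℂ] Module.End ℂ g)
  have hT : ∀ y (v : E), T y v = P ⁅y, (v : g)⁆ := fun _ _ => rfl
  have hKE : ∀ y ∈ K, ∀ v ∈ E, ⁅y, v⁆ ∈ E := by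
    intro y hy v hv
    rw [Module.End.mem_eigenspace_iff, LieAlgebra.ad_apply] at hv ⊢
    rw [leibniz_lie, hxK y hy, zero_lie, zero_add, hv, lie_smul]
  have hle : Submodule.span ℂ {z | ∃ y ∈ K, ∃ y' ∈ K, ⁅y, y'⁆ = z}
      ≤ LinearMap.ker (LinearMap.trace ℂ E ∘ₗ T) := by
    rw [Submodule.span_le]
    rintro _ ⟨y, hy, y', hy', rfl⟩
    have h1 : T ⁅y, y'⁆ = T y * T y' - T y' * T y := by
      refine LinearMap.ext fun v => ?_
      rw [LinearMap.sub_apply, Module.End.mul_apply, Module.End.mul_apply, hT, hT, hT, hT, hT,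
        hPE _ (hKE y' hy' v v.2), hPE _ (hKE y hy v v.2), lie_lie, map_sub]
    change LinearMap.trace ℂ E (T ⁅y, y'⁆) = 0
    rw [h1, map_sub, LinearMap.trace_mul_comm, sub_self]
  have h0 : LinearMap.trace ℂ E (T x) = 0 := hle hx
  have hTx : T x = χ ⟨x, hxH⟩ • LinearMap.id := by
    refine LinearMap.ext fun v => ?_
    have hv := Module.End.mem_eigenspace_iff.1 v.2
    rw [LieAlgebra.ad_apply] at hv
    rw [hT, hv, map_smul, hPE _ v.2]
    rfl
  rw [hTx, map_smul, LinearMap.trace_id, smul_eq_mul] at h0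
  refine (mul_eq_zero.1 h0).resolve_right ?_
  obtain ⟨v, hv, hv0⟩ := χ.exists_ne_zero
  have hvE : v ∈ E := Module.End.mem_eigenspace_iff.2
    (lie_eq_smul_of_mem_rootSpace hv (⟨x, hxH⟩ : H))
  have : Nontrivial E := ⟨⟨⟨v, hvE⟩, 0, fun h => hv0 (congrArg Subtype.val h)⟩⟩
  exact_mod_cast Module.finrank_pos.ne'

end Levi

/-! ### Nondegeneracy of the form on the Levi subalgebra, and the normalisation of root vectors -/

section LeviDecomposition

variable {g : Type*} [LieRing g] [LieAlgebra ℂ g] [FiniteDimensional ℂ g] [IsSemisimple ℂ g]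
  {H : LieSubalgebra ℂ g} [H.IsCartanSubalgebra] {B : LinearMap.BilinForm ℂ g}

/-- By invariance the centraliser of ϖ is orthogonal to every root space on which ϖ acts by a
nonzero scalar, so the form stays nondegenerate on the centraliser. -/
theorem eq_zero_of_forall_centralizer (hB : B.Nondegenerate) (hinv : B.lieInvariant g) {ϖ : H}
    {x : g} (hx : ⁅(ϖ : g), x⁆ = 0) (h : ∀ y, ⁅(ϖ : g), y⁆ = 0 → B x y = 0) : x = 0 := by
  refine hB.1 x fun y => ?_
  refine mem_of_forall_rootSpace (H := H) (S := LinearMap.ker (B x)) (fun χ y hy => ?_) y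
  have hy' : ⁅(ϖ : g), y⁆ = χ ϖ • y := lie_eq_smul_of_mem_rootSpace hy ϖ
  rw [LinearMap.mem_ker]
  by_cases h0 : χ ϖ = 0
  · exact h y (by rw [hy', h0, zero_smul])
  · have h1 := hinv ϖ x y
    rw [hx, hy', map_zero, LinearMap.zero_apply, map_smul, smul_eq_mul, zero_eq_neg] at h1
    exact (mul_eq_zero.1 h1).resolve_left h0

theorem eq_zero_of_forall_cartan (hB : B.Nondegenerate) (hinv : B.lieInvariant g)
    {x : g} (hx : x ∈ H) (h : ∀ y ∈ H, B x y = 0) : x = 0 := by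
  refine hB.1 x fun y => ?_
  refine mem_of_forall_rootSpace (H := H) (S := LinearMap.ker (B x)) (fun χ y hy => ?_) y
  by_cases h0 : (χ : H → ℂ) = 0
  · exact h y (mem_rootSpace_zero_iff.1 (h0 ▸ hy))
  · exact eq_zero_of_mem_rootSpace_of_add_ne_zero hinv (χ := (0 : H → ℂ)) (by rwa [zero_add])
      (mem_rootSpace_zero_iff.2 hx) hy

variable {b : (rootSystem H).Base} {D : Finset H.root} {ϖ : H}

/-- Since [l,l] ⊆ g_D, invariance makes the orthogonal complement of g_D in l central. An element of
g_D that is central in l is zero by `eq_zero_of_mem_span_lie`. Thus B is nondegenerate on g_D, hence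
also on c_D, and p and q are the orthogonal projections. -/
theorem IsGradingElement.exists_isLeviDecomposition (hϖ : IsGradingElement b D ϖ)
    (hD : D ⊆ b.support) (hB : B.Nondegenerate) (hsymm : ∀ x y, B x y = B y x)
    (hinv : B.lieInvariant g) :
    ∃ p q, IsLeviDecomposition B (diagSubalgebra D) (leviCenter D)
      (LinearMap.ker (LieAlgebra.ad ℂ g (ϖ : g))) p q := by
  have hl : ∀ {x : g}, x ∈ leviSubalgebra D ↔ ⁅(ϖ : g), x⁆ = 0 := hϖ.mem_leviSubalgebra_iff hD
  have hKl : ∀ x ∈ diagSubalgebra D, ⁅(ϖ : g), x⁆ = 0 := fun x hx => hϖ.lie_diagSubalgebra hD hx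
  have hKC : ∀ x ∈ diagSubalgebra D, ∀ c ∈ leviCenter D, ⁅x, c⁆ = 0 := fun x hx c hc =>
    (mem_leviCenter.1 hc).2 x (hl.2 (hKl x hx))
  have horth : ∀ x ∈ diagSubalgebra D, ∀ c ∈ leviCenter D, B x c = 0 := by
    intro x hx c hc
    have hx' := diagSubalgebra_le_span hx
    clear hx
    induction hx' using Submodule.span_induction with
    | mem z h =>
      obtain ⟨x, hx, y, _, rfl⟩ := h
      rw [hinv, hKC x hx c hc, map_zero, neg_zero]
    | zero => simp
    | add a b _ _ ha hb => rw [map_add, LinearMap.add_apply, ha, hb, add_zero]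
    | smul r a _ ha => rw [map_smul, LinearMap.smul_apply, ha, smul_zero]
  have hdisj : ∀ x ∈ diagSubalgebra D, x ∈ leviCenter D → x = 0 := by
    intro x hx hc
    have hxH : x ∈ H := mem_cartan_of_forall_lie fun h hh =>
      (mem_leviCenter.1 hc).2 h (hl.2 (lie_cartan_eq_zero ϖ.2 hh))
    refine eq_zero_of_mem_span_lie hxH (fun y hy => ?_) (diagSubalgebra_le_span hx)
    rw [← lie_skew, hKC y hy x hc, neg_zero]
  have hmemC : ∀ x, ⁅(ϖ : g), x⁆ = 0 → (∀ y ∈ diagSubalgebra D, B x y = 0) →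
      x ∈ leviCenter D := by
    intro x hx h
    refine mem_leviCenter.2 ⟨hl.2 hx, fun y hy => ?_⟩
    have hy := hl.1 hy
    refine eq_zero_of_forall_centralizer hB hinv (ϖ := ϖ) ?_ fun z hz => ?_
    · rw [leibniz_lie, hx, hy, zero_lie, lie_zero, add_zero]
    · rw [hinv, h _ (hϖ.lie_mem_diagSubalgebra hD hy hz), neg_zero]
  -- A vector in the radical of B on g_D is central in l and lies in g_D.
  have hndK : ∀ x ∈ diagSubalgebra D, (∀ y ∈ diagSubalgebra D, B x y = 0) → x = 0 :=
    fun x hx h => hdisj x hx (hmemC x (hKl x hx) h)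
  obtain ⟨q, hq, hqB⟩ := exists_orthogonal_projection hsymm
    (S := (diagSubalgebra D).toSubmodule) hndK
  have hsub : ∀ x, ⁅(ϖ : g), x⁆ = 0 → x - q x ∈ leviCenter D := by
    intro x hx
    refine hmemC _ (by rw [lie_sub, hx, hKl _ (hq x), sub_zero]) fun y hy => ?_
    rw [map_sub, LinearMap.sub_apply, hqB x y hy, sub_self]
  have hndC : ∀ x ∈ leviCenter D, (∀ y ∈ leviCenter D, B x y = 0) → x = 0 := by
    intro x hx h
    refine eq_zero_of_forall_centralizer hB hinv (hl.1 (mem_leviCenter.1 hx).1) fun y hy => ?_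
    rw [← sub_add_cancel y (q y), map_add, h _ (hsub y hy), hsymm x, horth _ (hq y) x hx,
      add_zero]
  obtain ⟨p, hp, hpB⟩ := exists_orthogonal_projection hsymm hndC
  have hpx : ∀ x ∈ leviCenter D, p x = x := fun x hx => sub_eq_zero.1 <|
    hndC _ (sub_mem (hp x) hx) fun y hy => by
      rw [map_sub, LinearMap.sub_apply, hpB x y hy, sub_self]
  have hp0 : ∀ x ∈ diagSubalgebra D, p x = 0 := fun x hx =>
    hndC _ (hp x) fun y hy => by rw [hpB x y hy, horth x hx y hy]
  refine ⟨p, q, ?_⟩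
  refine
    { p_mem := hp
      p_of_mem := hpx
      p_adjoint := fun x y => by rw [← hpB x _ (hp y), hsymm (p x) y, ← hpB y _ (hp x), hsymm]
      p_eq_zero := hp0
      q_mem := hq
      q_of_mem := fun x hx => sub_eq_zero.1 <| hndK _ (sub_mem (hq x) hx) fun y hy => ?_
      q_adjoint := fun x y => by rw [← hqB x _ (hq y), hsymm (q x) y, ← hqB y _ (hq x), hsymm]
      q_eq_zero := fun x hx => hndK _ (hq x) fun y hy => by rw [hqB x y hy, hsymm, horth y hy x hx]
      q_lie := fun x hx y => sub_eq_zero.1 <|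
        hndK _ (sub_mem (hq _) (LieSubalgebra.lie_mem _ hx (hq y))) fun z hz => ?_
      add_eq := fun x hx => ?_
      lie_eq_zero := hKC
      le_span := diagSubalgebra_le_span }
  · rw [map_sub, LinearMap.sub_apply, hqB x y hy, sub_self]
  · rw [map_sub, LinearMap.sub_apply, hqB _ z hz, hinv, hinv,
      hqB y _ (LieSubalgebra.lie_mem _ hx hz), sub_self]
  · have h := hpx _ (hsub x hx)
    rw [map_sub, hp0 _ (hq x), sub_zero] at h
    rw [h, sub_add_cancel]

/-- Let t in H represent α through B. Invariance gives [e, f] = B(e, f) t, and applying α to this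
coroot yields 2 = B(e, f)(α, α). -/
theorem rootNormSq_mul (hB : B.Nondegenerate) (hsymm : ∀ x y, B x y = B y x)
    (hinv : B.lieInvariant g) {α : H.root} {e f : g} (he : e ∈ rootSpace H α.1)
    (hef : ⁅e, f⁆ = (((rootSystem H).coroot α : H) : g)) :
    rootNormSq B α / 2 * B e f = 1 := by
  have hnd : (B.restrict H.toSubmodule).Nondegenerate :=
    restrict_nondegenerate_of_forall hsymm fun x hx h => eq_zero_of_forall_cartan hB hinv hx h
  set t := (LinearMap.BilinForm.toDual (B.restrict H.toSubmodule) hnd).symm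
    ((rootSystem H).root α) with ht
  have hnorm : rootNormSq B α = (rootSystem H).root α t := by
    rw [rootNormSq, dualForm, dif_pos hnd]
  have hBt : ∀ h : H, B t h = α.1 h := fun h =>
    LinearMap.BilinForm.apply_toDual_symm_apply (hB := hnd) ((rootSystem H).root α) h
  have hcor : ((rootSystem H).coroot α : H) = B e f • t := by
    rw [← sub_eq_zero]
    refine Subtype.ext (eq_zero_of_forall_cartan hB hinv (Subtype.mem _) fun h hh => ?_)
    have h1 : ⁅h, e⁆ = α.1 ⟨h, hh⟩ • e := lie_eq_smul_of_mem_rootSpace he ⟨h, hh⟩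
    have h2 : B ⁅e, f⁆ h = B e f * B t h := by
      rw [hinv, ← lie_skew, h1, map_neg, neg_neg, map_smul, hBt ⟨h, hh⟩, smul_eq_mul, mul_comm,
        hsymm f]
    change B ((((rootSystem H).coroot α : H) : g) - B e f • (t : g)) h = 0
    rw [← hef, map_sub, LinearMap.sub_apply, h2, map_smul, LinearMap.smul_apply, smul_eq_mul,
      sub_self]
  have h2 : (rootSystem H).root α ((rootSystem H).coroot α) = 2 :=
    (rootSystem H).root_coroot_two α
  have h3 : B e f * rootNormSq B α = 2 := by
    rw [hnorm, ← smul_eq_mul, ← map_smul, ← hcor, h2]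
  linear_combination h3 / 2

end LeviDecomposition

/-! ### The sign operator of a grading -/

section Graded

variable {𝕜 L : Type*} [Field 𝕜] [LieRing L] [LieAlgebra 𝕜 L] {ϖ : L}

/-- The endomorphism `S` multiplies elements of positive, zero and negative degree in the grading
by the eigenvalues of `ad ϖ` by `-1`, `0` and `1`. -/
def IsSignOperator (ϖ : L) (S : Module.End 𝕜 L) : Prop :=
  ∀ (n : ℤ) (x : L), ⁅ϖ, x⁆ = (n : 𝕜) • x → S x = -((n.sign : ℤ) : 𝕜) • x

/-- This integer is the factor by which the modified Yang-Baxter expression for S multiplies [x, y]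
in degrees m and n. It equals 1 when m = n = 0, which is the source of the defect in [l,l]. -/
theorem sign_mul_sign {m n : ℤ} (h : m ≠ 0 ∨ n ≠ 0) :
    m.sign * n.sign - (m.sign + n.sign) * (m + n).sign + 1 = 0 := by
  rcases lt_trichotomy m 0 with hm | rfl | hm <;> rcases lt_trichotomy n 0 with hn | rfl | hn
  · simp [Int.sign_eq_neg_one_of_neg hm, Int.sign_eq_neg_one_of_neg hn,
      Int.sign_eq_neg_one_of_neg (add_neg hm hn)]
  · simp [Int.sign_eq_neg_one_of_neg hm]
  · simp [Int.sign_eq_neg_one_of_neg hm, Int.sign_eq_one_of_pos hn]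
  · simp [Int.sign_eq_neg_one_of_neg hn]
  · simp at h
  · simp [Int.sign_eq_one_of_pos hn]
  · simp [Int.sign_eq_neg_one_of_neg hn, Int.sign_eq_one_of_pos hm]
  · simp [Int.sign_eq_one_of_pos hm]
  · simp [Int.sign_eq_one_of_pos hm, Int.sign_eq_one_of_pos hn,
      Int.sign_eq_one_of_pos (add_pos hm hn)]

theorem forall_of_eigenspace (hϖ : ⨆ n : ℤ, (LieAlgebra.ad 𝕜 L ϖ).eigenspace (n : 𝕜) = ⊤)
    {P : L → Prop} (h0 : P 0) (hadd : ∀ x y, P x → P y → P (x + y))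
    (h : ∀ (n : ℤ) (x : L), ⁅ϖ, x⁆ = (n : 𝕜) • x → P x) (x : L) : P x := by
  have hx : x ∈ ⨆ n : ℤ, (LieAlgebra.ad 𝕜 L ϖ).eigenspace (n : 𝕜) := hϖ ▸ Submodule.mem_top
  induction hx using Submodule.iSup_induction' with
  | zero => exact h0
  | add x y _ _ hx hy => exact hadd x y hx hy
  | mem n x hx => exact h n x (Module.End.mem_eigenspace_iff.1 hx)

theorem lie_lie_eq_smul {m n : ℤ} {x y : L} (hx : ⁅ϖ, x⁆ = (m : 𝕜) • x)
    (hy : ⁅ϖ, y⁆ = (n : 𝕜) • y) : ⁅ϖ, ⁅x, y⁆⁆ = ((m + n : ℤ) : 𝕜) • ⁅x, y⁆ := by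
  rw [leibniz_lie, hx, hy, smul_lie, lie_smul, ← add_smul, Int.cast_add]

namespace IsSignOperator

variable {S : Module.End 𝕜 L} (hS : IsSignOperator ϖ S)
  (hϖ : ⨆ n : ℤ, (LieAlgebra.ad 𝕜 L ϖ).eigenspace (n : 𝕜) = ⊤)

include hS in
theorem apply_eq_zero {x : L} (hx : ⁅ϖ, x⁆ = 0) : S x = 0 := by
  have := hS 0 x (by rw [hx, Int.cast_zero, zero_smul])
  rwa [Int.sign_zero, Int.cast_zero, neg_zero, zero_smul] at this

include hS hϖ

theorem lie_comm {x : L} (hx : ⁅ϖ, x⁆ = 0) (y : L) : S ⁅x, y⁆ = ⁅x, S y⁆ := by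
  refine forall_of_eigenspace hϖ (P := fun y => S ⁅x, y⁆ = ⁅x, S y⁆) (by simp) ?_ ?_ y
  · intro y z hy hz
    rw [lie_add, map_add, map_add, lie_add, hy, hz]
  · intro n y hy
    have hx' : ⁅ϖ, x⁆ = ((0 : ℤ) : 𝕜) • x := by rw [hx, Int.cast_zero, zero_smul]
    have := lie_lie_eq_smul hx' hy
    rw [zero_add] at this
    rw [hS n y hy, hS n _ this, lie_smul]

/-- The modified classical Yang-Baxter equation modulo the derived algebra of the centraliser of
the grading element. -/
theorem lie_sub_mem {K : Submodule 𝕜 L}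
    (hK : ∀ x y : L, ⁅ϖ, x⁆ = 0 → ⁅ϖ, y⁆ = 0 → ⁅x, y⁆ ∈ K) (x y : L) :
    ⁅S x, S y⁆ - S (⁅S x, y⁆ + ⁅x, S y⁆) + ⁅x, y⁆ ∈ K := by
  refine forall_of_eigenspace hϖ
    (P := fun x => ⁅S x, S y⁆ - S (⁅S x, y⁆ + ⁅x, S y⁆) + ⁅x, y⁆ ∈ K) (by simp) ?_ ?_ x
  · intro x x' hx hx'
    have := add_mem hx hx'
    simp only [map_add, add_lie] at this ⊢
    convert this using 1
    abel
  intro m x hx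
  refine forall_of_eigenspace hϖ
    (P := fun y => ⁅S x, S y⁆ - S (⁅S x, y⁆ + ⁅x, S y⁆) + ⁅x, y⁆ ∈ K) (by simp) ?_ ?_ y
  · intro y y' hy hy'
    have := add_mem hy hy'
    simp only [map_add, lie_add] at this ⊢
    convert this using 1
    abel
  intro n y hy
  have h : ⁅S x, S y⁆ - S (⁅S x, y⁆ + ⁅x, S y⁆) + ⁅x, y⁆
      = ((m.sign * n.sign - (m.sign + n.sign) * (m + n).sign + 1 : ℤ) : 𝕜) • ⁅x, y⁆ := by
    rw [hS m x hx, hS n y hy, smul_lie, lie_smul, smul_lie, map_add, map_smul, map_smul,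
      hS _ _ (lie_lie_eq_smul hx hy)]
    push_cast
    module
  rw [h]
  by_cases h0 : m = 0 ∧ n = 0
  · obtain ⟨rfl, rfl⟩ := h0
    refine K.smul_mem _ (hK x y ?_ ?_)
    · rw [hx, Int.cast_zero, zero_smul]
    · rw [hy, Int.cast_zero, zero_smul]
  · rw [sign_mul_sign (by tauto), Int.cast_zero, zero_smul]
    exact K.zero_mem

/-- In degree n the operator -S ∘ ad ϖ is multiplication by sign(n) n = |n|. -/
theorem iSup_eigenspace_eq_top :
    ⨆ n : ℕ, Module.End.eigenspace (-(S ∘ₗ LieAlgebra.ad 𝕜 L ϖ)) (n : 𝕜) = ⊤ := by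
  refine eq_top_iff.2 fun x _ => ?_
  refine forall_of_eigenspace hϖ (Submodule.zero_mem _) (fun _ _ => Submodule.add_mem _)
    (fun n x hx => ?_) x
  refine Submodule.mem_iSup_of_mem n.natAbs (Module.End.mem_eigenspace_iff.2 ?_)
  rw [LinearMap.neg_apply, LinearMap.comp_apply, LieAlgebra.ad_apply, hx, map_smul, hS n x hx,
    neg_smul, smul_neg, neg_neg, smul_smul, ← Int.cast_mul, mul_comm, Int.sign_mul_self_eq_natAbs,
    Int.cast_natCast]

/-- S² is the identity on the range of ad ϖ, so S loses nothing there. -/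
theorem ker_eq : LinearMap.ker (-(S ∘ₗ LieAlgebra.ad 𝕜 L ϖ))
    = LinearMap.ker (LieAlgebra.ad 𝕜 L ϖ) := by
  have h : ∀ x, S (S ⁅ϖ, x⁆) = ⁅ϖ, x⁆ := by
    refine forall_of_eigenspace hϖ (by simp) (fun x y hx hy => ?_) fun n x hx => ?_
    · rw [lie_add, map_add, map_add, hx, hy]
    · rw [hx, map_smul, hS n x hx, map_smul, map_smul, hS n x hx, smul_smul, smul_smul]
      congr 1
      have : n * n.sign * n.sign = n := by rw [Int.mul_sign_self, Int.natCast_natAbs, mul_comm,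
        Int.sign_mul_abs]
      have h2 := congrArg (Int.cast : ℤ → 𝕜) this
      rw [Int.cast_mul, Int.cast_mul] at h2
      linear_combination h2
  ext x
  rw [LinearMap.mem_ker, LinearMap.mem_ker, LinearMap.neg_apply, LinearMap.comp_apply,
    LieAlgebra.ad_apply, neg_eq_zero]
  exact ⟨fun hx => by rw [← h, hx, map_zero], fun hx => by rw [hx, map_zero]⟩

end IsSignOperator

end Graded

/-! ### Bivectors as endomorphisms -/

section Bivector

variable {R L κ : Type*} [CommRing R] [LieRing L] [LieAlgebra R L]

/-- The endomorphism which corresponds to the bivector `∑ c α • e α ∧ f α`. -/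
def bivectorEnd (B : LinearMap.BilinForm R L) (s : Finset κ) (c : κ → R) (e f : κ → L) :
    Module.End R L :=
  ∑ α ∈ s, c α • ((B (e α)).smulRight (f α) - (B (f α)).smulRight (e α))

variable {B : LinearMap.BilinForm R L} {s : Finset κ} {c : κ → R} {e f : κ → L}

theorem bivectorEnd_apply (x : L) : bivectorEnd B s c e f x
    = ∑ α ∈ s, c α • (B (e α) x • f α - B (f α) x • e α) := by
  simp [bivectorEnd]

theorem bivectorEnd_skew (hB : ∀ x y, B x y = B y x) (x y : L) :
    B (bivectorEnd B s c e f x) y = -B x (bivectorEnd B s c e f y) := by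
  rw [bivectorEnd_apply, bivectorEnd_apply, map_sum, map_sum, LinearMap.sum_apply,
    ← Finset.sum_neg_distrib]
  refine Finset.sum_congr rfl fun α _ => ?_
  simp only [map_smul, map_sub, LinearMap.smul_apply, LinearMap.sub_apply, smul_eq_mul, hB x]
  ring

theorem schouten_ι (X : L) (w : ExteriorAlgebra R L) :
    schouten (ExteriorAlgebra.ι R X) w = adExt X w := by
  have := schouten_ι_mul X 1 w
  rwa [mul_one, schouten_one, mul_zero, zero_add, map_one, one_mul] at this

theorem schouten_ι_mul_ι (X Y : L) (w : ExteriorAlgebra R L) :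
    schouten (ExteriorAlgebra.ι R X * ExteriorAlgebra.ι R Y) w
      = ExteriorAlgebra.ι R X * adExt Y w - ExteriorAlgebra.ι R Y * adExt X w := by
  have h : (CliffordAlgebra.involute (ExteriorAlgebra.ι R Y) : ExteriorAlgebra R L)
    = -ExteriorAlgebra.ι R Y := CliffordAlgebra.involute_ι Y
  rw [schouten_ι_mul, schouten_ι, h, neg_mul, sub_eq_add_neg]

/-- Each bivector acts by ⟦X ∧ Y, ·⟧ = X ∧ ad Y - Y ∧ ad X, and expanding the outer factor in the
dual families collects these terms into one sum over k. -/
theorem IsDualPair.schouten_eq_twistOp {ν : Type*} [Fintype ν] {ε ε' : ν → L}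
    (h : IsDualPair B ε ε') (w : ExteriorAlgebra R L) :
    schouten (∑ α ∈ s, c α • (ExteriorAlgebra.ι R (e α) * ExteriorAlgebra.ι R (f α))) w
      = twistOp ε ε' (bivectorEnd B s c e f) w := by
  have key : ∀ X Y : L, ∑ k, ExteriorAlgebra.ι R (ε k) * (B X (ε' k) • adExt Y w)
      = ExteriorAlgebra.ι R X * adExt Y w := by
    intro X Y
    conv_rhs => rw [← h.sum_left X]
    rw [map_sum, Finset.sum_mul]
    simp only [map_smul, smul_mul_assoc, mul_smul_comm]
  rw [twistOp_apply, map_sum, LinearMap.sum_apply]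
  simp only [bivectorEnd_apply, map_sum, LinearMap.sum_apply, Finset.mul_sum]
  rw [Finset.sum_comm]
  refine Finset.sum_congr rfl fun α _ => ?_
  rw [map_smul, LinearMap.smul_apply, schouten_ι_mul_ι, ← key (e α), ← key (f α),
    ← Finset.sum_sub_distrib, Finset.smul_sum]
  refine Finset.sum_congr rfl fun k _ => ?_
  simp only [map_smul, map_sub, LinearMap.smul_apply, LinearMap.sub_apply, mul_sub, mul_smul_comm]

end Bivector

theorem exists_isDualPair {𝕜 L : Type*} [Field 𝕜] [AddCommGroup L] [Module 𝕜 L]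
    [FiniteDimensional 𝕜 L] {B : LinearMap.BilinForm 𝕜 L} (hB : B.Nondegenerate)
    (hsymm : ∀ x y, B x y = B y x) :
    ∃ ε ε' : Fin (Module.finrank 𝕜 L) → L, IsDualPair B ε ε' := by
  let ε := Module.finBasis 𝕜 L
  let ε' := B.dualBasis hB ε
  have h1 : ∀ i j, B (ε' i) (ε j) = if j = i then 1 else 0 :=
    LinearMap.BilinForm.apply_dualBasis_left hB ε
  refine ⟨ε, ε', fun x => ?_, fun x => ?_⟩
  · conv_rhs => rw [← ε.sum_repr x]
    refine Finset.sum_congr rfl fun k _ => ?_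
    congr 1
    conv_lhs => rw [hsymm, ← ε.sum_repr x]
    simp only [map_sum, map_smul, h1, smul_eq_mul, mul_ite, mul_one, mul_zero,
      Finset.sum_ite_eq', Finset.mem_univ, if_true]
  · conv_rhs => rw [← ε'.sum_repr x]
    refine Finset.sum_congr rfl fun k _ => ?_
    congr 1
    conv_lhs => rw [← ε'.sum_repr x]
    simp only [map_sum, map_smul, LinearMap.sum_apply, LinearMap.smul_apply, h1, smul_eq_mul,
      mul_ite, mul_one, mul_zero, Finset.sum_ite_eq, Finset.mem_univ, if_true]

/-! ### The standard solution -/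

section Standard

variable {g : Type*} [LieRing g] [LieAlgebra ℂ g] [FiniteDimensional ℂ g] [IsSemisimple ℂ g]
  {H : LieSubalgebra ℂ g} [H.IsCartanSubalgebra] {B : LinearMap.BilinForm ℂ g}
  {b : (rootSystem H).Base} {D : Finset H.root} {ϖ : H} {e f : H.root → g}

theorem IsGradingElement.iSup_eigenspace_eq_top (hϖ : IsGradingElement b D ϖ) :
    ⨆ n : ℤ, (LieAlgebra.ad ℂ g (ϖ : g)).eigenspace (n : ℂ) = ⊤ := by
  refine eq_top_iff.2 fun x _ => mem_of_forall_rootSpace (H := H) (fun χ y hy => ?_) x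
  obtain ⟨n, hn, -⟩ := hϖ.exists_int χ
  refine Submodule.mem_iSup_of_mem n (Module.End.mem_eigenspace_iff.2 ?_)
  rw [← hn]
  exact lie_eq_smul_of_mem_rootSpace hy ϖ

/-- An eigenspace of ad ϖ may contain many root spaces. Independence of eigenspaces shows that a
vector of degree n has components only in weights of degree n, so testing on root spaces suffices.
-/
theorem isSignOperator_of_forall_weight {S : Module.End ℂ g}
    (h : ∀ (χ : Weight ℂ H g) (n : ℤ), χ ϖ = n → ∀ x ∈ rootSpace H χ,
      S x = -((n.sign : ℤ) : ℂ) • x) : IsSignOperator (ϖ : g) S := by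
  intro n x hx
  let F : Module.End ℂ g := S + ((n.sign : ℤ) : ℂ) • LinearMap.id
  let A : Module.End ℂ g := LieAlgebra.ad ℂ g (ϖ : g)
  have hmem : x ∈ (LinearMap.ker F ⊓ A.eigenspace n) ⊔ ⨆ μ : ℂ, ⨆ _ : μ ≠ n, A.eigenspace μ := by
    refine mem_of_forall_rootSpace (H := H) (fun χ y hy => ?_) x
    have hy' : A y = χ ϖ • y := lie_eq_smul_of_mem_rootSpace hy ϖ
    by_cases hn : χ ϖ = n
    · refine Submodule.mem_sup_left ⟨?_, Module.End.mem_eigenspace_iff.2 (by rw [hy', hn])⟩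
      change S y + ((n.sign : ℤ) : ℂ) • y = 0
      rw [h χ n hn y hy, neg_smul, neg_add_cancel]
    · exact Submodule.mem_sup_right (Submodule.mem_iSup_of_mem (χ ϖ)
        (Submodule.mem_iSup_of_mem hn (Module.End.mem_eigenspace_iff.2 hy')))
  obtain ⟨y, hy, z, hz, rfl⟩ := Submodule.mem_sup.1 hmem
  have hz0 : z = 0 := by
    refine Submodule.disjoint_def.1 (A.eigenspaces_iSupIndep (n : ℂ)) z ?_ hz
    have := sub_mem (Module.End.mem_eigenspace_iff.2 hx : y + z ∈ A.eigenspace (n : ℂ)) hy.2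
    rwa [add_sub_cancel_left] at this
  have hy0 : S y + ((n.sign : ℤ) : ℂ) • y = 0 := hy.1
  rw [hz0, add_zero, neg_smul]
  exact eq_neg_of_add_eq_zero_left hy0

open Classical in
theorem standardSolution_sub :
    standardSolution B b e f Set.univ - standardSolution B b e f (diagRoots D)
      = ∑ α : H.root with b.IsPos α ∧ α ∉ diagRoots D,
        (rootNormSq B α / 2) • (ExteriorAlgebra.ι ℂ (e α) * ExteriorAlgebra.ι ℂ (f α)) := by
  rw [standardSolution, standardSolution, Finset.sum_filter, Finset.sum_filter, Finset.sum_filter,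
    ← Finset.sum_sub_distrib]
  refine Finset.sum_congr rfl fun α _ => ?_
  by_cases h1 : b.IsPos α <;> by_cases h2 : α ∈ diagRoots D <;> simp [h1, h2]

theorem IsGradingElement.exists_pos (hϖ : IsGradingElement b D ϖ) (hD : D ⊆ b.support)
    {α : H.root} (hα : b.IsPos α) :
    ∃ n : ℕ, α.1 ϖ = n ∧ (α ∉ diagRoots D ↔ 0 < n) := by
  obtain ⟨n, hn, h0⟩ := hϖ.exists_nat hα
  refine ⟨n, hn, ⟨fun h => Nat.pos_of_ne_zero fun hn0 => h (h0 hn0).1, fun h hm => ?_⟩⟩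
  obtain ⟨x, hx, hx0⟩ := α.1.exists_ne_zero
  have h1 : ⁅(ϖ : g), x⁆ = α.1 ϖ • x := lie_eq_smul_of_mem_rootSpace hx ϖ
  rw [hϖ.lie_diagSubalgebra hD (hm x hx), hn, eq_comm, smul_eq_zero] at h1
  exact h.ne' (by exact_mod_cast h1.resolve_right hx0)

open Classical in
-- B pairs a root space only with the opposite one. On the root space of α or -α, with α positive
-- outside R_D, a single summand survives, and `rootNormSq_mul` makes its coefficient -1 or 1; on H
-- and the root spaces of degree 0 nothing survives.
theorem IsGradingElement.isSignOperator (hϖ : IsGradingElement b D ϖ) (hD : D ⊆ b.support)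
    (hB : B.Nondegenerate) (hsymm : ∀ x y, B x y = B y x) (hinv : B.lieInvariant g)
    (hef : IsRootVectorFamily b e f) :
    IsSignOperator (ϖ : g) (bivectorEnd B {α : H.root | b.IsPos α ∧ α ∉ diagRoots D}
      (fun α => rootNormSq B α / 2) e f) := by
  refine isSignOperator_of_forall_weight fun χ n hn x hx => ?_
  have he : ∀ α : H.root, b.IsPos α → α ∉ diagRoots D → 0 ≤ n → B (e α) x = 0 := by
    intro α hα hαD h0
    obtain ⟨k, hk, hk'⟩ := hϖ.exists_pos hD hα
    refine eq_zero_of_mem_rootSpace_of_add_ne_zero hinv (fun h => ?_) (hef α hα).1 hx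
    have h1 := congrFun h ϖ
    rw [Pi.add_apply, hk, hn, Pi.zero_apply] at h1
    have h2 : (k : ℤ) + n = 0 := by exact_mod_cast h1
    have := hk'.1 hαD
    omega
  have hf : ∀ α : H.root, b.IsPos α → α ∉ diagRoots D → n ≤ 0 → B (f α) x = 0 := by
    intro α hα hαD h0
    obtain ⟨k, hk, hk'⟩ := hϖ.exists_pos hD hα
    refine eq_zero_of_mem_rootSpace_of_add_ne_zero hinv (fun h => ?_) (hef α hα).2.1 hx
    have h1 := congrFun h ϖ
    rw [Pi.add_apply, Pi.neg_apply, hk, hn, Pi.zero_apply] at h1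
    have h2 : -(k : ℤ) + n = 0 := by exact_mod_cast h1
    have := hk'.1 hαD
    omega
  have inj : ∀ α β : H.root, (α.1 : H → ℂ) = β.1 → α = β :=
    fun α β h => Subtype.ext (DFunLike.coe_injective h)
  rw [bivectorEnd_apply]
  rcases weight_cases b χ with h | ⟨α, hα, h⟩
  · have hn0 : n = 0 := by
      rw [h, Pi.zero_apply] at hn
      exact_mod_cast hn.symm
    rw [hn0, Int.sign_zero, Int.cast_zero, neg_zero, zero_smul]
    refine Finset.sum_eq_zero fun β hβ => ?_
    obtain ⟨hβ, hβD⟩ := (Finset.mem_filter.1 hβ).2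
    rw [he β hβ hβD hn0.ge, hf β hβ hβD hn0.le, zero_smul, zero_smul, sub_zero, smul_zero]
  obtain ⟨k, hk, hk'⟩ := hϖ.exists_pos hD hα
  by_cases hαD : α ∈ diagRoots D
  · have hk0 : k = 0 := by by_contra hk0; exact hk'.2 (Nat.pos_of_ne_zero hk0) hαD
    have hn0 : n = 0 := by
      rw [hk0, Nat.cast_zero] at hk
      rcases h with h | h
      · rw [h, hk] at hn
        exact_mod_cast hn.symm
      · rw [h, Pi.neg_apply, hk, neg_zero] at hn
        exact_mod_cast hn.symm
    rw [hn0, Int.sign_zero, Int.cast_zero, neg_zero, zero_smul]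
    refine Finset.sum_eq_zero fun β hβ => ?_
    obtain ⟨hβ, hβD⟩ := (Finset.mem_filter.1 hβ).2
    rw [he β hβ hβD hn0.ge, hf β hβ hβD hn0.le, zero_smul, zero_smul, sub_zero, smul_zero]
  have hk1 := hk'.1 hαD
  have hαs : α ∈ ({α : H.root | b.IsPos α ∧ α ∉ diagRoots D} : Finset H.root) :=
    Finset.mem_filter.2 ⟨Finset.mem_univ _, hα, hαD⟩
  have h1 := rootNormSq_mul hB hsymm hinv (hef α hα).1 (hef α hα).2.2
  have hnz : α.1.IsNonZero := H.isNonZero_coe_root α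
  rcases h with h | h
  · have hn0 : 0 < n := by
      rw [h, hk] at hn
      have : (k : ℤ) = n := by exact_mod_cast hn
      omega
    -- The normalisation forces B(e α, f α) ≠ 0, so e α spans its root space and x is a multiple of
    -- it.
    have he0 : e α ≠ 0 := fun h0 => by
      rw [h0, map_zero, LinearMap.zero_apply, mul_zero] at h1
      exact zero_ne_one h1
    obtain ⟨r, rfl⟩ := exists_smul_of_mem_rootSpace hnz (hef α hα).1 he0 (h ▸ hx)
    rw [Finset.sum_eq_single α, he α hα hαD hn0.le, Int.sign_eq_one_of_pos hn0, Int.cast_one,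
      zero_smul, zero_sub, smul_neg, neg_one_smul, map_smul, smul_smul, smul_eq_mul, hsymm,
      mul_left_comm, h1, mul_one]
    · intro β hβ hne
      obtain ⟨hβ, hβD⟩ := (Finset.mem_filter.1 hβ).2
      have hf0 : B (f β) (r • e α) = 0 := by
        refine eq_zero_of_mem_rootSpace_of_add_ne_zero hinv (fun h0 => hne ?_) (hef β hβ).2.1 hx
        rw [h, neg_add_eq_zero] at h0
        exact inj _ _ h0
      rw [he β hβ hβD hn0.le, hf0, zero_smul, zero_smul, sub_zero, smul_zero]
    · exact fun h0 => absurd hαs h0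
  · have hn0 : n < 0 := by
      rw [h, Pi.neg_apply, hk] at hn
      have : -(k : ℤ) = n := by exact_mod_cast hn
      omega
    have hf0 : f α ≠ 0 := fun h0 => by
      rw [h0, map_zero, mul_zero] at h1
      exact zero_ne_one h1
    obtain ⟨r, rfl⟩ := exists_smul_of_mem_rootSpace (α := -α.1) hnz.neg
      (by rw [Weight.coe_neg]; exact (hef α hα).2.1) hf0 (by rw [Weight.coe_neg]; exact h ▸ hx)
    rw [Finset.sum_eq_single α, hf α hα hαD hn0.le, Int.sign_eq_neg_one_of_neg hn0, Int.cast_neg,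
      Int.cast_one, zero_smul, sub_zero, neg_neg, one_smul, map_smul, smul_smul, smul_eq_mul,
      mul_left_comm, h1, mul_one]
    · intro β hβ hne
      obtain ⟨hβ, hβD⟩ := (Finset.mem_filter.1 hβ).2
      have he0 : B (e β) (r • f α) = 0 := by
        refine eq_zero_of_mem_rootSpace_of_add_ne_zero hinv (fun h0 => hne ?_) (hef β hβ).1 hx
        rw [h, ← sub_eq_add_neg, sub_eq_zero] at h0
        exact inj _ _ h0
      rw [hf β hβ hβD hn0.le, he0, zero_smul, zero_smul, sub_zero, smul_zero]
    · exact fun h0 => absurd hαs h0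

end Standard

/-! ### The cohomology of the twist -/

section Twist

variable {𝕜 L : Type*} [Field 𝕜] [LieRing L] [LieAlgebra 𝕜 L]

theorem exists_map_subtype {C l : Submodule 𝕜 L} (h : C ≤ l) (v : ExteriorAlgebra 𝕜 C) :
    ∃ u, ExteriorAlgebra.map l.subtype u = ExteriorAlgebra.map C.subtype v :=
  ⟨ExteriorAlgebra.map (Submodule.inclusion h) v, by
    rw [map_map_apply, Submodule.subtype_comp_inclusion]⟩

/-- The bivector `ρ` corresponds to the skew sign operator `S` of the grading by an element `ϖ`
which centralises `K`, and `K` contains the derived algebra of the centraliser of `ϖ`. -/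
structure IsSignBivector {κ : Type*} [Fintype κ] (B : LinearMap.BilinForm 𝕜 L)
    (K : LieSubalgebra 𝕜 L) (e e' : κ → L) (ϖ : L) (S : Module.End 𝕜 L)
    (ρ : ExteriorAlgebra 𝕜 L) : Prop where
  dualPair : IsDualPair B e e'
  symm : ∀ x y, B x y = B y x
  lieInvariant : B.lieInvariant L
  iSup_eigenspace : ⨆ n : ℤ, (LieAlgebra.ad 𝕜 L ϖ).eigenspace (n : 𝕜) = ⊤
  signOperator : IsSignOperator ϖ S
  skew : ∀ x y, B (S x) y = -B x (S y)
  schouten_eq : ∀ w, schouten ρ w = twistOp e e' S w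
  lie_eq_zero : ∀ x ∈ K, ⁅ϖ, x⁆ = 0
  lie_mem : ∀ x y : L, ⁅ϖ, x⁆ = 0 → ⁅ϖ, y⁆ = 0 → ⁅x, y⁆ ∈ K

namespace IsSignBivector

variable {κ : Type*} [Fintype κ] {B : LinearMap.BilinForm 𝕜 L}
  {K : LieSubalgebra 𝕜 L} {e e' : κ → L} {ϖ : L} {S : Module.End 𝕜 L}
  {ρ : ExteriorAlgebra 𝕜 L}

theorem schouten_mem_invariants (h : IsSignBivector B K e e' ϖ S ρ) {k : ℕ}
    {w : ExteriorAlgebra 𝕜 L} (hw : w ∈ invariants K k) :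
    schouten ρ w ∈ invariants K (k + 1) := by
  rw [mem_invariants] at hw ⊢
  rw [h.schouten_eq]
  refine ⟨twistOp_mem hw.1, fun x hx => ?_⟩
  rw [h.dualPair.adExt_twistOp h.symm h.lieInvariant
    (h.signOperator.lie_comm h.iSup_eigenspace (h.lie_eq_zero x hx)), hw.2 x hx, map_zero]

variable [CharZero 𝕜]

theorem schouten_schouten (h : IsSignBivector B K e e' ϖ S ρ) {k : ℕ}
    {w : ExteriorAlgebra 𝕜 L} (hw : w ∈ invariants K k) : schouten ρ (schouten ρ w) = 0 := by
  rw [h.schouten_eq, h.schouten_eq]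
  exact h.dualPair.twistOp_twistOp h.symm h.lieInvariant fun x y => (mem_invariants.1 hw).2 _
    (h.signOperator.lie_sub_mem h.iSup_eigenspace (K := K.toSubmodule) h.lie_mem x y)

/-- The differential is an antiderivation and kills each X commuting with ϖ, since S commutes with
ad X. -/
theorem schouten_map_subtype (h : IsSignBivector B K e e' ϖ S ρ)
    (v : ExteriorAlgebra 𝕜 (LinearMap.ker (LieAlgebra.ad 𝕜 L ϖ))) :
    schouten ρ (ExteriorAlgebra.map (LinearMap.ker (LieAlgebra.ad 𝕜 L ϖ)).subtype v) = 0 := by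
  rw [h.schouten_eq]
  induction v using left_induction with
  | one r => rw [map_smul, map_one, map_smul, twistOp_one, smul_zero]
  | add a b ha hb => rw [map_add, map_add, ha, hb, add_zero]
  | ι_mul a X ha =>
    rw [map_ι_mul, Submodule.subtype_apply, twistOp_ι_mul, ha, mul_zero, sub_zero,
      h.dualPair.twistOp_ι_eq_zero h.symm h.lieInvariant h.skew
        (h.signOperator.lie_comm h.iSup_eigenspace X.2), zero_mul]

theorem extDer_eq_zero_iff (h : IsSignBivector B K e e' ϖ S ρ) {w : ExteriorAlgebra 𝕜 L} :
    extDer (-(S ∘ₗ LieAlgebra.ad 𝕜 L ϖ)) w = 0 ↔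
      ∃ v, ExteriorAlgebra.map (LinearMap.ker (LieAlgebra.ad 𝕜 L ϖ)).subtype v = w := by
  have := RelTwist.extDer_eq_zero_iff (h.signOperator.iSup_eigenspace_eq_top h.iSup_eigenspace)
    (w := w)
  rwa [h.signOperator.ker_eq h.iSup_eigenspace] at this

variable [FiniteDimensional 𝕜 L]

/-- Contraction with B ϖ is the homotopy; the resulting T has kernel ⋀ l with l the centraliser of
ϖ. It remains only to parametrise the K-invariants of ⋀ l, which is the role of J. -/
theorem exists_cohomology_equiv (h : IsSignBivector B K e e' ϖ S ρ) {k : ℕ}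
    {M : Type*} [AddCommGroup M] [Module 𝕜 M] (J : M →ₗ[𝕜] ExteriorAlgebra 𝕜 L)
    (hJ : Function.Injective J) (hJK : ∀ m, J m ∈ invariants K (k + 1))
    (hJl : ∀ m, ∃ v,
      ExteriorAlgebra.map (LinearMap.ker (LieAlgebra.ad 𝕜 L ϖ)).subtype v = J m)
    (hJs : ∀ w ∈ invariants K (k + 1),
      (∃ v, ExteriorAlgebra.map (LinearMap.ker (LieAlgebra.ad 𝕜 L ϖ)).subtype v = w) →
        ∃ m, J m = w) :
    ∃ φ : M ≃ₗ[𝕜] Cohomology ρ K (k + 1), ∀ m, ∃ z : cocycles ρ K (k + 1),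
      (z : ExteriorAlgebra 𝕜 L) = J m ∧ φ m = cohomologyClass ρ K (k + 1) z := by
  have hA := h.signOperator.iSup_eigenspace_eq_top h.iSup_eigenspace
  have hKϖ : ∀ x ∈ K, ⁅x, ϖ⁆ = 0 := fun x hx => by
    rw [← lie_skew, h.lie_eq_zero x hx, neg_zero]
  refine RelTwist.exists_cohomology_equiv (i := contract (B ϖ))
    (T := extDer (-(S ∘ₗ LieAlgebra.ad 𝕜 L ϖ)))
    (fun k a ha => ⟨h.schouten_mem_invariants ha, h.schouten_schouten ha⟩)
    (fun k a ha => contract_mem_invariants h.lieInvariant hKϖ ha)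
    (fun a ha => contract_of_mem_zero _ (mem_invariants.1 ha).1) (fun w => ?_) (fun k a ha => ?_)
    (fun w hw => ?_) (fun w => extDer_eq_zero_of_extDer_extDer hA) J hJ hJK
    (fun m => h.extDer_eq_zero_iff.2 (hJl m)) fun w hw hw0 => hJs w hw (h.extDer_eq_zero_iff.1 hw0)
  · rw [h.schouten_eq, h.schouten_eq, h.dualPair.contract_twistOp h.symm h.lieInvariant h.skew
      (h.signOperator.apply_eq_zero (lie_self ϖ)), extDer_neg, LinearMap.neg_apply]
  · rw [mem_invariants] at ha ⊢
    refine ⟨extDer_mem _ ha.1, fun x hx => ?_⟩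
    -- T preserves invariants because ad x, for x in K, commutes with both S and ad ϖ.
    have hc : LieAlgebra.ad 𝕜 L x * -(S ∘ₗ LieAlgebra.ad 𝕜 L ϖ)
        - -(S ∘ₗ LieAlgebra.ad 𝕜 L ϖ) * LieAlgebra.ad 𝕜 L x = 0 := by
      ext y
      have h1 : ⁅ϖ, ⁅x, y⁆⁆ = ⁅x, ⁅ϖ, y⁆⁆ := by
        rw [leibniz_lie, h.lie_eq_zero x hx, zero_lie, zero_add]
      have h2 := h.signOperator.lie_comm h.iSup_eigenspace (h.lie_eq_zero x hx) ⁅ϖ, y⁆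
      rw [LinearMap.sub_apply, Module.End.mul_apply, Module.End.mul_apply, LinearMap.neg_apply,
        LinearMap.neg_apply, LinearMap.comp_apply, LinearMap.comp_apply, LieAlgebra.ad_apply,
        LieAlgebra.ad_apply, LieAlgebra.ad_apply, LieAlgebra.ad_apply, h1, h2, lie_neg, sub_self,
        LinearMap.zero_apply]
    have h1 := extDer_comp_sub (LieAlgebra.ad 𝕜 L x) (-(S ∘ₗ LieAlgebra.ad 𝕜 L ϖ)) a
    rw [hc, extDer_zero, LinearMap.zero_apply, sub_eq_zero] at h1
    have h2 : extDer (LieAlgebra.ad 𝕜 L x) a = 0 := ha.2 x hx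
    rw [h2, map_zero] at h1
    exact h1
  · obtain ⟨v, rfl⟩ := h.extDer_eq_zero_iff.1 hw
    exact h.schouten_map_subtype v

variable {C : Submodule 𝕜 L} {p q : Module.End 𝕜 L}

theorem exists_cohomology_equiv_one (h : IsSignBivector B K e e' ϖ S ρ)
    (hd : IsLeviDecomposition B K C (LinearMap.ker (LieAlgebra.ad 𝕜 L ϖ)) p q)
    (hC : C ≤ LinearMap.ker (LieAlgebra.ad 𝕜 L ϖ)) :
    ∃ φ : C ≃ₗ[𝕜] Cohomology ρ K 1, ∀ w : C, ∃ z : cocycles ρ K 1,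
      (z : ExteriorAlgebra 𝕜 L) = ExteriorAlgebra.ι 𝕜 (w : L) ∧
        φ w = cohomologyClass ρ K 1 z := by
  have hι : ∀ w : C, ExteriorAlgebra.map C.subtype (ExteriorAlgebra.ι 𝕜 w)
      = ExteriorAlgebra.ι 𝕜 (w : L) := fun w => ExteriorAlgebra.map_apply_ι _ _
  refine h.exists_cohomology_equiv (ExteriorAlgebra.ι 𝕜 ∘ₗ C.subtype)
    (fun x y hxy => Subtype.ext ((ExteriorAlgebra.ι_inj 𝕜 _ _).1 hxy)) (fun w => ?_) (fun w => ?_)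
    fun w hw hwl => ?_
  · rw [LinearMap.comp_apply, Submodule.subtype_apply, ← hι]
    exact hd.map_subtype_center_mem (ι_mem_exteriorPower_one w)
  · rw [LinearMap.comp_apply, Submodule.subtype_apply, ← hι]
    exact exists_map_subtype hC _
  · obtain ⟨c, hc⟩ := mem_exteriorPower_one.1 (map_mem hd.toCenter (mem_invariants.1 hw).1)
    refine ⟨c, ?_⟩
    rw [LinearMap.comp_apply, Submodule.subtype_apply, ← hι, hc, hd.map_toCenter,
      hd.map_p_eq_self_of_one h.dualPair h.symm h.lieInvariant hw hwl]

theorem exists_cohomology_equiv_two (h : IsSignBivector B K e e' ϖ S ρ)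
    (hd : IsLeviDecomposition B K C (LinearMap.ker (LieAlgebra.ad 𝕜 L ϖ)) p q)
    (hC : C ≤ LinearMap.ker (LieAlgebra.ad 𝕜 L ϖ)) :
    ∃ φ : (⋀[𝕜]^2 C) ≃ₗ[𝕜] Cohomology ρ K 2, ∀ w : (⋀[𝕜]^2 C), ∃ z : cocycles ρ K 2,
      (z : ExteriorAlgebra 𝕜 L) = ExteriorAlgebra.map C.subtype (w : ExteriorAlgebra 𝕜 C) ∧
        φ w = cohomologyClass ρ K 2 z := by
  refine h.exists_cohomology_equiv
    ((ExteriorAlgebra.map C.subtype).toLinearMap ∘ₗ (⋀[𝕜]^2 C).subtype)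
    (fun x y hxy => Subtype.ext ?_) (fun w => hd.map_subtype_center_mem w.2)
    (fun w => exists_map_subtype hC _) fun w hw hwl => ?_
  · have := congrArg (ExteriorAlgebra.map hd.toCenter) hxy
    change ExteriorAlgebra.map hd.toCenter (ExteriorAlgebra.map C.subtype x)
      = ExteriorAlgebra.map hd.toCenter (ExteriorAlgebra.map C.subtype y) at this
    rwa [hd.map_toCenter_map_subtype, hd.map_toCenter_map_subtype] at this
  · refine ⟨⟨_, map_mem hd.toCenter (mem_invariants.1 hw).1⟩, ?_⟩
    change ExteriorAlgebra.map C.subtype (ExteriorAlgebra.map hd.toCenter w) = w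
    rw [hd.map_toCenter, hd.map_p_eq_self_of_two h.dualPair h.symm h.lieInvariant hw hwl]

theorem exists_cohomology_equiv_three (h : IsSignBivector B K e e' ϖ S ρ)
    (hd : IsLeviDecomposition B K C (LinearMap.ker (LieAlgebra.ad 𝕜 L ϖ)) p q)
    (hC : C ≤ LinearMap.ker (LieAlgebra.ad 𝕜 L ϖ)) :
    ∃ φ : ((⋀[𝕜]^3 C) × invariants (⊤ : LieSubalgebra 𝕜 K) 3) ≃ₗ[𝕜] Cohomology ρ K 3,
      ∀ w, ∃ z : cocycles ρ K 3,
        (z : ExteriorAlgebra 𝕜 L) = ExteriorAlgebra.map C.subtype (w.1 : ExteriorAlgebra 𝕜 C)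
          + ExteriorAlgebra.map K.toSubmodule.subtype (w.2 : ExteriorAlgebra 𝕜 K) ∧
        φ w = cohomologyClass ρ K 3 z := by
  let J : ((⋀[𝕜]^3 C) × invariants (⊤ : LieSubalgebra 𝕜 K) 3) →ₗ[𝕜] ExteriorAlgebra 𝕜 L :=
    ((ExteriorAlgebra.map C.subtype).toLinearMap ∘ₗ (⋀[𝕜]^3 C).subtype).coprod
      ((ExteriorAlgebra.map K.toSubmodule.subtype).toLinearMap ∘ₗ Submodule.subtype _)
  have hJ : ∀ w, J w = ExteriorAlgebra.map C.subtype (w.1 : ExteriorAlgebra 𝕜 C)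
      + ExteriorAlgebra.map K.toSubmodule.subtype (w.2 : ExteriorAlgebra 𝕜 K) := fun _ => rfl
  refine h.exists_cohomology_equiv J ?_ (fun w => ?_) (fun w => ?_) fun w hw hwl => ?_
  · rw [← LinearMap.ker_eq_bot, LinearMap.ker_eq_bot']
    rintro ⟨⟨v, hv⟩, ⟨u, hu⟩⟩ h0
    rw [hJ] at h0
    -- Projecting to ⋀ C kills the K-summand, which has positive degree, and isolates the first
    -- component; projecting to ⋀ K then gives the second.
    have h1 := congrArg (ExteriorAlgebra.map hd.toCenter) h0
    rw [map_add, hd.map_toCenter_map_subtype,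
      hd.map_toCenter_map_subalgebra (mem_invariants.1 hu).1, add_zero, map_zero] at h1
    subst h1
    rw [map_zero, zero_add] at h0
    have h2 := congrArg (ExteriorAlgebra.map hd.toSubalgebra) h0
    rw [hd.map_toSubalgebra_map_subtype, map_zero] at h2
    subst h2
    rfl
  · exact add_mem (hd.map_subtype_center_mem w.1.2)
      (IsLeviDecomposition.map_subtype_subalgebra_mem w.2.2)
  · obtain ⟨v, hv⟩ := exists_map_subtype hC (w.1 : ExteriorAlgebra 𝕜 C)
    obtain ⟨u, hu⟩ := exists_map_subtype (C := K.toSubmodule)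
      (l := LinearMap.ker (LieAlgebra.ad 𝕜 L ϖ)) (fun x hx => h.lie_eq_zero x hx)
      (w.2 : ExteriorAlgebra 𝕜 K)
    exact ⟨v + u, by rw [map_add, hv, hu, hJ]⟩
  · refine ⟨⟨⟨_, map_mem hd.toCenter (mem_invariants.1 hw).1⟩,
      ⟨_, hd.map_toSubalgebra_mem hw⟩⟩, ?_⟩
    rw [hJ]
    change ExteriorAlgebra.map C.subtype (ExteriorAlgebra.map hd.toCenter w)
      + ExteriorAlgebra.map K.toSubmodule.subtype (ExteriorAlgebra.map hd.toSubalgebra w) = w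
    rw [hd.map_toCenter, hd.map_toSubalgebra,
      hd.map_p_add_map_q h.dualPair h.symm h.lieInvariant hw hwl]

end IsSignBivector

end Twist

theorem exists_isSignBivector {g : Type*} [LieRing g] [LieAlgebra ℂ g] [FiniteDimensional ℂ g]
    [LieAlgebra.IsSemisimple ℂ g] {H : LieSubalgebra ℂ g} [H.IsCartanSubalgebra]
    {b : (LieAlgebra.IsKilling.rootSystem H).Base} {D : Finset H.root} (hD : D ⊆ b.support)
    {B : LinearMap.BilinForm ℂ g} (hB : B.Nondegenerate) (hsymm : ∀ x y, B x y = B y x)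
    (hinv : B.lieInvariant g) {e f : H.root → g} (hef : IsRootVectorFamily b e f)
    {ϖ : H} (hϖ : IsGradingElement b D ϖ) :
    ∃ (ε ε' : Fin (Module.finrank ℂ g) → g) (S : Module.End ℂ g),
      IsSignBivector B (diagSubalgebra D) ε ε' (ϖ : g) S
        (standardSolution B b e f Set.univ - standardSolution B b e f (diagRoots D)) := by
  obtain ⟨ε, ε', hε⟩ := exists_isDualPair hB hsymm
  exact ⟨ε, ε', _,
    { dualPair := hε
      symm := hsymm
      lieInvariant := hinv
      iSup_eigenspace := hϖ.iSup_eigenspace_eq_top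
      signOperator := hϖ.isSignOperator hD hB hsymm hinv hef
      skew := bivectorEnd_skew hsymm
      schouten_eq := fun w => by rw [standardSolution_sub]; exact hε.schouten_eq_twistOp w
      lie_eq_zero := fun x hx => hϖ.lie_diagSubalgebra hD hx
      lie_mem := fun x y => hϖ.lie_mem_diagSubalgebra hD }⟩

end RelTwist

end

theorem mainTheorem5
    {g : Type*} [LieRing g] [LieAlgebra ℂ g] [FiniteDimensional ℂ g]
    [LieAlgebra.IsSemisimple ℂ g]
    -- a Cartan subalgebra, a choice of simple roots, and a subdiagram of the Dynkin diagram
    (H : LieSubalgebra ℂ g) [H.IsCartanSubalgebra]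
    (b : (LieAlgebra.IsKilling.rootSystem H).Base)
    (D : Finset H.root) (hD : D ⊆ b.support)
    -- a nondegenerate, ad-invariant, symmetric bilinear form on `g`
    (B : LinearMap.BilinForm ℂ g) (hB : B.Nondegenerate) (hBsymm : B.IsSymm)
    (hBinv : B.lieInvariant g)
    -- root vectors normalised by `[e α, f α] = h α`
    (e f : H.root → g) (hef : RelTwist.IsRootVectorFamily b e f)
    -- the difference `ρ = r_g - r_D` of the standard solutions
    (ρ : ExteriorAlgebra ℂ g)
    (hρ : ρ = RelTwist.standardSolution B b e f Set.univ
      - RelTwist.standardSolution B b e f (RelTwist.diagRoots D)) :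
    -- `((⋀ g)^{g_D}, ⟦ρ, ·⟧)` is a complex
    (∀ (k : ℕ), ∀ a ∈ RelTwist.invariants (RelTwist.diagSubalgebra D) k,
      RelTwist.schouten ρ a ∈ RelTwist.invariants (RelTwist.diagSubalgebra D) (k + 1) ∧
      RelTwist.schouten ρ (RelTwist.schouten ρ a) = 0) ∧
    -- `H¹ ≅ c_D`
    (∃ φ : RelTwist.leviCenter D ≃ₗ[ℂ] RelTwist.Cohomology ρ (RelTwist.diagSubalgebra D) 1,
      ∀ w : RelTwist.leviCenter D, ∃ z : RelTwist.cocycles ρ (RelTwist.diagSubalgebra D) 1,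
        (z : ExteriorAlgebra ℂ g) = ExteriorAlgebra.ι ℂ (w : g) ∧
        φ w = RelTwist.cohomologyClass ρ (RelTwist.diagSubalgebra D) 1 z) ∧
    -- `H² ≅ ⋀² c_D`
    (∃ φ : (⋀[ℂ]^2 (RelTwist.leviCenter D)) ≃ₗ[ℂ]
        RelTwist.Cohomology ρ (RelTwist.diagSubalgebra D) 2,
      ∀ w : (⋀[ℂ]^2 (RelTwist.leviCenter D)), ∃ z : RelTwist.cocycles ρ (RelTwist.diagSubalgebra D) 2,
        (z : ExteriorAlgebra ℂ g)
          = ExteriorAlgebra.map (RelTwist.leviCenter D).subtype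
              (w : ExteriorAlgebra ℂ (RelTwist.leviCenter D)) ∧
        φ w = RelTwist.cohomologyClass ρ (RelTwist.diagSubalgebra D) 2 z) ∧
    -- `H³ ≅ ⋀³ c_D ⊕ (⋀³ g_D)^{g_D}`
    (∃ φ : ((⋀[ℂ]^3 (RelTwist.leviCenter D)) ×
          RelTwist.invariants (⊤ : LieSubalgebra ℂ (RelTwist.diagSubalgebra D)) 3) ≃ₗ[ℂ]
        RelTwist.Cohomology ρ (RelTwist.diagSubalgebra D) 3,
      ∀ w, ∃ z : RelTwist.cocycles ρ (RelTwist.diagSubalgebra D) 3,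
        (z : ExteriorAlgebra ℂ g)
          = ExteriorAlgebra.map (RelTwist.leviCenter D).subtype
              (w.1 : ExteriorAlgebra ℂ (RelTwist.leviCenter D))
            + ExteriorAlgebra.map (RelTwist.diagSubalgebra D).toSubmodule.subtype
              (w.2 : ExteriorAlgebra ℂ (RelTwist.diagSubalgebra D)) ∧
        φ w = RelTwist.cohomologyClass ρ (RelTwist.diagSubalgebra D) 3 z) := by
  have hsymm : ∀ x y, B x y = B y x := fun x y => hBsymm.eq x y
  obtain ⟨ϖ, hϖ⟩ := RelTwist.exists_grading_element b D
  obtain ⟨ε, ε', S, h⟩ := RelTwist.exists_isSignBivector hD hB hsymm hBinv hef hϖ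
  rw [← hρ] at h
  obtain ⟨p, q, hd⟩ :=
    RelTwist.IsGradingElement.exists_isLeviDecomposition hϖ hD hB hsymm hBinv
  have hC : RelTwist.leviCenter D ≤ LinearMap.ker (LieAlgebra.ad ℂ g (ϖ : g)) := fun x hx =>
    (RelTwist.IsGradingElement.mem_leviSubalgebra_iff hϖ hD).1 (RelTwist.mem_leviCenter.1 hx).1
  exact ⟨fun k a ha => ⟨h.schouten_mem_invariants ha, h.schouten_schouten ha⟩,
    h.exists_cohomology_equiv_one hd hC, h.exists_cohomology_equiv_two hd hC,
    h.exists_cohomology_equiv_three hd hC⟩
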